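/- **Setting.** For each $n\ge 1$ there are $n$ units with potential outcome vectors $a,b\in\mathbb R^n$, sum vector $\mu=a+b$, and a covariate matrix $X\in\mathbb R^{n\times d}$ with rows $x_1,\dots,x_n$; $\xi=\max_i\|x_i\|$, and $\phi\in(0,1)$ is the robustness parameter. The number $d\ge 1$ is fixed, while $a,b,X,\phi$ may depend on $n$. Let $\tau=\frac1n\sum_i(a_i-b_i)$ and, for a random design vector $z\in\{\pm1\}^n$, $$\hat\tau=\frac1n\Big(\sum_{i:z_i=1}\frac{a_i}{\mathbb P[z_i=1]}-\sum_{i:z_i=-1}\frac{b_i}{\mathbb P[z_i=-1]}\Big).$$ Write $\mu=X\beta_{\rm ls}+v$, where $v={\rm Proj}_{{\rm ColSp}(X)^\perp}(\mu)$. **Gram–Schmidt Walk design (randomized pivot order).** Let $B=\begin{pmatrix}\sqrt\phi\, I_n\\ \xi^{-1}\sqrt{1-\phi}\,X^{\mathsf T}\end{pmatrix}$. Start with $z_0=0\in\mathbb R^n$ and $A_1=\{1,\dots,n\}$. In rounds $t=1,\dots,n$, as long as $A_t\neq\emptyset$ (otherwise $z_t=z_{t-1}$ and $A_{t+1}=\emptyset$):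 1. If $t>1$ and the previous pivot $p_{t-1}$ lies in $A_t$, put $p_t=p_{t-1}$; otherwise choose $p_t$ uniformly at random from $A_t$. 2. Let $u_t$ be the minimizer of $\|Bu\|^2$ over the $u\in\mathbb R^n$ with $u[i]=0$ for $i\notin A_t$ and $u[p_t]=1$. 3. Let $\Delta=\{\delta\in\mathbb R: z_{t-1}+\delta u_t\in[-1,1]^n\}$, $\delta^+=|\sup\Delta|$, $\delta^-=|\inf\Delta|$; let $\delta_t=\delta^+$ with probability $\frac{\delta^-}{\delta^++\delta^-}$ and $\delta_t=-\delta^-$ with probability $\frac{\delta^+}{\delta^++\delta^-}$. 4. Put $z_t=z_{t-1}+\delta_tu_t$ and $A_{t+1}=\{i\in A_t:|z_t[i]|<1\}$. The design vector is $z=z_n$, and $\hat\tau_{\rm GSW}$ is $\hat\tau$ for this design. **Theorem 1.2.** Suppose that there are positive constants $c,C$, not depending on $n$, such that for all sufficiently large $n$ * (outcome regularity) $\dfrac{\|v\|_\infty}{\|v\|}\le\dfrac{C}{\log^{3+c}n}$ and $\|\beta_{\rm ls}\|^2\le C\log n$; * (covariate regularity) $\sigma_{\min}(X)\ge\sqrt{cn}$,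 where $\sigma_{\min}(X)$ is the smallest singular value of $X$, and $\xi^2\le C\,d\log n$; * (non-degeneracy) $\|v\|^2\ge\log^{2+c}n$. Suppose also that $\phi$ is bounded away from $0$ and $1$ (uniformly in $n$). Then, as $n\to\infty$, $$\frac{\hat\tau_{\rm GSW}-\tau}{\sqrt{{\rm Var}[\hat\tau_{\rm GSW}]}}\longrightarrow N(0,1)\ \text{ in law,}\qquad\text{and}\qquad \frac{{\rm Var}[\hat\tau_{\rm GSW}]}{\|v\|^2/n^2}\longrightarrow 1 .$$ -/

import Mathlib

open Filter Topology MeasureTheory ProbabilityTheory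

noncomputable section

namespace GSW

/-- `ℝᵏ` with its Euclidean norm. -/
abbrev Vec (k : ℕ) : Type := EuclideanSpace ℝ (Fin k)

/-! ### Linear algebra of the covariates -/

/-- The `i`-th row `xᵢ ∈ ℝᵈ` of the covariate matrix. -/
def covariate {n d : ℕ} (X : Matrix (Fin n) (Fin d) ℝ) (i : Fin n) : Vec d :=
  WithLp.toLp 2 (X i)

/-- `ξ = maxᵢ ‖xᵢ‖`, the maximal row norm of the covariate matrix. -/
def maxRowNorm {n d : ℕ} (X : Matrix (Fin n) (Fin d) ℝ) : ℝ :=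
  ⨆ i : Fin n, ‖covariate X i‖

/-- The column space of `X`. -/
def colSpace {n d : ℕ} (X : Matrix (Fin n) (Fin d) ℝ) : Submodule ℝ (Vec n) :=
  LinearMap.range (Matrix.toEuclideanLin X)

/-- `v`, the orthogonal projection of `μ` onto the orthogonal complement of the column space
of `X`. -/
def residual {n d : ℕ} (X : Matrix (Fin n) (Fin d) ℝ) (μ : Vec n) : Vec n :=
  (colSpace X)ᗮ.starProjection μ

/-- The smallest (that is, the `d`-th largest) singular value of the `n × d` matrix `X`.
Mathlib lists singular values in decreasing order, starting from index `0`. -/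
def sigmaMin {n d : ℕ} (X : Matrix (Fin n) (Fin d) ℝ) : ℝ :=
  (Matrix.toEuclideanLin X).singularValues (d - 1)

/-- The sup-norm `‖w‖∞ = maxᵢ |wᵢ|` of a vector. -/
def supNorm {n : ℕ} (w : Vec n) : ℝ := ⨆ i : Fin n, |w i|

/-! ### The Gram–Schmidt Walk with randomized pivot order -/

/-- The `(n + d) × n` matrix obtained by stacking `√φ Iₙ` on top of `ξ⁻¹ √(1 - φ) Xᵀ`. -/
def augmented {n d : ℕ} (φ : ℝ) (X : Matrix (Fin n) (Fin d) ℝ) :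
    Matrix (Fin n ⊕ Fin d) (Fin n) ℝ :=
  Matrix.fromRows (√φ • (1 : Matrix (Fin n) (Fin n) ℝ))
    (((maxRowNorm X)⁻¹ * √(1 - φ)) • X.transpose)

section Walk

variable {n d : ℕ}

/-- The constraints on a step direction: `u` vanishes off the active set `A`, and `u[p] = 1`. -/
def feasible (A : Finset (Fin n)) (p : Fin n) : Set (Vec n) :=
  {u | (∀ i, i ∉ A → u i = 0) ∧ u p = 1}

open Classical in
/-- The step direction: the minimizer of `‖B u‖²` over the feasible vectors. (It exists and is
unique whenever `p ∈ A` and `B` has full column rank, so for `B = augmented φ X` with `0 < φ`;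
the value `0` is a placeholder.) -/
def stepDirection (B : Matrix (Fin n ⊕ Fin d) (Fin n) ℝ) (A : Finset (Fin n)) (p : Fin n) :
    Vec n :=
  if h : ∃ u ∈ feasible A p, IsMinOn (fun w => ‖Matrix.toEuclideanLin B w‖ ^ 2) (feasible A p) u
  then h.choose else 0

/-- `Δ = {δ : z + δ u ∈ [-1, 1]ⁿ}`. -/
def stepRange (z u : Vec n) : Set ℝ :=
  {δ | ∀ i, (z + δ • u) i ∈ Set.Icc (-1 : ℝ) 1}

/-- `δ⁺ = |sup Δ|`. -/
def deltaPlus (z u : Vec n) : ℝ := |sSup (stepRange z u)|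

/-- `δ⁻ = |inf Δ|`. -/
def deltaMinus (z u : Vec n) : ℝ := |sInf (stepRange z u)|

lemma ratio_mem (z u : Vec n) :
    deltaMinus z u / (deltaPlus z u + deltaMinus z u) ∈ Set.Icc (0 : ℝ) 1 := by
  have h1 : 0 ≤ deltaPlus z u := abs_nonneg _
  have h2 : 0 ≤ deltaMinus z u := abs_nonneg _
  exact ⟨by positivity, div_le_one_of_le₀ (by linarith) (by linarith)⟩

/-- The coin that shows `true` with probability `p` and `false` with probability `1 - p`. -/
def coin (p : ℝ) (hp : p ∈ Set.Icc (0 : ℝ) 1) : PMF Bool :=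
  PMF.ofFintype (fun b => if b then ENNReal.ofReal p else ENNReal.ofReal (1 - p)) (by
    have h1 : (0 : ℝ) ≤ 1 - p := by linarith [hp.2]
    simp [← ENNReal.ofReal_add hp.1 h1])

/-- The law of the random step size: `δ⁺` with probability `δ⁻ / (δ⁺ + δ⁻)`, and `-δ⁻` with the
complementary probability `δ⁺ / (δ⁺ + δ⁻)`. -/
def stepSize (z u : Vec n) : PMF ℝ :=
  (coin (deltaMinus z u / (deltaPlus z u + deltaMinus z u)) (ratio_mem z u)).map
    (fun b => if b then deltaPlus z u else -deltaMinus z u)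

/-- The law of the next pivot: the previous pivot is kept while it is active; otherwise (and in
the first round, where there is no previous pivot) the pivot is uniform on the active set. -/
def nextPivot (A : Finset (Fin n)) (hA : A.Nonempty) : Option (Fin n) → PMF (Fin n)
  | none => PMF.uniformOfFinset A hA
  | some q => if q ∈ A then PMF.pure q else PMF.uniformOfFinset A hA

/-- State of the walk between two rounds: fractional assignment, active set, last pivot. -/
structure State (n : ℕ) where
  z : Vec n
  active : Finset (Fin n)
  pivot : Option (Fin n)

/-- The initial state: zero assignment, all units active, no pivot yet. -/
def State.init (n : ℕ) : State n := ⟨0, Finset.univ, none⟩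

/-- The state after moving along `u` by `δ` with pivot `p`: the units whose coordinate has
reached `±1` leave the active set. -/
def State.update (s : State n) (p : Fin n) (u : Vec n) (δ : ℝ) : State n :=
  ⟨s.z + δ • u, s.active.filter (fun i => |(s.z + δ • u) i| < 1), some p⟩

/-- One round of the walk. Nothing happens once the active set is empty. -/
def step (B : Matrix (Fin n ⊕ Fin d) (Fin n) ℝ) (s : State n) : PMF (State n) :=
  if hA : s.active.Nonempty then
    (nextPivot s.active hA s.pivot).bind fun p =>
      (stepSize s.z (stepDirection B s.active p)).map fun δ =>
        s.update p (stepDirection B s.active p) δ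
  else PMF.pure s

/-- The law of the state after `t` rounds. -/
def run (B : Matrix (Fin n ⊕ Fin d) (Fin n) ℝ) : ℕ → PMF (State n)
  | 0 => PMF.pure (State.init n)
  | t + 1 => (run B t).bind (step B)

/-- The Gram–Schmidt Walk design with robustness parameter `φ` and covariates `X`: the law of the
assignment vector `zₙ` after `n` rounds. -/
def design (φ : ℝ) (X : Matrix (Fin n) (Fin d) ℝ) : Measure (Vec n) :=
  ((run (augmented φ X) n).map State.z).toMeasure

instance (φ : ℝ) (X : Matrix (Fin n) (Fin d) ℝ) : IsProbabilityMeasure (design φ X) := by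
  unfold design; infer_instance

end Walk

/-! ### The Horvitz–Thompson estimator -/

/-- The average treatment effect `τ = n⁻¹ ∑ᵢ (aᵢ - bᵢ)`. -/
def ate {n : ℕ} (a b : Vec n) : ℝ := (1 / n : ℝ) * ∑ i, (a i - b i)

/-- The Horvitz–Thompson estimator of the average treatment effect, as a function of the
assignment vector `z`, which is drawn from the law `P`. -/
def horvitzThompson {n : ℕ} (P : Measure (Vec n)) (a b : Vec n) (z : Vec n) : ℝ :=
  (1 / n : ℝ) * (∑ i with z i = 1, a i / P.real {w | w i = 1}
    - ∑ i with z i = -1, b i / P.real {w | w i = -1})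

/-! ### The regularity assumptions -/

/-- Outcome regularity, for residuals `v n` and least squares coefficients `β n`. -/
def OutcomeRegularity {d : ℕ} (v : ∀ n : ℕ, Vec n) (β : ℕ → Vec d) : Prop :=
  ∃ c > (0 : ℝ), ∃ C > (0 : ℝ), ∀ᶠ n : ℕ in atTop,
    supNorm (v n) / ‖v n‖ ≤ C / Real.log n ^ (3 + c) ∧ ‖β n‖ ^ 2 ≤ C * Real.log n

/-- Covariate regularity. -/
def CovariateRegularity {d : ℕ} (X : ∀ n : ℕ, Matrix (Fin n) (Fin d) ℝ) : Prop :=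
  ∃ c > (0 : ℝ), ∃ C > (0 : ℝ), ∀ᶠ n : ℕ in atTop,
    √(c * n) ≤ sigmaMin (X n) ∧ maxRowNorm (X n) ^ 2 ≤ C * d * Real.log n

/-- Non-degeneracy. -/
def NonDegeneracy (v : ∀ n : ℕ, Vec n) : Prop :=
  ∃ c > (0 : ℝ), ∀ᶠ n : ℕ in atTop, Real.log n ^ (2 + c) ≤ ‖v n‖ ^ 2

end GSW

end

/-!
Every unit is treated with probability `1/2`, so the centred Horvitz–Thompson estimator is the
linear statistic `⟪z, a + b⟫ / n` of the assignment (`horvitzThompson_sub_ate`). Split `a + b`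
into `X β` and the residual, normalized to a unit vector `v`.

*Covariance bound.* The walk is a martingale whose total fluctuation is controlled by an
orthogonal projection: the expected square of a linear functional `⟪B z, w⟫` of the final
assignment, minus its square at the present state, is at most the squared norm of the projection
of `w` to the span of the active columns of `B` (`expect_walkFrom_sq_le_varianceBound`). The proof
is a backward induction; a pivot phase is accounted for by the Gram–Schmidt exchange step
`norm_sq_starProjection_exchange`. Applied from the start it gives
`E ⟪Xᵀ z, β⟫² ≤ ξ² ‖β‖² / (1 - φ)`, which is negligible against the squared norm of the residual.
Applied from a later state with active set `A` it bounds the remaining variance of `⟪z, v⟫` by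
`∑ i ∈ A, v i ² / φ`.

*Good states.* While the active set `A` is large, its Gram matrix is well conditioned and all
active coordinates are small, the step direction moves every coordinate except that of the pivot
by `O(ξ² / |A|)`. Then every round decides exactly the pivot, so active sets evolve by deleting a
uniformly random element. The increment of `⟪z, v⟫` has conditional variance close to `v p ²`, up
to the square of a defect `⟪u, v⟫ - v p`, which is small because `v` is orthogonal to the columns
of `X` (`Good.defect_sq_le`). Hence the conditional characteristic function of the remaining
increment is close to `exp (-θ² ∑ i ∈ A, v i ² / 2)`.

*Potential.* The errors are summed by comparison with a supermartingale, `potential`. It has an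
exponential part, which detects a large active coordinate; a part measuring how far the Gram
matrix of `A` is from the full one, a reverse martingale under uniform deletions; and parts that
pay for the errors of the single rounds. Wherever the walk leaves the good states with many active
units the potential exceeds the trivial bound on the error, and once few units are left the
covariance bound takes over, since `supNorm v` is small. Optional stopping
(`norm_expect_walkFrom_sub_le`) then bounds the error at time zero by the initial potential. This
is done for the second moment (`abs_expect_sq_sub_one_le`) and for the characteristic function
(`norm_expect_exp_sub_gaussian_le`).

With a cutoff of order `log⁶ n` for the number of active units the regularity assumptions send all
error terms to zero (`exists_regime`), and Slutsky's and Lévy's theorems finish the proof.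
-/

open Filter Topology MeasureTheory ProbabilityTheory

noncomputable section

namespace GSW

/-! ### Expectations under finitely supported laws -/

section Expectation

variable {α γ E : Type*} [NormedAddCommGroup E] [NormedSpace ℝ E]

/-- The expectation of `f` under the discrete law `p`. It is only used for finitely supported
laws, for which it is a finite sum and no integrability question arises. -/
def expect (p : PMF α) (f : α → E) : E := ∑' a, (p a).toReal • f a

lemma expect_eq_sum (p : PMF α) (f : α → E) (s : Finset α) (hs : ∀ a ∈ p.support, a ∈ s) :
    expect p f = ∑ a ∈ s, (p a).toReal • f a := by
  refine tsum_eq_sum fun a ha => ?_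
  have h : p a = 0 := by
    by_contra h
    exact ha (hs a ((p.mem_support_iff a).2 h))
  simp [h]

lemma expect_eq_sum_support {p : PMF α} (hp : p.support.Finite) (f : α → E) :
    expect p f = ∑ a ∈ hp.toFinset, (p a).toReal • f a :=
  expect_eq_sum p f _ fun a ha => by simpa using ha

lemma sum_toReal_support {p : PMF α} (hp : p.support.Finite) :
    ∑ a ∈ hp.toFinset, (p a).toReal = 1 := by
  rw [← ENNReal.toReal_sum fun a _ => p.apply_ne_top a]
  have h : ∑ a ∈ hp.toFinset, p a = ∑' a, p a :=
    (tsum_eq_sum fun a ha => by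
      by_contra h
      exact ha (by simpa using h)).symm
  rw [h, p.tsum_coe, ENNReal.toReal_one]

@[simp] lemma expect_pure (a : α) (f : α → E) : expect (PMF.pure a) f = f a := by
  rw [expect_eq_sum _ _ {a} (by simp)]
  simp

lemma finite_support_bind {p : PMF α} {q : α → PMF γ} (hp : p.support.Finite)
    (hq : ∀ a, (q a).support.Finite) : (p.bind q).support.Finite := by
  rw [PMF.support_bind]
  exact hp.biUnion fun a _ => hq a

lemma finite_support_map {p : PMF α} (g : α → γ) (hp : p.support.Finite) :
    (p.map g).support.Finite := by
  rw [PMF.support_map]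
  exact hp.image g

lemma finite_support_pure (a : α) : (PMF.pure a).support.Finite := by
  rw [PMF.support_pure]; exact Set.finite_singleton a

lemma expect_bind {p : PMF α} {q : α → PMF γ} (hp : p.support.Finite)
    (hq : ∀ a, (q a).support.Finite) (f : γ → E) :
    expect (p.bind q) f = expect p fun a => expect (q a) f := by
  have hb := finite_support_bind hp hq
  rw [expect_eq_sum_support hb, expect_eq_sum_support hp]
  have h1 : ∀ c, ((p.bind q) c).toReal = ∑ a ∈ hp.toFinset, (p a).toReal * (q a c).toReal := by
    intro c
    rw [PMF.bind_apply, tsum_eq_sum (s := hp.toFinset), ENNReal.toReal_sum]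
    · simp [ENNReal.toReal_mul]
    · exact fun a _ => ENNReal.mul_ne_top (p.apply_ne_top a) ((q a).apply_ne_top c)
    · intro a ha
      have : p a = 0 := by
        by_contra h
        exact ha (by simpa using h)
      simp [this]
  have h2 : ∀ a ∈ hp.toFinset, (p a).toReal • expect (q a) f
      = ∑ c ∈ hb.toFinset, ((p a).toReal * (q a c).toReal) • f c := by
    intro a ha
    rw [expect_eq_sum (q a) f hb.toFinset, Finset.smul_sum]
    · simp [mul_smul]
    · intro c hc
      simp only [Set.Finite.mem_toFinset, PMF.support_bind, Set.mem_iUnion]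
      exact ⟨a, by simpa using ha, hc⟩
  rw [Finset.sum_congr rfl h2, Finset.sum_comm]
  refine Finset.sum_congr rfl fun c _ => ?_
  rw [h1, Finset.sum_smul]

lemma expect_map {p : PMF α} (hp : p.support.Finite) (g : α → γ) (f : γ → E) :
    expect (p.map g) f = expect p (f ∘ g) := by
  rw [← PMF.bind_pure_comp, expect_bind hp (q := PMF.pure ∘ g) fun a => finite_support_pure (g a)]
  simp [Function.comp_def]

variable {p : PMF α}

lemma expect_congr {f g : α → E} (h : ∀ a ∈ p.support, f a = g a) : expect p f = expect p g := by
  refine tsum_congr fun a => ?_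
  by_cases ha : a ∈ p.support
  · rw [h a ha]
  · have : p a = 0 := by simpa [PMF.mem_support_iff] using ha
    simp [this]

lemma expect_const (hp : p.support.Finite) (c : E) : expect p (fun _ => c) = c := by
  rw [expect_eq_sum_support hp, ← Finset.sum_smul, sum_toReal_support hp, one_smul]

lemma expect_add (hp : p.support.Finite) (f g : α → E) :
    expect p (fun a => f a + g a) = expect p f + expect p g := by
  simp [expect_eq_sum_support hp, Finset.sum_add_distrib]

lemma expect_sub (hp : p.support.Finite) (f g : α → E) :
    expect p (fun a => f a - g a) = expect p f - expect p g := by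
  simp [expect_eq_sum_support hp, smul_sub]

lemma expect_const_mul {A : Type*} [NormedRing A] [NormedAlgebra ℝ A] (hp : p.support.Finite)
    (c : A) (f : α → A) : expect p (fun a => c * f a) = c * expect p f := by
  simp [expect_eq_sum_support hp, Finset.mul_sum]

lemma expect_mono (hp : p.support.Finite) {f g : α → ℝ} (h : ∀ a ∈ p.support, f a ≤ g a) :
    expect p f ≤ expect p g := by
  rw [expect_eq_sum_support hp, expect_eq_sum_support hp]
  refine Finset.sum_le_sum fun a ha => ?_
  exact mul_le_mul_of_nonneg_left (h a (by simpa using ha)) ENNReal.toReal_nonneg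

lemma expect_nonneg (hp : p.support.Finite) {f : α → ℝ} (h : ∀ a ∈ p.support, 0 ≤ f a) :
    0 ≤ expect p f := by
  simpa [expect_const hp] using expect_mono hp (f := fun _ => 0) h

lemma norm_expect_le (hp : p.support.Finite) (f : α → E) :
    ‖expect p f‖ ≤ expect p fun a => ‖f a‖ := by
  rw [expect_eq_sum_support hp, expect_eq_sum_support hp]
  refine (norm_sum_le _ _).trans (Finset.sum_le_sum fun a _ => ?_)
  rw [norm_smul, Real.norm_of_nonneg ENNReal.toReal_nonneg, smul_eq_mul]

lemma expect_coin (r : ℝ) (hr : r ∈ Set.Icc (0 : ℝ) 1) (f : Bool → E) :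
    expect (coin r hr) f = r • f true + (1 - r) • f false := by
  rw [expect_eq_sum _ _ Finset.univ (by simp)]
  have : 0 ≤ 1 - r := by linarith [hr.2]
  simp [coin, hr.1, this]

lemma expect_uniformOfFinset (A : Finset α) (hA : A.Nonempty) (f : α → E) :
    expect (PMF.uniformOfFinset A hA) f = (A.card : ℝ)⁻¹ • ∑ a ∈ A, f a := by
  rw [expect_eq_sum _ _ A (by simp), Finset.smul_sum]
  refine Finset.sum_congr rfl fun a ha => ?_
  rw [PMF.uniformOfFinset_apply_of_mem hA ha]
  simp

/-- Jensen's inequality for the square. -/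
lemma expect_abs_sq_le (hp : p.support.Finite) (f : α → ℝ) :
    (expect p fun a => |f a|) ^ 2 ≤ expect p fun a => f a ^ 2 := by
  set m := expect p fun a => |f a|
  have h : 0 ≤ expect p fun a => (|f a| - m) ^ 2 :=
    expect_nonneg hp fun a _ => sq_nonneg _
  have h2 : (expect p fun a => (|f a| - m) ^ 2) = (expect p fun a => f a ^ 2) - m ^ 2 := by
    have : (fun a => (|f a| - m) ^ 2) = fun a => (f a ^ 2 + (-2 * m) * |f a|) + m ^ 2 := by
      funext a; rw [sub_sq, sq_abs]; ring
    rw [this, expect_add hp, expect_add hp, expect_const hp, expect_const_mul hp]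
    ring
  linarith

/-- The measure-theoretic expectation under the law of `g` is the discrete expectation. -/
lemma integral_toMeasure_map [CompleteSpace E] [MeasurableSpace γ] [MeasurableSingletonClass γ]
    (hp : p.support.Finite) (g : α → γ) (f : γ → E) :
    ∫ c, f c ∂(p.map g).toMeasure = expect p (f ∘ g) := by
  rw [← expect_map hp]
  refine PMF.integral_eq_tsum _ _ ?_
  have hs := finite_support_map g hp
  rw [← PMF.restrict_toMeasure_support]
  exact IntegrableOn.of_finite hs

end Expectation

/-! ### One round of the walk -/

section Step

variable {n d : ℕ}

/-- The consistency condition of the states that the walk can reach: the fractional assignment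
lies in the cube, and the active units are exactly those strictly inside. -/
def Valid (s : State n) : Prop := (∀ i, |s.z i| ≤ 1) ∧ ∀ i, i ∈ s.active ↔ |s.z i| < 1

lemma valid_init : Valid (State.init n) := by
  simp [Valid, State.init]

lemma deltaPlus_nonneg (z u : Vec n) : 0 ≤ deltaPlus z u := abs_nonneg _

lemma deltaMinus_nonneg (z u : Vec n) : 0 ≤ deltaMinus z u := abs_nonneg _

lemma finite_support_coin (r : ℝ) (hr : r ∈ Set.Icc (0 : ℝ) 1) : (coin r hr).support.Finite :=
  Set.toFinite _

lemma finite_support_stepSize (z u : Vec n) : (stepSize z u).support.Finite :=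
  finite_support_map _ (finite_support_coin _ _)

lemma finite_support_nextPivot (A : Finset (Fin n)) (hA : A.Nonempty) (q : Option (Fin n)) :
    (nextPivot A hA q).support.Finite := Set.toFinite _

lemma finite_support_step (B : Matrix (Fin n ⊕ Fin d) (Fin n) ℝ) (s : State n) :
    (step B s).support.Finite := by
  unfold step
  split_ifs with hA
  · exact finite_support_bind (finite_support_nextPivot _ _ _) fun p =>
      finite_support_map _ (finite_support_stepSize _ _)
  · exact finite_support_pure _

lemma finite_support_run (B : Matrix (Fin n ⊕ Fin d) (Fin n) ℝ) (t : ℕ) :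
    (run B t).support.Finite := by
  induction t with
  | zero => exact finite_support_pure _
  | succ t ih => exact finite_support_bind ih (finite_support_step B)

section

variable {E : Type*} [NormedAddCommGroup E] [NormedSpace ℝ E]

lemma expect_stepSize (z u : Vec n) (f : ℝ → E) :
    expect (stepSize z u) f =
      (deltaMinus z u / (deltaPlus z u + deltaMinus z u)) • f (deltaPlus z u) +
      (1 - deltaMinus z u / (deltaPlus z u + deltaMinus z u)) • f (-deltaMinus z u) := by
  unfold stepSize
  rw [expect_map (finite_support_coin _ _), expect_coin]
  simp

lemma expect_step (B : Matrix (Fin n ⊕ Fin d) (Fin n) ℝ) (s : State n) (hA : s.active.Nonempty)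
    (f : State n → E) :
    expect (step B s) f = expect (nextPivot s.active hA s.pivot) fun p =>
      expect (stepSize s.z (stepDirection B s.active p)) fun δ =>
        f (s.update p (stepDirection B s.active p) δ) := by
  unfold step
  rw [dif_pos hA, expect_bind (finite_support_nextPivot _ _ _) fun p =>
    finite_support_map _ (finite_support_stepSize _ _)]
  congr 1
  funext p
  rw [expect_map (finite_support_stepSize _ _)]
  rfl

end

lemma expect_stepSize_id (z u : Vec n) : expect (stepSize z u) (fun δ => δ) = 0 := by
  rw [expect_stepSize]
  rcases (add_nonneg (deltaPlus_nonneg z u) (deltaMinus_nonneg z u)).eq_or_lt' with h | h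
  · have h1 := deltaPlus_nonneg z u
    have h2 := deltaMinus_nonneg z u
    have h3 : deltaMinus z u = 0 := by linarith
    have h4 : deltaPlus z u = 0 := by linarith
    simp [h3, h4]
  · simp only [smul_eq_mul]
    field_simp
    ring

lemma mem_support_nextPivot {A : Finset (Fin n)} {hA : A.Nonempty} {q : Option (Fin n)}
    {p : Fin n} (hp : p ∈ (nextPivot A hA q).support) :
    p ∈ A ∧ ∀ r, q = some r → r ∈ A → p = r := by
  cases q with
  | none => simpa [nextPivot] using hp
  | some r =>
    by_cases hr : r ∈ A
    · simp only [nextPivot, hr, if_true, PMF.support_pure, Set.mem_singleton_iff] at hp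
      subst hp
      exact ⟨hr, fun r' h _ => by simpa using h⟩
    · simp only [nextPivot, hr, if_false, PMF.support_uniformOfFinset, Finset.mem_coe] at hp
      refine ⟨hp, fun r' h h' => ?_⟩
      obtain rfl : r = r' := by simpa using h
      exact absurd h' hr

section Range

variable {s : State n} {p : Fin n} {u : Vec n}

lemma zero_mem_stepRange (hs : Valid s) (u : Vec n) : (0 : ℝ) ∈ stepRange s.z u := fun i => by
  simpa [← abs_le] using hs.1 i

lemma isClosed_stepRange (z u : Vec n) : IsClosed (stepRange z u) := by
  have : stepRange z u = ⋂ i, (fun δ : ℝ => (z + δ • u) i) ⁻¹' Set.Icc (-1) 1 := by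
    ext; simp [stepRange]
  rw [this]
  refine isClosed_iInter fun i => isClosed_Icc.preimage ?_
  simp only [PiLp.add_apply, PiLp.smul_apply, smul_eq_mul]
  fun_prop

lemma stepRange_subset (hu : u p = 1) :
    stepRange s.z u ⊆ Set.Icc (-1 - s.z p) (1 - s.z p) := fun δ hδ => by
  have h := hδ p
  simp only [PiLp.add_apply, PiLp.smul_apply, smul_eq_mul, hu, mul_one, Set.mem_Icc] at h
  exact ⟨by linarith [h.1], by linarith [h.2]⟩

lemma deltaPlus_eq (hs : Valid s) (hu : u p = 1) :
    deltaPlus s.z u = sSup (stepRange s.z u) :=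
  abs_of_nonneg (le_csSup ⟨_, fun _ h => (stepRange_subset hu h).2⟩ (zero_mem_stepRange hs u))

lemma neg_deltaMinus_eq (hs : Valid s) (hu : u p = 1) :
    -deltaMinus s.z u = sInf (stepRange s.z u) := by
  rw [deltaMinus, abs_of_nonpos, neg_neg]
  exact csInf_le ⟨_, fun _ h => (stepRange_subset hu h).1⟩ (zero_mem_stepRange hs u)

lemma deltaPlus_mem (hs : Valid s) (hu : u p = 1) : deltaPlus s.z u ∈ stepRange s.z u := by
  rw [deltaPlus_eq hs hu]
  exact (isClosed_stepRange _ _).csSup_mem ⟨0, zero_mem_stepRange hs u⟩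
    ⟨_, fun _ h => (stepRange_subset hu h).2⟩

lemma neg_deltaMinus_mem (hs : Valid s) (hu : u p = 1) :
    -deltaMinus s.z u ∈ stepRange s.z u := by
  rw [neg_deltaMinus_eq hs hu]
  exact (isClosed_stepRange _ _).csInf_mem ⟨0, zero_mem_stepRange hs u⟩
    ⟨_, fun _ h => (stepRange_subset hu h).1⟩

lemma mem_support_stepSize {z u : Vec n} {δ : ℝ} (hδ : δ ∈ (stepSize z u).support) :
    δ = deltaPlus z u ∨ δ = -deltaMinus z u := by
  simp only [stepSize, PMF.support_map, Set.mem_image] at hδ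
  obtain ⟨b, _, rfl⟩ := hδ
  cases b <;> simp

lemma mem_stepRange_of_mem_support (hs : Valid s) (hu : u p = 1) {δ : ℝ}
    (hδ : δ ∈ (stepSize s.z u).support) : δ ∈ stepRange s.z u := by
  rcases mem_support_stepSize hδ with rfl | rfl
  · exact deltaPlus_mem hs hu
  · exact neg_deltaMinus_mem hs hu

lemma valid_update (hs : Valid s) (hu : u ∈ feasible s.active p) {δ : ℝ}
    (hδ : δ ∈ stepRange s.z u) : Valid (s.update p u δ) := by
  have h1 : ∀ i, |(s.z + δ • u) i| ≤ 1 := fun i => abs_le.2 (hδ i)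
  refine ⟨h1, fun i => ?_⟩
  simp only [State.update, Finset.mem_filter, and_iff_right_iff_imp]
  intro hi
  by_contra hA
  have : (s.z + δ • u) i = s.z i := by simp [hu.1 i hA]
  rw [this] at hi
  exact hA ((hs.2 i).2 hi)

/-- A step that cannot be prolonged brings some active unit to the boundary. -/
lemma exists_frozen (hs : Valid s) (hu : u ∈ feasible s.active p) {δ : ℝ}
    (hδ : δ ∈ (stepSize s.z u).support) : ∃ i ∈ s.active, i ∉ (s.update p u δ).active := by
  have hp := hu.2
  by_contra! hcon
  have hin : ∀ i ∈ s.active, |(s.z + δ • u) i| < 1 := fun i hi => by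
    have := hcon i hi
    simp only [State.update, Finset.mem_filter] at this
    exact this.2
  have hmem := mem_stepRange_of_mem_support hs hp hδ
  -- A whole neighbourhood of `δ` is then admissible, so `δ` is neither the largest nor the
  -- smallest element of the range.
  have hnhds : ∀ᶠ x in 𝓝 δ, x ∈ stepRange s.z u := by
    refine Filter.eventually_all.2 fun i => ?_
    by_cases hi : i ∈ s.active
    · have hc : ContinuousAt (fun x : ℝ => |(s.z + x • u) i|) δ := by
        simp only [PiLp.add_apply, PiLp.smul_apply, smul_eq_mul]
        fun_prop
      filter_upwards [hc.eventually_lt continuousAt_const (hin i hi)] with x hx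
      exact abs_le.1 hx.le
    · refine Filter.Eventually.of_forall fun x => ?_
      have : (s.z + x • u) i = s.z i := by simp [hu.1 i hi]
      rw [this]
      exact abs_le.1 (hs.1 i)
  obtain ⟨ε, hε, hball⟩ := Metric.eventually_nhds_iff.1 hnhds
  have hplus : δ + ε / 2 ∈ stepRange s.z u := hball (by simp [abs_of_pos hε, hε])
  have hminus : δ - ε / 2 ∈ stepRange s.z u := hball (by simp [abs_of_pos hε, hε])
  rcases mem_support_stepSize hδ with h | h
  · have := le_csSup ⟨_, fun _ h => (stepRange_subset hp h).2⟩ hplus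
    rw [← deltaPlus_eq hs hp] at this
    linarith
  · have := csInf_le ⟨_, fun _ h => (stepRange_subset hp h).1⟩ hminus
    rw [← neg_deltaMinus_eq hs hp] at this
    linarith

lemma active_update_subset (s : State n) (p : Fin n) (u : Vec n) (δ : ℝ) :
    (s.update p u δ).active ⊆ s.active := Finset.filter_subset _ _

lemma card_active_update_lt (hs : Valid s) (hu : u ∈ feasible s.active p) {δ : ℝ}
    (hδ : δ ∈ (stepSize s.z u).support) : (s.update p u δ).active.card < s.active.card := by
  obtain ⟨i, hi, hi'⟩ := exists_frozen hs hu hδ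
  exact Finset.card_lt_card ⟨active_update_subset _ _ _ _, fun h => hi' (h hi)⟩

end Range

/-! ### The step direction -/

/-- Quantitative injectivity of the matrix that defines the step directions. -/
def Coercive (B : Matrix (Fin n ⊕ Fin d) (Fin n) ℝ) : Prop :=
  ∃ φ > (0 : ℝ), ∀ w : Vec n, φ * ‖w‖ ^ 2 ≤ ‖Matrix.toEuclideanLin B w‖ ^ 2

variable {B : Matrix (Fin n ⊕ Fin d) (Fin n) ℝ}

lemma exists_minimizer (hB : Coercive B) {A : Finset (Fin n)} {p : Fin n} (hp : p ∈ A) :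
    ∃ u ∈ feasible A p,
      IsMinOn (fun w => ‖Matrix.toEuclideanLin B w‖ ^ 2) (feasible A p) u := by
  obtain ⟨φ, hφ, hB⟩ := hB
  have hcont : Continuous fun w : Vec n => ‖Matrix.toEuclideanLin B w‖ ^ 2 := by
    have := (Matrix.toEuclideanLin B).continuous_of_finiteDimensional
    fun_prop
  have hclosed : IsClosed (feasible A p) := by
    have : feasible A p = (⋂ i, ⋂ _ : i ∉ A, {u : Vec n | u i = 0}) ∩ {u | u p = 1} := by
      ext; simp [feasible]
    rw [this]
    refine (isClosed_iInter fun i => isClosed_iInter fun _ => ?_).inter ?_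
    · exact isClosed_eq (by fun_prop) continuous_const
    · exact isClosed_eq (by fun_prop) continuous_const
  have hmem : EuclideanSpace.single p (1 : ℝ) ∈ feasible A p := by
    refine ⟨fun i hi => ?_, by simp⟩
    have : i ≠ p := fun h => hi (h ▸ hp)
    simp [this]
  refine hcont.continuousOn.exists_isMinOn' hclosed hmem ?_
  have htend : Tendsto (fun w : Vec n => φ * ‖w‖ ^ 2) (cocompact _) atTop :=
    ((tendsto_pow_atTop two_ne_zero).comp (tendsto_norm_cocompact_atTop)).const_mul_atTop hφ
  have := (tendsto_atTop_mono hB htend).eventually_ge_atTop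
    (‖Matrix.toEuclideanLin B (EuclideanSpace.single p (1 : ℝ))‖ ^ 2)
  exact this.filter_mono inf_le_left

lemma stepDirection_mem (hB : Coercive B) {A : Finset (Fin n)} {p : Fin n} (hp : p ∈ A) :
    stepDirection B A p ∈ feasible A p := by
  rw [stepDirection, dif_pos (exists_minimizer hB hp)]
  exact (exists_minimizer hB hp).choose_spec.1

/-- The normal equations of the least squares problem that defines the step direction. -/
lemma inner_stepDirection (hB : Coercive B) {A : Finset (Fin n)} {p : Fin n} (hp : p ∈ A)
    {w : Vec n} (hw : ∀ i, i ∉ A → w i = 0) (hwp : w p = 0) :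
    inner ℝ (Matrix.toEuclideanLin B (stepDirection B A p)) (Matrix.toEuclideanLin B w) = 0 := by
  have hu := stepDirection_mem hB hp
  have hmin : IsMinOn (fun w => ‖Matrix.toEuclideanLin B w‖ ^ 2) (feasible A p)
      (stepDirection B A p) := by
    have := (exists_minimizer hB hp).choose_spec.2
    rwa [stepDirection, dif_pos (exists_minimizer hB hp)]
  set u := stepDirection B A p
  set T := Matrix.toEuclideanLin B
  have key : ∀ t : ℝ, 0 ≤ 2 * t * inner ℝ (T u) (T w) + t ^ 2 * ‖T w‖ ^ 2 := fun t => by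
    have hm : u + t • w ∈ feasible A p :=
      ⟨fun i hi => by simp [hu.1 i hi, hw i hi], by simp [hu.2, hwp]⟩
    have h := isMinOn_iff.1 hmin _ hm
    rw [map_add, map_smul, norm_add_sq_real, inner_smul_right, norm_smul, mul_pow,
      Real.norm_eq_abs, sq_abs] at h
    linarith
  by_contra hne
  have hTw : 0 < ‖T w‖ ^ 2 := by
    have : T w ≠ 0 := fun h => hne (by rw [h, inner_zero_right])
    positivity
  have h := key (-(inner ℝ (T u) (T w)) / ‖T w‖ ^ 2)
  have h2 : 0 < inner ℝ (T u) (T w) ^ 2 / ‖T w‖ ^ 2 := by positivity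
  have h3 : 2 * (-(inner ℝ (T u) (T w)) / ‖T w‖ ^ 2) * inner ℝ (T u) (T w) +
      (-(inner ℝ (T u) (T w)) / ‖T w‖ ^ 2) ^ 2 * ‖T w‖ ^ 2 =
      -(inner ℝ (T u) (T w) ^ 2 / ‖T w‖ ^ 2) := by
    field_simp
    ring
  linarith

end Step

/-! ### The walk started from an arbitrary state -/

section WalkFrom

variable {n d : ℕ}

/-- The law of the state after `k` further rounds of the walk, started from the state `s`. -/
def walkFrom (B : Matrix (Fin n ⊕ Fin d) (Fin n) ℝ) : ℕ → State n → PMF (State n)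
  | 0, s => PMF.pure s
  | k + 1, s => (step B s).bind (walkFrom B k)

variable {B : Matrix (Fin n ⊕ Fin d) (Fin n) ℝ}

lemma finite_support_walkFrom (B : Matrix (Fin n ⊕ Fin d) (Fin n) ℝ) (k : ℕ) (s : State n) :
    (walkFrom B k s).support.Finite := by
  induction k generalizing s with
  | zero => exact finite_support_pure _
  | succ k ih => exact finite_support_bind (finite_support_step B s) ih

lemma run_bind_walkFrom (B : Matrix (Fin n ⊕ Fin d) (Fin n) ℝ) (t k : ℕ) :
    (run B t).bind (walkFrom B k) = walkFrom B (t + k) (State.init n) := by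
  induction t generalizing k with
  | zero => simp [run]
  | succ t ih =>
    rw [run, PMF.bind_bind, Nat.succ_add_eq_add_succ, ← ih]
    rfl

lemma run_eq_walkFrom (B : Matrix (Fin n ⊕ Fin d) (Fin n) ℝ) (t : ℕ) :
    run B t = walkFrom B t (State.init n) := by
  rw [← Nat.add_zero t, ← run_bind_walkFrom]
  exact ((run B t).bind_pure).symm

lemma expect_walkFrom_zero {E : Type*} [NormedAddCommGroup E] [NormedSpace ℝ E] (s : State n)
    (f : State n → E) : expect (walkFrom B 0 s) f = f s := expect_pure s f

lemma expect_walkFrom_succ {E : Type*} [NormedAddCommGroup E] [NormedSpace ℝ E] (k : ℕ)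
    (s : State n) (f : State n → E) :
    expect (walkFrom B (k + 1) s) f = expect (step B s) fun s' => expect (walkFrom B k s') f :=
  expect_bind (finite_support_step B s) (finite_support_walkFrom B k) f

lemma step_of_empty {s : State n} (h : s.active = ∅) : step B s = PMF.pure s := by
  unfold step
  rw [dif_neg (by simp [h])]

lemma exists_of_mem_support_step {s s' : State n} (hA : s.active.Nonempty)
    (h : s' ∈ (step B s).support) : ∃ p ∈ s.active,
      ∃ δ ∈ (stepSize s.z (stepDirection B s.active p)).support,
        s' = s.update p (stepDirection B s.active p) δ := by
  unfold step at h
  rw [dif_pos hA] at h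
  simp only [PMF.support_bind, PMF.support_map, Set.mem_iUnion, Set.mem_image] at h
  obtain ⟨p, hp, δ, hδ, rfl⟩ := h
  exact ⟨p, (mem_support_nextPivot hp).1, δ, hδ, rfl⟩

lemma valid_of_mem_support_step (hB : Coercive B) {s s' : State n} (hs : Valid s)
    (h : s' ∈ (step B s).support) : Valid s' := by
  rcases s.active.eq_empty_or_nonempty with hA | hA
  · rw [step_of_empty hA, PMF.support_pure, Set.mem_singleton_iff] at h
    exact h ▸ hs
  · obtain ⟨p, hp, δ, hδ, rfl⟩ := exists_of_mem_support_step hA h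
    have hu := stepDirection_mem hB hp
    exact valid_update hs hu (mem_stepRange_of_mem_support hs hu.2 hδ)

lemma valid_of_mem_support_walkFrom (hB : Coercive B) {k : ℕ} {s s' : State n} (hs : Valid s)
    (h : s' ∈ (walkFrom B k s).support) : Valid s' := by
  induction k generalizing s with
  | zero =>
    rw [walkFrom, PMF.support_pure, Set.mem_singleton_iff] at h
    exact h ▸ hs
  | succ k ih =>
    simp only [walkFrom, PMF.support_bind, Set.mem_iUnion] at h
    obtain ⟨s₁, h₁, h₂⟩ := h
    exact ih (valid_of_mem_support_step hB hs h₁) h₂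

/-- Each round removes at least one unit, so that the walk is finished after `n` rounds. -/
lemma active_eq_empty_of_mem_support (hB : Coercive B) {k : ℕ} {s s' : State n} (hs : Valid s)
    (hk : s.active.card ≤ k) (h : s' ∈ (walkFrom B k s).support) : s'.active = ∅ := by
  induction k generalizing s with
  | zero =>
    rw [walkFrom, PMF.support_pure, Set.mem_singleton_iff] at h
    rw [h]
    exact Finset.card_eq_zero.1 (Nat.le_zero.1 hk)
  | succ k ih =>
    simp only [walkFrom, PMF.support_bind, Set.mem_iUnion] at h
    obtain ⟨s₁, h₁, h₂⟩ := h
    refine ih (valid_of_mem_support_step hB hs h₁) ?_ h₂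
    rcases s.active.eq_empty_or_nonempty with hA | hA
    · rw [step_of_empty hA, PMF.support_pure, Set.mem_singleton_iff] at h₁
      simp [h₁, hA]
    · obtain ⟨p, hp, δ, hδ, rfl⟩ := exists_of_mem_support_step hA h₁
      have := card_active_update_lt hs (stepDirection_mem hB hp) hδ
      omega

/-- The walk is a martingale. -/
lemma expect_walkFrom_inner (B : Matrix (Fin n ⊕ Fin d) (Fin n) ℝ) (k : ℕ) (s : State n)
    (y : Vec n) : (expect (walkFrom B k s) fun s' => inner ℝ s'.z y) = inner ℝ s.z y := by
  induction k generalizing s with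
  | zero => exact expect_walkFrom_zero _ _
  | succ k ih =>
    rw [expect_walkFrom_succ]
    simp_rw [ih]
    rcases s.active.eq_empty_or_nonempty with hA | hA
    · rw [step_of_empty hA, expect_pure]
    · rw [expect_step _ _ hA]
      have : ∀ p, (expect (stepSize s.z (stepDirection B s.active p)) fun δ =>
          inner ℝ (s.update p (stepDirection B s.active p) δ).z y) = inner ℝ s.z y := fun p => by
        have hfin := finite_support_stepSize s.z (stepDirection B s.active p)
        simp only [State.update, inner_add_left, real_inner_smul_left]
        simp_rw [mul_comm _ (inner ℝ (stepDirection B s.active p) y)]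
        rw [expect_add hfin, expect_const hfin, expect_const_mul hfin, expect_stepSize_id]
        simp
      simp_rw [this]
      exact expect_const (finite_support_nextPivot _ _ _) _

end WalkFrom

/-! ### The covariance bound -/

section Projection

variable {H : Type*} [NormedAddCommGroup H] [InnerProductSpace ℝ H] [FiniteDimensional ℝ H]

lemma norm_sq_starProjection_add (K : Submodule ℝ H) (y : H) :
    ‖y‖ ^ 2 = ‖K.starProjection y‖ ^ 2 + ‖y - K.starProjection y‖ ^ 2 := by
  have h : inner ℝ (K.starProjection y) (y - K.starProjection y) = 0 :=
    Submodule.inner_right_of_mem_orthogonal (K.starProjection_apply_mem y)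
      (K.sub_starProjection_mem_orthogonal y)
  have := norm_add_sq_real (K.starProjection y) (y - K.starProjection y)
  rw [add_sub_cancel, h] at this
  linarith

lemma inner_starProjection_of_mem {K : Submodule ℝ H} {c : H} (hc : c ∈ K) (w : H) :
    inner ℝ c (K.starProjection w) = inner ℝ c w := by
  have : inner ℝ c (w - K.starProjection w) = 0 :=
    Submodule.inner_right_of_mem_orthogonal hc (K.sub_starProjection_mem_orthogonal w)
  rw [inner_sub_right] at this
  linarith

lemma starProjection_starProjection_of_le {K K' : Submodule ℝ H} (h : K ≤ K') (w : H) :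
    K.starProjection (K'.starProjection w) = K.starProjection w := by
  have h0 : K.starProjection (w - K'.starProjection w) = 0 := by
    rw [Submodule.starProjection_apply_eq_zero_iff]
    exact Submodule.orthogonal_le h (K'.sub_starProjection_mem_orthogonal w)
  rw [map_sub] at h0
  exact (sub_eq_zero.1 h0).symm

/-- Bessel's inequality for a subspace and a vector orthogonal to it. -/
lemma norm_sq_starProjection_add_inner_sq_le {K K' : Submodule ℝ H} (h : K ≤ K') {c : H}
    (hc : c ∈ K') (hcK : c ∈ Kᗮ) (hc1 : ‖c‖ ≤ 1) (w : H) :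
    ‖K.starProjection w‖ ^ 2 + inner ℝ c w ^ 2 ≤ ‖K'.starProjection w‖ ^ 2 := by
  rw [← starProjection_starProjection_of_le h, ← inner_starProjection_of_mem hc,
    norm_sq_starProjection_add K (K'.starProjection w)]
  set y := K'.starProjection w
  have h1 : inner ℝ c y = inner ℝ c (y - K.starProjection y) := by
    rw [inner_sub_right, Submodule.inner_left_of_mem_orthogonal (K.starProjection_apply_mem y) hcK,
      sub_zero]
  have h2 : inner ℝ c y ^ 2 ≤ ‖y - K.starProjection y‖ ^ 2 := by
    rw [h1, ← sq_abs]
    refine pow_le_pow_left₀ (abs_nonneg _) ((abs_real_inner_le_norm _ _).trans ?_) 2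
    exact mul_le_of_le_one_left (norm_nonneg _) hc1
  linarith

lemma sq_add_le_of_sq_le {q α x b : ℝ} (hq0 : 0 ≤ q) (hq1 : q ≤ 1)
    (hx : x ^ 2 ≤ q * (1 - q) * b ^ 2) : (q * α + x) ^ 2 ≤ α ^ 2 + b ^ 2 := by
  rcases hq1.eq_or_lt with rfl | hq1
  · have : x = 0 := by
      have : x ^ 2 ≤ 0 := by simpa using hx
      exact pow_eq_zero_iff two_ne_zero |>.1 (le_antisymm this (sq_nonneg x))
    subst this
    nlinarith [sq_nonneg b]
  · have hr : 0 < 1 - q := by linarith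
    -- Young's inequality with weight `1 - q`.
    have h1 : 2 * α * x ≤ (1 - q) * α ^ 2 + x ^ 2 / (1 - q) := by
      have : (1 - q) * α ^ 2 + x ^ 2 / (1 - q) - 2 * α * x
          = ((1 - q) * α - x) ^ 2 / (1 - q) := by
        field_simp
        ring
      have : 0 ≤ ((1 - q) * α - x) ^ 2 / (1 - q) := by positivity
      linarith
    have h2 : x ^ 2 / (1 - q) ≤ q * b ^ 2 := by
      rw [div_le_iff₀ hr]
      linarith
    nlinarith [sq_nonneg α, sq_nonneg b]

/-- When the subspace spanned by the non-pivot columns shrinks from `M` to a smaller one, the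
residual of the pivot column changes from `c` to `c'`. This compares the quadratic forms before
and after the change; `K₁` is the span of all columns that remain. -/
lemma norm_sq_starProjection_exchange {K₁ K' : Submodule ℝ H} (h : K₁ ≤ K') {c c' : H}
    (hc : c ∈ K') (hc' : c' ∈ K₁) (hcc : inner ℝ c (c' - c) = 0) (hc'1 : ‖c'‖ ≤ 1)
    (hdec : ∀ z ∈ K₁, ∃ t : ℝ, inner ℝ c (z - t • c') = 0 ∧ inner ℝ c' (z - t • c') = 0)
    (w : H) :
    ‖K₁.starProjection w‖ ^ 2 - inner ℝ c' w ^ 2 + inner ℝ c w ^ 2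
      ≤ ‖K'.starProjection w‖ ^ 2 := by
  rw [← starProjection_starProjection_of_le h, ← inner_starProjection_of_mem hc,
    ← inner_starProjection_of_mem (h hc'), norm_sq_starProjection_add K₁ (K'.starProjection w)]
  set y := K'.starProjection w
  rw [← inner_starProjection_of_mem hc' y]
  obtain ⟨t, ht, ht'⟩ := hdec _ (K₁.starProjection_apply_mem y)
  set a := y - K₁.starProjection y with ha
  have hy : inner ℝ c y = inner ℝ c (K₁.starProjection y) + inner ℝ c a := by
    rw [ha, inner_sub_right]; ring
  have hc'a : inner ℝ c' a = 0 :=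
    Submodule.inner_right_of_mem_orthogonal hc' (K₁.sub_starProjection_mem_orthogonal y)
  have hl : inner ℝ c c' = ‖c‖ ^ 2 := by
    rw [inner_sub_right, real_inner_self_eq_norm_sq] at hcc
    linarith
  rw [inner_sub_right, inner_smul_right, hl] at ht
  rw [inner_sub_right, inner_smul_right, real_inner_self_eq_norm_sq] at ht'
  rw [hy, sub_eq_zero.1 ht, sub_eq_zero.1 ht']
  suffices (t * ‖c‖ ^ 2 + inner ℝ c a) ^ 2 ≤ (t * ‖c'‖ ^ 2) ^ 2 + ‖a‖ ^ 2 by linarith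
  by_cases h0 : c' = 0
  · have hc0 : c = 0 := by
      rw [h0, inner_zero_right] at hl
      simpa using hl.symm
    simp [h0, hc0]
  have hs : 0 < ‖c'‖ ^ 2 := by positivity
  set q := ‖c‖ ^ 2 / ‖c'‖ ^ 2 with hq
  have hqs : ‖c‖ ^ 2 = q * ‖c'‖ ^ 2 := by rw [hq]; field_simp
  have hpyth : ‖c - q • c'‖ ^ 2 = q * (1 - q) * ‖c'‖ ^ 2 := by
    rw [norm_sub_sq_real, inner_smul_right, hl, norm_smul, mul_pow, Real.norm_eq_abs, sq_abs, hqs]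
    ring
  have hq0 : 0 ≤ q := by positivity
  have hq1 : q ≤ 1 := by
    by_contra hq1
    have : q * (1 - q) * ‖c'‖ ^ 2 < 0 :=
      mul_neg_of_neg_of_pos (mul_neg_of_pos_of_neg (by linarith) (by linarith)) hs
    linarith [sq_nonneg ‖c - q • c'‖]
  have hxa : inner ℝ c a ^ 2 ≤ q * (1 - q) * ‖a‖ ^ 2 := by
    have h1 : inner ℝ c a = inner ℝ (c - q • c') a := by
      rw [inner_sub_left, real_inner_smul_left, hc'a]; ring
    have h2 : inner ℝ c a ^ 2 ≤ ‖c - q • c'‖ ^ 2 * ‖a‖ ^ 2 := by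
      rw [h1, ← sq_abs, ← mul_pow]
      exact pow_le_pow_left₀ (abs_nonneg _) (abs_real_inner_le_norm _ _) 2
    rw [hpyth] at h2
    refine h2.trans ?_
    have : ‖c'‖ ^ 2 ≤ 1 := pow_le_one₀ (norm_nonneg _) hc'1
    have h3 : 0 ≤ q * (1 - q) := mul_nonneg hq0 (by linarith)
    exact mul_le_mul_of_nonneg_right (mul_le_of_le_one_right h3 this) (sq_nonneg _)
  have := sq_add_le_of_sq_le (α := t * ‖c'‖ ^ 2) hq0 hq1 hxa
  rw [hqs]
  calc (t * (q * ‖c'‖ ^ 2) + inner ℝ c a) ^ 2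
      = (q * (t * ‖c'‖ ^ 2) + inner ℝ c a) ^ 2 := by ring
    _ ≤ _ := this

end Projection

section Covariance

variable {n d : ℕ} {B : Matrix (Fin n ⊕ Fin d) (Fin n) ℝ}

/-- The vectors that vanish off `A`. -/
def supportedOn (A : Finset (Fin n)) : Submodule ℝ (Vec n) where
  carrier := {w | ∀ i, i ∉ A → w i = 0}
  add_mem' ha hb i hi := by simp [ha i hi, hb i hi]
  zero_mem' i _ := by simp
  smul_mem' c w hw i hi := by simp [hw i hi]

/-- The span of the columns of `B` with index in `A`. -/
def columnSpan (B : Matrix (Fin n ⊕ Fin d) (Fin n) ℝ) (A : Finset (Fin n)) :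
    Submodule ℝ (EuclideanSpace ℝ (Fin n ⊕ Fin d)) :=
  (supportedOn A).map (Matrix.toEuclideanLin B)

lemma columnSpan_mono {A A' : Finset (Fin n)} (h : A ⊆ A') : columnSpan B A ≤ columnSpan B A' :=
  Submodule.map_mono fun _ hw i hi => hw i fun hA => hi (h hA)

lemma stepDirection_mem_columnSpan (hB : Coercive B) {A : Finset (Fin n)} {p : Fin n}
    (hp : p ∈ A) : Matrix.toEuclideanLin B (stepDirection B A p) ∈ columnSpan B A :=
  Submodule.mem_map_of_mem (stepDirection_mem hB hp).1

lemma norm_stepDirection_le (hB : Coercive B)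
    (hcol : ∀ i, ‖Matrix.toEuclideanLin B (EuclideanSpace.single i 1)‖ ≤ 1)
    {A : Finset (Fin n)} {p : Fin n} (hp : p ∈ A) :
    ‖Matrix.toEuclideanLin B (stepDirection B A p)‖ ≤ 1 := by
  have hu := stepDirection_mem hB hp
  set T := Matrix.toEuclideanLin B
  set u := stepDirection B A p
  have h : inner ℝ (T u) (T (u - EuclideanSpace.single p 1)) = 0 := by
    refine inner_stepDirection hB hp (fun i hi => ?_) (by simp [hu.2])
    have : i ≠ p := fun h => hi (h ▸ hp)
    simp [hu.1 i hi, this]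
  rw [map_sub, inner_sub_right, real_inner_self_eq_norm_sq, sub_eq_zero] at h
  have h2 := real_inner_le_norm (T u) (T (EuclideanSpace.single p 1))
  rw [← h, sq] at h2
  by_contra hcon
  have h3 : ‖T u‖ ≤ ‖T (EuclideanSpace.single p 1)‖ := le_of_mul_le_mul_left h2 (by linarith)
  linarith [hcol p]

/-- The bound for the remaining variance of the walk in the direction `w`. -/
def varianceBound (B : Matrix (Fin n ⊕ Fin d) (Fin n) ℝ)
    (w : EuclideanSpace ℝ (Fin n ⊕ Fin d)) (s : State n) : ℝ :=
  ‖(columnSpan B s.active).starProjection w‖ ^ 2 -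
    match s.pivot with
    | none => 0
    | some q => if q ∈ s.active then
        s.z q ^ 2 * inner ℝ (Matrix.toEuclideanLin B (stepDirection B s.active q)) w ^ 2 else 0

lemma varianceBound_le (s : State n) (w : EuclideanSpace ℝ (Fin n ⊕ Fin d)) :
    varianceBound B w s ≤ ‖(columnSpan B s.active).starProjection w‖ ^ 2 := by
  unfold varianceBound
  split
  · linarith
  · split_ifs
    · exact sub_le_self _ (mul_nonneg (sq_nonneg _) (sq_nonneg _))
    · linarith

lemma norm_sq_starProjection_le (s : State n) (w : EuclideanSpace ℝ (Fin n ⊕ Fin d)) :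
    ‖(columnSpan B s.active).starProjection w‖ ^ 2 ≤ ‖w‖ ^ 2 :=
  pow_le_pow_left₀ (norm_nonneg _) (Submodule.norm_starProjection_apply_le _ _) 2

lemma inner_stepDirection_sq_le (hB : Coercive B)
    (hcol : ∀ i, ‖Matrix.toEuclideanLin B (EuclideanSpace.single i 1)‖ ≤ 1)
    {A : Finset (Fin n)} {p : Fin n} (hp : p ∈ A) (w : EuclideanSpace ℝ (Fin n ⊕ Fin d)) :
    inner ℝ (Matrix.toEuclideanLin B (stepDirection B A p)) w ^ 2 ≤
      ‖(columnSpan B A).starProjection w‖ ^ 2 := by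
  have := norm_sq_starProjection_add_inner_sq_le (K := ⊥) bot_le
    (stepDirection_mem_columnSpan hB hp) (by simp) (norm_stepDirection_le hB hcol hp) w
  simpa using this

lemma varianceBound_nonneg (hB : Coercive B)
    (hcol : ∀ i, ‖Matrix.toEuclideanLin B (EuclideanSpace.single i 1)‖ ≤ 1)
    {s : State n} (hs : Valid s) (w : EuclideanSpace ℝ (Fin n ⊕ Fin d)) :
    0 ≤ varianceBound B w s := by
  unfold varianceBound
  split
  · simp
  · rename_i q _
    split_ifs with hq
    · have h1 := inner_stepDirection_sq_le hB hcol hq w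
      have h2 : s.z q ^ 2 ≤ 1 := by
        rw [← sq_abs]; exact pow_le_one₀ (abs_nonneg _) (hs.1 q)
      have := mul_le_of_le_one_left (sq_nonneg (inner ℝ
        (Matrix.toEuclideanLin B (stepDirection B s.active q)) w)) h2
      linarith
    · simp

/-- One round lowers the variance bound at least by the variance that the round contributes, up
to the change of the squared position of the pivot. -/
lemma varianceBound_update_le (hB : Coercive B)
    (hcol : ∀ i, ‖Matrix.toEuclideanLin B (EuclideanSpace.single i 1)‖ ≤ 1)
    {s : State n} (hs : Valid s) {p : Fin n} (hp : p ∈ s.active) {δ : ℝ}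
    (hδ : δ ∈ stepRange s.z (stepDirection B s.active p))
    (w : EuclideanSpace ℝ (Fin n ⊕ Fin d)) :
    varianceBound B w (s.update p (stepDirection B s.active p) δ) +
      (s.z p + δ) ^ 2 * inner ℝ (Matrix.toEuclideanLin B (stepDirection B s.active p)) w ^ 2 ≤
      ‖(columnSpan B s.active).starProjection w‖ ^ 2 := by
  have hu := stepDirection_mem hB hp
  have hv := valid_update hs hu hδ
  have hsub := active_update_subset s p (stepDirection B s.active p) δ
  have hzp : (s.update p (stepDirection B s.active p) δ).z p = s.z p + δ := by
    simp [State.update, hu.2]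
  have hpiv : (s.update p (stepDirection B s.active p) δ).pivot = some p := rfl
  set s' := s.update p (stepDirection B s.active p) δ
  set T := Matrix.toEuclideanLin B
  set u := stepDirection B s.active p
  have hcK : ∀ w ∈ supportedOn s.active, w p = 0 → inner ℝ (T u) (T w) = 0 :=
    fun w hw hwp => inner_stepDirection hB hp hw hwp
  have hz1 : (s.z p + δ) ^ 2 ≤ 1 := by
    rw [← hzp, ← sq_abs]; exact pow_le_one₀ (abs_nonneg _) (hv.1 p)
  have h0 := columnSpan_mono (B := B) hsub
  unfold varianceBound
  rw [hpiv]
  simp only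
  split_ifs with hps
  · set u' := stepDirection B s'.active p
    have hu' : u' ∈ feasible s'.active p := stepDirection_mem hB hps
    rw [hzp]
    have hA : ‖(columnSpan B s'.active).starProjection w‖ ^ 2
        ≤ ‖(columnSpan B s.active).starProjection w‖ ^ 2 := by
      have := norm_sq_starProjection_add_inner_sq_le h0 (c := 0) (zero_mem _) (zero_mem _)
        (by simp) w
      simpa using this
    have hE : ‖(columnSpan B s'.active).starProjection w‖ ^ 2 - inner ℝ (T u') w ^ 2 +
        inner ℝ (T u) w ^ 2 ≤ ‖(columnSpan B s.active).starProjection w‖ ^ 2 := by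
      refine norm_sq_starProjection_exchange h0 (stepDirection_mem_columnSpan hB hp)
        (stepDirection_mem_columnSpan hB hps) ?_ (norm_stepDirection_le hB hcol hps) ?_ w
      · change inner ℝ (T u) (T u' - T u) = 0
        rw [← map_sub]
        refine hcK _ (fun i hi => ?_) (by simp [hu.2, hu'.2])
        simp [hu.1 i hi, hu'.1 i fun h => hi (hsub h)]
      · rintro _ ⟨y, hy, rfl⟩
        refine ⟨y p, ?_, ?_⟩
        · change inner ℝ (T u) (T y - y p • T u') = 0
          rw [← map_smul, ← map_sub]
          refine hcK _ (fun i hi => ?_) (by simp [hu'.2])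
          have hi' : i ∉ s'.active := fun h => hi (hsub h)
          simp [hy i hi', hu'.1 i hi']
        · change inner ℝ (T u') (T y - y p • T u') = 0
          rw [← map_smul, ← map_sub]
          refine inner_stepDirection hB hps (fun i hi' => ?_) (by simp [hu'.2])
          simp [hy i hi', hu'.1 i hi']
    -- The claim is affine in the squared position, and holds at both end points.
    nlinarith [mul_nonneg (sq_nonneg (s.z p + δ)) (sub_nonneg.2 hE),
      mul_nonneg (sub_nonneg.2 hz1) (sub_nonneg.2 hA)]
  · have h1 := norm_sq_starProjection_add_inner_sq_le h0 (stepDirection_mem_columnSpan hB hp)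
      (c := T u) ?_ (norm_stepDirection_le hB hcol hp) w
    · have := mul_le_of_le_one_left (sq_nonneg (inner ℝ (T u) w)) hz1
      linarith
    · rw [Submodule.mem_orthogonal']
      rintro _ ⟨y, hy, rfl⟩
      exact hcK y (fun i hi => hy i fun h => hi (hsub h)) (hy p hps)

/-- The covariance of the rest of the walk, transported by `B`, is dominated by the identity, if
all columns of `B` have norm at most one. -/
lemma expect_walkFrom_sq_le_varianceBound (hB : Coercive B)
    (hcol : ∀ i, ‖Matrix.toEuclideanLin B (EuclideanSpace.single i 1)‖ ≤ 1)
    (w : EuclideanSpace ℝ (Fin n ⊕ Fin d)) (k : ℕ) {s : State n} (hs : Valid s) :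
    (expect (walkFrom B k s) fun s' => inner ℝ (Matrix.toEuclideanLin B s'.z) w ^ 2) ≤
      inner ℝ (Matrix.toEuclideanLin B s.z) w ^ 2 + varianceBound B w s := by
  induction k generalizing s with
  | zero =>
    rw [expect_walkFrom_zero]
    linarith [varianceBound_nonneg hB hcol hs w]
  | succ k ih =>
    rw [expect_walkFrom_succ]
    refine (expect_mono (finite_support_step B s) fun s' hs' =>
      ih (valid_of_mem_support_step hB hs hs')).trans ?_
    rcases s.active.eq_empty_or_nonempty with hA | hA
    · rw [step_of_empty hA, expect_pure]
    rw [expect_step _ _ hA, ← expect_const (finite_support_nextPivot s.active hA s.pivot)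
      (inner ℝ (Matrix.toEuclideanLin B s.z) w ^ 2 + varianceBound B w s)]
    refine expect_mono (finite_support_nextPivot _ _ _) fun p hp => ?_
    obtain ⟨hpA, hpiv⟩ := mem_support_nextPivot hp
    have hu := stepDirection_mem hB hpA
    set u := stepDirection B s.active p with hudef
    set T := Matrix.toEuclideanLin B
    set x := inner ℝ (T u) w
    set y := inner ℝ (T s.z) w
    set base := ‖(columnSpan B s.active).starProjection w‖ ^ 2 with hbase
    have hfin := finite_support_stepSize s.z u
    have hle : ∀ δ ∈ (stepSize s.z u).support,
        inner ℝ (T (s.update p u δ).z) w ^ 2 + varianceBound B w (s.update p u δ) ≤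
        (y ^ 2 + base - s.z p ^ 2 * x ^ 2) + (2 * x * y - 2 * s.z p * x ^ 2) * δ := by
      intro δ hδ
      have h := varianceBound_update_le hB hcol hs hpA (mem_stepRange_of_mem_support hs hu.2 hδ) w
      have hT : inner ℝ (T (s.update p u δ).z) w = y + δ * x := by
        simp only [State.update, map_add, map_smul, inner_add_left, real_inner_smul_left]
        rfl
      rw [hT]
      have h' : varianceBound B w (s.update p u δ) + (s.z p + δ) ^ 2 * x ^ 2 ≤ base := h
      nlinarith
    refine (expect_mono hfin hle).trans ?_
    rw [expect_add hfin, expect_const hfin, expect_const_mul hfin, expect_stepSize_id]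
    have hvb : base - s.z p ^ 2 * x ^ 2 ≤ varianceBound B w s := by
      unfold varianceBound
      split
      · have := mul_nonneg (sq_nonneg (s.z p)) (sq_nonneg x)
        linarith
      · rename_i q hq
        split_ifs with hqA
        · obtain rfl := hpiv q hq hqA
          exact le_rfl
        · have := mul_nonneg (sq_nonneg (s.z p)) (sq_nonneg x)
          linarith
    linarith

end Covariance

/-! ### The augmented covariate matrix -/

section Augmented

variable {n d : ℕ}

/-- The vector `Xᵀ w = ∑ᵢ wᵢ xᵢ`. -/
def covSum (X : Matrix (Fin n) (Fin d) ℝ) (w : Vec n) : Vec d := ∑ i, w i • covariate X i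

lemma covSum_apply (X : Matrix (Fin n) (Fin d) ℝ) (w : Vec n) (j : Fin d) :
    covSum X w j = ∑ i, w i * X i j := by
  simp [covSum, covariate]

lemma toEuclideanLin_apply_eq_inner (X : Matrix (Fin n) (Fin d) ℝ) (β : Vec d) (i : Fin n) :
    Matrix.toEuclideanLin X β i = inner ℝ (covariate X i) β := by
  simp [Matrix.toLpLin_apply, Matrix.mulVec, dotProduct, covariate, PiLp.inner_apply,
    mul_comm]

lemma inner_toEuclideanLin (X : Matrix (Fin n) (Fin d) ℝ) (w : Vec n) (β : Vec d) :
    inner ℝ w (Matrix.toEuclideanLin X β) = inner ℝ (covSum X w) β := by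
  rw [covSum, sum_inner, PiLp.inner_apply]
  refine Finset.sum_congr rfl fun i _ => ?_
  rw [toEuclideanLin_apply_eq_inner, real_inner_smul_left]
  simp [mul_comm]

lemma augmented_inl (φ : ℝ) (X : Matrix (Fin n) (Fin d) ℝ) (w : Vec n) (i : Fin n) :
    Matrix.toEuclideanLin (augmented φ X) w (Sum.inl i) = √φ * w i := by
  simp [Matrix.toLpLin_apply, augmented, Matrix.smul_mulVec]

lemma augmented_inr (φ : ℝ) (X : Matrix (Fin n) (Fin d) ℝ) (w : Vec n) (j : Fin d) :
    Matrix.toEuclideanLin (augmented φ X) w (Sum.inr j) =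
      (maxRowNorm X)⁻¹ * √(1 - φ) * covSum X w j := by
  simp [Matrix.toLpLin_apply, augmented, Matrix.smul_mulVec, covSum_apply,
    Matrix.mulVec, dotProduct, mul_comm]

lemma inner_augmented {φ : ℝ} (h0 : 0 ≤ φ) (h1 : φ ≤ 1) (X : Matrix (Fin n) (Fin d) ℝ)
    (u w : Vec n) :
    inner ℝ (Matrix.toEuclideanLin (augmented φ X) u) (Matrix.toEuclideanLin (augmented φ X) w) =
      φ * inner ℝ u w + (maxRowNorm X)⁻¹ ^ 2 * (1 - φ) * inner ℝ (covSum X u) (covSum X w) := by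
  have h2 := Real.mul_self_sqrt h0
  have h3 := Real.mul_self_sqrt (sub_nonneg.2 h1)
  rw [PiLp.inner_apply, Fintype.sum_sum_type, PiLp.inner_apply, PiLp.inner_apply]
  simp only [augmented_inl, augmented_inr, RCLike.inner_apply, conj_trivial]
  rw [Finset.mul_sum, Finset.mul_sum]
  congr 1
  · refine Finset.sum_congr rfl fun i _ => ?_
    linear_combination (u i * w i) * h2
  · refine Finset.sum_congr rfl fun i _ => ?_
    linear_combination ((maxRowNorm X)⁻¹ ^ 2 * covSum X u i * covSum X w i) * h3

lemma norm_covariate_le (X : Matrix (Fin n) (Fin d) ℝ) (i : Fin n) :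
    ‖covariate X i‖ ≤ maxRowNorm X :=
  le_ciSup (f := fun i => ‖covariate X i‖) (Set.finite_range _).bddAbove i

lemma maxRowNorm_nonneg (X : Matrix (Fin n) (Fin d) ℝ) : 0 ≤ maxRowNorm X :=
  Real.iSup_nonneg fun _ => norm_nonneg _

lemma coercive_augmented {φ : ℝ} (h0 : 0 < φ) (h1 : φ ≤ 1) (X : Matrix (Fin n) (Fin d) ℝ) :
    Coercive (augmented φ X) := by
  refine ⟨φ, h0, fun w => ?_⟩
  rw [← real_inner_self_eq_norm_sq, ← real_inner_self_eq_norm_sq, inner_augmented h0.le h1]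
  have : 0 ≤ (maxRowNorm X)⁻¹ ^ 2 * (1 - φ) * inner ℝ (covSum X w) (covSum X w) :=
    mul_nonneg (mul_nonneg (sq_nonneg _) (sub_nonneg.2 h1)) real_inner_self_nonneg
  linarith

lemma covSum_single (X : Matrix (Fin n) (Fin d) ℝ) (i : Fin n) :
    covSum X (EuclideanSpace.single i 1) = covariate X i := by
  rw [covSum, Finset.sum_eq_single i]
  · simp
  · intro j _ hj; simp [hj]
  · simp

lemma norm_augmented_single_le {φ : ℝ} (h0 : 0 ≤ φ) (h1 : φ ≤ 1) (X : Matrix (Fin n) (Fin d) ℝ)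
    (i : Fin n) : ‖Matrix.toEuclideanLin (augmented φ X) (EuclideanSpace.single i 1)‖ ≤ 1 := by
  have h : ‖Matrix.toEuclideanLin (augmented φ X) (EuclideanSpace.single i 1)‖ ^ 2 ≤ 1 := by
    rw [← real_inner_self_eq_norm_sq, inner_augmented h0 h1, covSum_single,
      real_inner_self_eq_norm_sq, real_inner_self_eq_norm_sq]
    have h2 : ((maxRowNorm X)⁻¹ * ‖covariate X i‖) ^ 2 ≤ 1 := by
      refine pow_le_one₀ (mul_nonneg (inv_nonneg.2 (maxRowNorm_nonneg X)) (norm_nonneg _)) ?_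
      rw [inv_mul_eq_div]
      exact div_le_one_of_le₀ (norm_covariate_le X i) (maxRowNorm_nonneg X)
    have h3 := mul_le_mul_of_nonneg_left h2 (sub_nonneg.2 h1)
    simp only [PiLp.norm_single, norm_one]
    nlinarith
  exact (sq_le_one_iff₀ (norm_nonneg _)).1 h

/-- The variance that the rest of the walk contributes in the direction `v` is controlled by the
part of `v` on the active units. -/
lemma expect_walkFrom_inner_sq_le {φ : ℝ} (h0 : 0 < φ) (h1 : φ ≤ 1)
    (X : Matrix (Fin n) (Fin d) ℝ) (v : Vec n) (k : ℕ) {s : State n} (hs : Valid s) :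
    (expect (walkFrom (augmented φ X) k s) fun s' => inner ℝ s'.z v ^ 2) ≤
      inner ℝ s.z v ^ 2 + (∑ i ∈ s.active, v i ^ 2) / φ := by
  classical
  have hφ : √φ ≠ 0 := (Real.sqrt_pos.2 h0).ne'
  let lift : Vec n → EuclideanSpace ℝ (Fin n ⊕ Fin d) := fun v =>
    WithLp.toLp 2 (Sum.elim (fun i => (√φ)⁻¹ * v i) 0)
  have hlift : ∀ z v : Vec n,
      inner ℝ (Matrix.toEuclideanLin (augmented φ X) z) (lift v) = inner ℝ z v := fun z v => by
    rw [PiLp.inner_apply, Fintype.sum_sum_type, PiLp.inner_apply]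
    simp only [lift, augmented_inl, Sum.elim_inl, Sum.elim_inr, RCLike.inner_apply, conj_trivial,
      Pi.zero_apply, zero_mul, Finset.sum_const_zero, add_zero]
    refine Finset.sum_congr rfl fun i _ => ?_
    field_simp
  have h := expect_walkFrom_sq_le_varianceBound (coercive_augmented h0 h1 X)
    (norm_augmented_single_le h0.le h1 X) (lift v) k hs
  simp only [hlift] at h
  refine h.trans (add_le_add le_rfl ((varianceBound_le s (lift v)).trans ?_))
  -- Only the active part of `v` matters, since its complement is orthogonal to the active columns.
  let va : Vec n := WithLp.toLp 2 fun i => if i ∈ s.active then v i else 0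
  have hproj : (columnSpan (augmented φ X) s.active).starProjection (lift v) =
      (columnSpan (augmented φ X) s.active).starProjection (lift va) := by
    rw [← sub_eq_zero, ← map_sub, Submodule.starProjection_apply_eq_zero_iff,
      Submodule.mem_orthogonal]
    rintro _ ⟨y, hy, rfl⟩
    rw [inner_sub_right, hlift, hlift, ← inner_sub_right, PiLp.inner_apply]
    refine Finset.sum_eq_zero fun i _ => ?_
    by_cases hi : i ∈ s.active
    · simp [va, hi]
    · simp [hy i hi]
  have hva : ‖lift va‖ ^ 2 = (∑ i ∈ s.active, v i ^ 2) / φ := by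
    rw [EuclideanSpace.norm_sq_eq, Fintype.sum_sum_type, Finset.sum_div]
    simp only [lift, va, Sum.elim_inl, Sum.elim_inr, Pi.zero_apply, norm_zero, ne_eq,
      OfNat.ofNat_ne_zero, not_false_eq_true, zero_pow, Finset.sum_const_zero, add_zero]
    rw [← Finset.sum_subset (Finset.subset_univ s.active)]
    · refine Finset.sum_congr rfl fun i hi => ?_
      rw [if_pos hi, Real.norm_eq_abs, sq_abs, mul_pow, inv_pow, Real.sq_sqrt h0.le]
      field_simp
    · intro i _ hi
      simp [hi]
  rw [← hva, hproj]
  exact norm_sq_starProjection_le s (lift va)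

/-- The design balances the covariates. -/
lemma expect_walkFrom_covSum_sq_le {φ : ℝ} (h0 : 0 < φ) (h1 : φ < 1)
    (X : Matrix (Fin n) (Fin d) ℝ) (β : Vec d) (k : ℕ) :
    (expect (walkFrom (augmented φ X) k (State.init n)) fun s' => inner ℝ (covSum X s'.z) β ^ 2) ≤
      maxRowNorm X ^ 2 * ‖β‖ ^ 2 / (1 - φ) := by
  have hφ : 0 < √(1 - φ) := Real.sqrt_pos.2 (by linarith)
  have hfin := finite_support_walkFrom (augmented φ X) k (State.init n)
  rcases (maxRowNorm_nonneg X).eq_or_lt' with hξ | hξ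
  · have hX : ∀ z, covSum X z = 0 := fun z => by
      refine Finset.sum_eq_zero fun i _ => ?_
      have := norm_covariate_le X i
      rw [hξ, norm_le_zero_iff] at this
      rw [this, smul_zero]
    simp [hX, hξ, expect_const hfin]
  let w : EuclideanSpace ℝ (Fin n ⊕ Fin d) :=
    WithLp.toLp 2 (Sum.elim 0 (fun j => maxRowNorm X / √(1 - φ) * β j))
  have hw : ∀ z : Vec n, inner ℝ (Matrix.toEuclideanLin (augmented φ X) z) w =
      inner ℝ (covSum X z) β := fun z => by
    rw [PiLp.inner_apply, Fintype.sum_sum_type, PiLp.inner_apply]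
    simp only [w, augmented_inr, Sum.elim_inl, Sum.elim_inr, RCLike.inner_apply, conj_trivial,
      Pi.zero_apply, zero_mul, Finset.sum_const_zero, zero_add]
    refine Finset.sum_congr rfl fun i _ => ?_
    field_simp
  have hnorm : ‖w‖ ^ 2 = maxRowNorm X ^ 2 * ‖β‖ ^ 2 / (1 - φ) := by
    rw [EuclideanSpace.norm_sq_eq, EuclideanSpace.norm_sq_eq, Fintype.sum_sum_type]
    simp only [w, Sum.elim_inl, Sum.elim_inr, Pi.zero_apply, norm_zero, ne_eq,
      OfNat.ofNat_ne_zero, not_false_eq_true, zero_pow, Finset.sum_const_zero, zero_add,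
      Real.norm_eq_abs, sq_abs, mul_pow, div_pow, Real.sq_sqrt (show 0 ≤ 1 - φ by linarith)]
    rw [← Finset.mul_sum]
    ring
  have h := expect_walkFrom_sq_le_varianceBound (coercive_augmented h0 h1.le X)
    (norm_augmented_single_le h0.le h1.le X) w k valid_init
  simp only [hw] at h
  rw [← hnorm]
  refine h.trans ?_
  have : inner ℝ (covSum X (State.init n).z) β = 0 := by simp [State.init, covSum]
  rw [this]
  linarith [varianceBound_le (B := augmented φ X) (State.init n) w,
    norm_sq_starProjection_le (B := augmented φ X) (State.init n) w]

/-- The coordinates of the step direction off the pivot are linear in the covariates. -/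
lemma exists_stepDirection_eq {φ : ℝ} (h0 : 0 < φ) (h1 : φ ≤ 1) (X : Matrix (Fin n) (Fin d) ℝ)
    {A : Finset (Fin n)} {p : Fin n} (hp : p ∈ A) {σ : ℝ} (hσ : 0 < σ)
    (hA : ∀ g : Vec d, σ * ‖g‖ ^ 2 ≤ ∑ i ∈ A.erase p, inner ℝ (covariate X i) g ^ 2) :
    ∃ g : Vec d, ‖g‖ ≤ maxRowNorm X / σ ∧
      ∀ i ∈ A.erase p, stepDirection (augmented φ X) A p i = -inner ℝ (covariate X i) g := by
  have hB := coercive_augmented h0 h1 X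
  have hu := stepDirection_mem hB hp
  set u := stepDirection (augmented φ X) A p with hudef
  set κ := (maxRowNorm X)⁻¹ ^ 2 * (1 - φ) / φ with hκ
  have hκ0 : 0 ≤ κ := by
    have := sub_nonneg.2 h1
    positivity
  set g := κ • covSum X u with hg
  have hrepr : ∀ i ∈ A.erase p, u i = -inner ℝ (covariate X i) g := by
    intro i hi
    obtain ⟨hip, hiA⟩ := Finset.mem_erase.1 hi
    have h := inner_stepDirection hB hp (w := EuclideanSpace.single i 1)
      (fun j hj => by
        have : j ≠ i := fun h => hj (h ▸ hiA)
        simp [this])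
      (by simp [hip.symm])
    rw [← hudef, inner_augmented h0.le h1, covSum_single, EuclideanSpace.inner_single_right] at h
    simp only [conj_trivial, one_mul] at h
    rw [hg, inner_smul_right, real_inner_comm, hκ]
    refine mul_left_cancel₀ h0.ne' ?_
    have : φ * ((maxRowNorm X)⁻¹ ^ 2 * (1 - φ) / φ) = (maxRowNorm X)⁻¹ ^ 2 * (1 - φ) := by
      field_simp
    linear_combination h + inner ℝ (covSum X u) (covariate X i) * this
  refine ⟨g, ?_, hrepr⟩
  rcases hκ0.eq_or_lt with hk | hk
  · rw [hg, ← hk, zero_smul, norm_zero]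
    exact div_nonneg (maxRowNorm_nonneg X) hσ.le
  have hsum : covSum X u = covariate X p + ∑ i ∈ A.erase p, u i • covariate X i := by
    rw [covSum, ← Finset.sum_subset (Finset.subset_univ A), ← Finset.add_sum_erase A _ hp, hu.2,
      one_smul]
    intro i _ hi
    rw [hu.1 i hi, zero_smul]
  have hself : ‖g‖ ^ 2 = κ * (inner ℝ (covariate X p) g -
      ∑ i ∈ A.erase p, inner ℝ (covariate X i) g ^ 2) := by
    rw [← real_inner_self_eq_norm_sq]
    nth_rewrite 1 [hg]
    rw [real_inner_smul_left, hsum, inner_add_left, sum_inner, sub_eq_add_neg,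
      ← Finset.sum_neg_distrib]
    congr 2
    refine Finset.sum_congr rfl fun i hi => ?_
    rw [real_inner_smul_left, hrepr i hi]
    ring
  have h2 : ∑ i ∈ A.erase p, inner ℝ (covariate X i) g ^ 2 ≤ inner ℝ (covariate X p) g := by
    have := nonneg_of_mul_nonneg_right (hself ▸ sq_nonneg ‖g‖) hk
    linarith
  have h3 : σ * ‖g‖ ^ 2 ≤ maxRowNorm X * ‖g‖ :=
    (hA g).trans (h2.trans ((real_inner_le_norm _ _).trans
      (mul_le_mul_of_nonneg_right (norm_covariate_le X p) (norm_nonneg _))))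
  rw [le_div_iff₀ hσ]
  rcases (norm_nonneg g).eq_or_lt with hg0 | hg0
  · rw [← hg0, zero_mul]
    exact maxRowNorm_nonneg X
  · refine le_of_mul_le_mul_right ?_ hg0
    linarith [sq ‖g‖]

end Augmented

/-! ### Rounds in which only the pivot is decided -/

section FreshStep

variable {n d : ℕ} {B : Matrix (Fin n ⊕ Fin d) (Fin n) ℝ}

/-- The last pivot, if any, is no longer active, so that the next pivot is chosen afresh. -/
def Fresh (s : State n) : Prop := ∀ q, s.pivot = some q → q ∉ s.active

lemma fresh_init : Fresh (State.init n) := by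
  intro q hq
  simp [State.init] at hq

lemma expect_step_of_fresh {E : Type*} [NormedAddCommGroup E] [NormedSpace ℝ E]
    {s : State n} (hs : Fresh s) (hA : s.active.Nonempty) (f : State n → E) :
    expect (step B s) f = (s.active.card : ℝ)⁻¹ • ∑ p ∈ s.active,
      expect (stepSize s.z (stepDirection B s.active p)) fun δ =>
        f (s.update p (stepDirection B s.active p) δ) := by
  rw [expect_step _ _ hA]
  have : nextPivot s.active hA s.pivot = PMF.uniformOfFinset s.active hA := by
    cases h : s.pivot with
    | none => rfl
    | some q => simp [nextPivot, hs q h]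
  rw [this, expect_uniformOfFinset]

variable {s : State n} {p : Fin n} {u : Vec n}

/-- If the direction is small off the pivot, and the other active units are far from the
boundary, the step is only limited by the pivot. -/
lemma stepRange_eq (hs : Valid s) (hu : u ∈ feasible s.active p) (hp : p ∈ s.active)
    (hz : ∀ i ∈ s.active, |s.z i| ≤ 1 / 2) (hu8 : ∀ i ∈ s.active.erase p, |u i| ≤ 1 / 8) :
    stepRange s.z u = Set.Icc (-1 - s.z p) (1 - s.z p) := by
  refine (stepRange_subset hu.2).antisymm fun δ hδ i => ?_
  have h1 := abs_le.1 (hz p hp)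
  rw [Set.mem_Icc, ← abs_le, PiLp.add_apply, PiLp.smul_apply, smul_eq_mul]
  by_cases hi : i ∈ s.active
  · by_cases hip : i = p
    · subst hip
      rw [hu.2, abs_le]
      exact ⟨by linarith [hδ.1], by linarith [hδ.2]⟩
    · have h2 := hu8 i (Finset.mem_erase.2 ⟨hip, hi⟩)
      have h3 : |δ| ≤ 2 := abs_le.2 ⟨by linarith [hδ.1], by linarith [hδ.2]⟩
      have h4 : |δ * u i| ≤ 2 * (1 / 8) := by
        rw [abs_mul]
        exact mul_le_mul h3 h2 (abs_nonneg _) (by norm_num)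
      linarith [abs_add_le (s.z i) (δ * u i), hz i hi]
  · simpa [hu.1 i hi] using hs.1 i

lemma deltaPlus_eq_of_small (hs : Valid s) (hu : u ∈ feasible s.active p) (hp : p ∈ s.active)
    (hz : ∀ i ∈ s.active, |s.z i| ≤ 1 / 2) (hu8 : ∀ i ∈ s.active.erase p, |u i| ≤ 1 / 8) :
    deltaPlus s.z u = 1 - s.z p := by
  rw [deltaPlus_eq hs hu.2, stepRange_eq hs hu hp hz hu8, csSup_Icc (by linarith)]

lemma deltaMinus_eq_of_small (hs : Valid s) (hu : u ∈ feasible s.active p) (hp : p ∈ s.active)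
    (hz : ∀ i ∈ s.active, |s.z i| ≤ 1 / 2) (hu8 : ∀ i ∈ s.active.erase p, |u i| ≤ 1 / 8) :
    deltaMinus s.z u = 1 + s.z p := by
  have := neg_deltaMinus_eq hs hu.2
  rw [stepRange_eq hs hu hp hz hu8, csInf_Icc (by linarith)] at this
  linarith

lemma expect_stepSize_sq (hs : Valid s) (hu : u ∈ feasible s.active p) (hp : p ∈ s.active)
    (hz : ∀ i ∈ s.active, |s.z i| ≤ 1 / 2) (hu8 : ∀ i ∈ s.active.erase p, |u i| ≤ 1 / 8) :
    (expect (stepSize s.z u) fun δ => δ ^ 2) = 1 - s.z p ^ 2 := by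
  rw [expect_stepSize, deltaPlus_eq_of_small hs hu hp hz hu8,
    deltaMinus_eq_of_small hs hu hp hz hu8]
  simp only [smul_eq_mul]
  ring

lemma abs_le_two_of_mem_support (hs : Valid s) (hu : u p = 1)
    {δ : ℝ} (hδ : δ ∈ (stepSize s.z u).support) : |δ| ≤ 2 := by
  have h := stepRange_subset hu (mem_stepRange_of_mem_support hs hu hδ)
  have h1 := abs_le.1 (hs.1 p)
  exact abs_le.2 ⟨by linarith [h.1], by linarith [h.2]⟩

lemma mem_active_update (s : State n) (p i : Fin n) (u : Vec n) (δ : ℝ) :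
    i ∈ (s.update p u δ).active ↔ i ∈ s.active ∧ |s.z i + δ * u i| < 1 := Finset.mem_filter

lemma active_update_eq (hs : Valid s) (hu : u ∈ feasible s.active p) (hp : p ∈ s.active)
    (hz : ∀ i ∈ s.active, |s.z i| ≤ 1 / 2) (hu8 : ∀ i ∈ s.active.erase p, |u i| ≤ 1 / 8)
    {δ : ℝ} (hδ : δ ∈ (stepSize s.z u).support) :
    (s.update p u δ).active = s.active.erase p := by
  have h3 := abs_le_two_of_mem_support hs hu.2 hδ
  ext i
  rw [mem_active_update, Finset.mem_erase]
  constructor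
  · rintro ⟨hi, hlt⟩
    refine ⟨?_, hi⟩
    rintro rfl
    rw [hu.2] at hlt
    rcases mem_support_stepSize hδ with h | h
    · rw [h, deltaPlus_eq_of_small hs hu hp hz hu8] at hlt
      norm_num at hlt
    · rw [h, deltaMinus_eq_of_small hs hu hp hz hu8] at hlt
      norm_num at hlt
  · rintro ⟨hip, hi⟩
    refine ⟨hi, ?_⟩
    have h2 := hu8 i (Finset.mem_erase.2 ⟨hip, hi⟩)
    have h4 : |δ * u i| ≤ 2 * (1 / 8) := by
      rw [abs_mul]
      exact mul_le_mul h3 h2 (abs_nonneg _) (by norm_num)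
    linarith [abs_add_le (s.z i) (δ * u i), hz i hi]

end FreshStep

/-! ### Averages over the active set -/

section Average

variable {ι E : Type*} [NormedAddCommGroup E] [InnerProductSpace ℝ E]

/-- The average of the vectors `y i` over `i ∈ A`. -/
def avg (y : ι → E) (A : Finset ι) : E := (A.card : ℝ)⁻¹ • ∑ i ∈ A, y i

lemma card_smul_avg (y : ι → E) {A : Finset ι} (hA : A.Nonempty) :
    (A.card : ℝ) • avg y A = ∑ i ∈ A, y i := by
  have : (A.card : ℝ) ≠ 0 := by exact_mod_cast hA.card_pos.ne'
  rw [avg, smul_smul, mul_inv_cancel₀ this, one_smul]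

lemma card_erase_real [DecidableEq ι] {A : Finset ι} {p : ι} (hp : p ∈ A) :
    ((A.erase p).card : ℝ) = A.card - 1 := by
  rw [Finset.card_erase_of_mem hp, Nat.cast_sub (Finset.card_pos.2 ⟨p, hp⟩), Nat.cast_one]

/-- When a uniformly random element is removed, averages form a martingale with small
increments. -/
lemma average_norm_sq_avg_erase_le [DecidableEq ι] (y : ι → E) (c : E) {A : Finset ι}
    (hA : 2 ≤ A.card) :
    (A.card : ℝ)⁻¹ * ∑ p ∈ A, ‖avg y (A.erase p) - c‖ ^ 2 ≤
      ‖avg y A - c‖ ^ 2 + (A.card : ℝ)⁻¹ * ∑ p ∈ A, ‖y p‖ ^ 2 / (A.card - 1) ^ 2 := by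
  set m : ℝ := (A.card : ℝ) with hm
  have hm2 : 2 ≤ m := by rw [hm]; exact_mod_cast hA
  have hne : A.Nonempty := Finset.card_pos.1 (by omega)
  have hm1 : m - 1 ≠ 0 := by linarith
  have hm0 : m ≠ 0 := by linarith
  set a := avg y A
  have hsum : ∑ p ∈ A, (a - y p) = 0 := by
    rw [Finset.sum_sub_distrib, Finset.sum_const, ← card_smul_avg y hne, Nat.cast_smul_eq_nsmul]
    exact sub_self _
  have h1 : ∀ p ∈ A, avg y (A.erase p) - c = (a - c) + (m - 1)⁻¹ • (a - y p) := by
    intro p hp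
    have hs : ∑ i ∈ A.erase p, y i = m • a - y p := by
      rw [hm, card_smul_avg y hne, ← Finset.add_sum_erase A y hp, add_sub_cancel_left]
    rw [avg, card_erase_real hp, hs, ← hm]
    have : (m - 1)⁻¹ • (m • a - y p) = a + (m - 1)⁻¹ • (a - y p) := by
      have h3 : m • a - y p = (m - 1) • a + (a - y p) := by
        rw [sub_smul, one_smul]; abel
      rw [h3, smul_add, smul_smul, inv_mul_cancel₀ hm1, one_smul]
    rw [this]; abel
  have h2 : ∑ p ∈ A, ‖avg y (A.erase p) - c‖ ^ 2 =
      m * ‖a - c‖ ^ 2 + ((m - 1) ^ 2)⁻¹ * ∑ p ∈ A, ‖a - y p‖ ^ 2 := by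
    have h4 : ∀ p ∈ A, ‖avg y (A.erase p) - c‖ ^ 2 = ‖a - c‖ ^ 2 +
        2 * (m - 1)⁻¹ * inner ℝ (a - c) (a - y p) + ((m - 1) ^ 2)⁻¹ * ‖a - y p‖ ^ 2 := by
      intro p hp
      rw [h1 p hp, norm_add_sq_real, inner_smul_right, norm_smul, mul_pow, Real.norm_eq_abs,
        sq_abs, inv_pow]
      ring
    rw [Finset.sum_congr rfl h4, Finset.sum_add_distrib, Finset.sum_add_distrib,
      ← Finset.mul_sum, ← Finset.mul_sum, ← inner_sum, hsum, inner_zero_right, Finset.sum_const,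
      nsmul_eq_mul, ← hm]
    ring
  have h3 : ∑ p ∈ A, ‖a - y p‖ ^ 2 ≤ ∑ p ∈ A, ‖y p‖ ^ 2 := by
    have h5 : ∀ p ∈ A, ‖y p‖ ^ 2 = ‖a - y p‖ ^ 2 - 2 * inner ℝ a (a - y p) + ‖a‖ ^ 2 := by
      intro p _
      have : y p = a - (a - y p) := by abel
      nth_rewrite 1 [this]
      rw [norm_sub_sq_real, real_inner_comm]
      ring
    rw [Finset.sum_congr rfl h5, Finset.sum_add_distrib, Finset.sum_sub_distrib, ← Finset.mul_sum,
      ← inner_sum, hsum, inner_zero_right]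
    have : 0 ≤ ∑ _p ∈ A, ‖a‖ ^ 2 := Finset.sum_nonneg fun _ _ => sq_nonneg _
    linarith
  rw [h2, ← Finset.sum_div, mul_add, ← mul_assoc, inv_mul_cancel₀ hm0, one_mul, div_eq_inv_mul]
  gcongr

end Average

/-- The tensor square `g ⊗ g`, as a vector of Euclidean norm `‖g‖²`. -/
def outer {d : ℕ} (g : Vec d) : EuclideanSpace ℝ (Fin d × Fin d) :=
  WithLp.toLp 2 fun jk => g jk.1 * g jk.2

lemma inner_outer {d : ℕ} (g h : Vec d) : inner ℝ (outer g) (outer h) = inner ℝ g h ^ 2 := by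
  simp only [PiLp.inner_apply, outer, RCLike.inner_apply, conj_trivial, Fintype.sum_prod_type]
  rw [sq, Finset.sum_mul_sum]
  exact Finset.sum_congr rfl fun j _ => Finset.sum_congr rfl fun k _ => by ring

lemma norm_outer {d : ℕ} (g : Vec d) : ‖outer g‖ = ‖g‖ ^ 2 := by
  have h := inner_outer g g
  rw [real_inner_self_eq_norm_sq, real_inner_self_eq_norm_sq] at h
  exact (pow_left_inj₀ (norm_nonneg _) (sq_nonneg _) two_ne_zero).1 h

/-! ### Good states -/

section Good

variable {n d : ℕ}

/-- The average of `xᵢ ⊗ xᵢ` over `A`. -/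
def gram (X : Matrix (Fin n) (Fin d) ℝ) (A : Finset (Fin n)) : EuclideanSpace ℝ (Fin d × Fin d) :=
  avg (fun i => outer (covariate X i)) A

/-- The average of `vᵢ xᵢ` over `A`. -/
def crossAvg (X : Matrix (Fin n) (Fin d) ℝ) (v : Vec n) (A : Finset (Fin n)) : Vec d :=
  avg (fun i => v i • covariate X i) A

/-- The quantitative assumptions under which one experiment is analysed. The unit vector `v` is
orthogonal to the covariates, whose second moment matrix is at least `c`. The analysis follows
the walk until `m₀` units are left. Before that, the fractional assignments of the active units
should stay below `η`; the probability that they do not is controlled by an exponential moment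
with parameter `l`. -/
structure Regime (X : Matrix (Fin n) (Fin d) ℝ) (v : Vec n) (c η l m₀ : ℝ) : Prop where
  c_pos : 0 < c
  lower : ∀ g : Vec d, c * ‖g‖ ^ 2 ≤ (n : ℝ)⁻¹ * ∑ i, inner ℝ (covariate X i) g ^ 2
  unit : ‖v‖ = 1
  orth : covSum X v = 0
  two_le : 2 ≤ m₀
  le_n : m₀ ≤ n
  eta_nonneg : 0 ≤ η
  eta_le : η ≤ 1 / 2
  l_nonneg : 0 ≤ l
  xi_le : 16 * maxRowNorm X ^ 2 ≤ c * m₀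
  l_le : 2 * (l * (2 * maxRowNorm X ^ 2 / c)) ≤ m₀
  l_sq_le : 2 * (l * (2 * maxRowNorm X ^ 2 / c)) ^ 2 ≤ m₀

/-- The states from which only the pivot is decided in the next round: a new pivot is chosen,
more than `m₀` units are active, their fractional assignments are small, and their covariates
have a second moment matrix close to that of the whole population. -/
structure Good (X : Matrix (Fin n) (Fin d) ℝ) (c η m₀ : ℝ) (s : State n) : Prop where
  valid : Valid s
  fresh : Fresh s
  card : m₀ < s.active.card
  small : ∀ i ∈ s.active, |s.z i| ≤ η
  gram : ‖gram X s.active - gram X Finset.univ‖ ≤ c / 4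

variable {X : Matrix (Fin n) (Fin d) ℝ} {v : Vec n} {c η l m₀ φ : ℝ} {s : State n} {p : Fin n}

lemma sum_inner_sq_eq (A : Finset (Fin n)) (hA : A.Nonempty) (g : Vec d) :
    ∑ i ∈ A, inner ℝ (covariate X i) g ^ 2 = A.card * inner ℝ (gram X A) (outer g) := by
  rw [← real_inner_smul_left, gram, card_smul_avg _ hA, sum_inner]
  simp_rw [inner_outer]

lemma Good.active_nonempty (hR : Regime X v c η l m₀) (hs : Good X c η m₀ s) :
    s.active.Nonempty := by
  have h1 := hR.two_le
  have h2 := hs.card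
  exact Finset.card_pos.1 (by exact_mod_cast (by linarith : (0 : ℝ) < s.active.card))

lemma Good.lower_erase (hR : Regime X v c η l m₀) (hs : Good X c η m₀ s) (hp : p ∈ s.active)
    (g : Vec d) : c / 2 * s.active.card * ‖g‖ ^ 2 ≤
      ∑ i ∈ s.active.erase p, inner ℝ (covariate X i) g ^ 2 := by
  set m : ℝ := (s.active.card : ℝ) with hm
  have hm0 : 0 < m := by linarith [hR.two_le, hs.card]
  have hc := hR.c_pos
  have hn : (Finset.univ : Finset (Fin n)).Nonempty := ⟨p, Finset.mem_univ p⟩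
  have h1 := hR.lower g
  rw [sum_inner_sq_eq _ hn, Finset.card_univ, Fintype.card_fin, ← mul_assoc, inv_mul_cancel₀,
    one_mul] at h1
  swap
  · have : (0 : ℝ) < n := by linarith [hR.two_le, hR.le_n]
    exact this.ne'
  have h2 := sum_inner_sq_eq (X := X) _ (hs.active_nonempty hR) g
  rw [← Finset.add_sum_erase _ _ hp, ← hm] at h2
  have h3 : inner ℝ (GSW.gram X Finset.univ) (outer g) - inner ℝ (GSW.gram X s.active) (outer g)
      ≤ c / 4 * ‖g‖ ^ 2 := by
    rw [← inner_sub_left, ← norm_outer g]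
    refine (real_inner_le_norm _ _).trans ?_
    rw [norm_sub_rev]
    exact mul_le_mul_of_nonneg_right hs.gram (norm_nonneg _)
  have h4 : inner ℝ (covariate X p) g ^ 2 ≤ c / 4 * m * ‖g‖ ^ 2 := by
    have h5 : inner ℝ (covariate X p) g ^ 2 ≤ (maxRowNorm X * ‖g‖) ^ 2 := by
      rw [← sq_abs]
      exact pow_le_pow_left₀ (abs_nonneg _) ((abs_real_inner_le_norm _ _).trans
        (mul_le_mul_of_nonneg_right (norm_covariate_le X p) (norm_nonneg _))) 2
    rw [mul_pow] at h5
    refine h5.trans (mul_le_mul_of_nonneg_right ?_ (sq_nonneg _))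
    nlinarith [hR.xi_le, hs.card, sq_nonneg (maxRowNorm X)]
  have h6 : 3 / 4 * c * m * ‖g‖ ^ 2 ≤ m * inner ℝ (GSW.gram X s.active) (outer g) := by
    nlinarith
  nlinarith

lemma Good.exists_direction (hR : Regime X v c η l m₀) (h0 : 0 < φ) (h1 : φ ≤ 1)
    (hs : Good X c η m₀ s) (hp : p ∈ s.active) :
    ∃ g : Vec d, ‖g‖ ≤ 2 * maxRowNorm X / (c * s.active.card) ∧
      ∀ i ∈ s.active.erase p,
        stepDirection (augmented φ X) s.active p i = -inner ℝ (covariate X i) g := by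
  have hm0 : (0 : ℝ) < s.active.card := by linarith [hR.two_le, hs.card]
  have hc := hR.c_pos
  obtain ⟨g, hg, hg'⟩ := exists_stepDirection_eq h0 h1 X hp (σ := c / 2 * s.active.card)
    (by positivity) (hs.lower_erase hR hp)
  refine ⟨g, hg.trans (le_of_eq ?_), hg'⟩
  field_simp

lemma Good.abs_direction_le (hR : Regime X v c η l m₀) (h0 : 0 < φ) (h1 : φ ≤ 1)
    (hs : Good X c η m₀ s) (hp : p ∈ s.active) {i : Fin n} (hi : i ∈ s.active.erase p) :
    |stepDirection (augmented φ X) s.active p i| ≤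
      2 * maxRowNorm X ^ 2 / c / s.active.card := by
  obtain ⟨g, hg, hg'⟩ := hs.exists_direction hR h0 h1 hp
  rw [hg' i hi, abs_neg]
  have h2 : maxRowNorm X * (2 * maxRowNorm X / (c * s.active.card)) =
      2 * maxRowNorm X ^ 2 / c / s.active.card := by
    rw [div_div]; ring
  rw [← h2]
  exact (abs_real_inner_le_norm _ _).trans
    (mul_le_mul (norm_covariate_le X i) hg (norm_nonneg _) (maxRowNorm_nonneg X))

lemma Good.abs_direction_le_eighth (hR : Regime X v c η l m₀) (h0 : 0 < φ) (h1 : φ ≤ 1)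
    (hs : Good X c η m₀ s) (hp : p ∈ s.active) :
    ∀ i ∈ s.active.erase p, |stepDirection (augmented φ X) s.active p i| ≤ 1 / 8 := by
  intro i hi
  refine (hs.abs_direction_le hR h0 h1 hp hi).trans ?_
  have hm0 : (0 : ℝ) < s.active.card := by linarith [hR.two_le, hs.card]
  have hc := hR.c_pos
  rw [div_div, div_le_div_iff₀ (by positivity) (by norm_num)]
  nlinarith [hR.xi_le, hs.card]

lemma Good.small_half (hR : Regime X v c η l m₀) (hs : Good X c η m₀ s) :
    ∀ i ∈ s.active, |s.z i| ≤ 1 / 2 := fun i hi => (hs.small i hi).trans hR.eta_le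

/-- The part of the increment of `⟨z, v⟩` that is not due to the pivot. -/
def defect (φ : ℝ) (X : Matrix (Fin n) (Fin d) ℝ) (v : Vec n) (A : Finset (Fin n)) (p : Fin n) :
    ℝ := inner ℝ (stepDirection (augmented φ X) A p) v - v p

lemma defect_eq_sum (h0 : 0 < φ) (h1 : φ ≤ 1) {A : Finset (Fin n)} (hp : p ∈ A) :
    defect φ X v A p = ∑ i ∈ A.erase p, stepDirection (augmented φ X) A p i * v i := by
  have hu := stepDirection_mem (coercive_augmented h0 h1 X) hp
  rw [defect, PiLp.inner_apply, ← Finset.sum_subset (Finset.subset_univ A),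
    ← Finset.add_sum_erase A _ hp, hu.2]
  · simp [mul_comm]
  · intro i _ hi
    simp [hu.1 i hi]

lemma Good.defect_sq_le (hR : Regime X v c η l m₀) (h0 : 0 < φ) (h1 : φ ≤ 1)
    (hs : Good X c η m₀ s) (hp : p ∈ s.active) :
    defect φ X v s.active p ^ 2 ≤ 8 * maxRowNorm X ^ 2 / c ^ 2 * ‖crossAvg X v s.active‖ ^ 2 +
      8 * maxRowNorm X ^ 4 / (c ^ 2 * s.active.card ^ 2) * v p ^ 2 := by
  obtain ⟨g, hg, hg'⟩ := hs.exists_direction hR h0 h1 hp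
  have hm0 : (0 : ℝ) < s.active.card := by linarith [hR.two_le, hs.card]
  have hc := hR.c_pos
  set m : ℝ := (s.active.card : ℝ) with hm
  set h := ∑ i ∈ s.active.erase p, v i • covariate X i with hh
  have hd : defect φ X v s.active p = -inner ℝ h g := by
    rw [defect_eq_sum h0 h1 hp, hh, sum_inner, ← Finset.sum_neg_distrib]
    refine Finset.sum_congr rfl fun i hi => ?_
    rw [hg' i hi, real_inner_smul_left]
    ring
  have hsum : h = m • crossAvg X v s.active - v p • covariate X p := by
    rw [crossAvg, hm, card_smul_avg _ (hs.active_nonempty hR), ← Finset.add_sum_erase _ _ hp,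
      add_sub_cancel_left]
  have hn : ‖h‖ ^ 2 ≤ 2 * (m ^ 2 * ‖crossAvg X v s.active‖ ^ 2) +
      2 * (v p ^ 2 * maxRowNorm X ^ 2) := by
    have h3 : ‖h‖ ≤ m * ‖crossAvg X v s.active‖ + |v p| * maxRowNorm X := by
      rw [hsum]
      refine (norm_sub_le _ _).trans ?_
      rw [norm_smul, norm_smul, Real.norm_of_nonneg hm0.le, Real.norm_eq_abs]
      gcongr
      exact norm_covariate_le X p
    have h4 := pow_le_pow_left₀ (norm_nonneg h) h3 2
    have h5 := sq_nonneg (m * ‖crossAvg X v s.active‖ - |v p| * maxRowNorm X)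
    have h6 := sq_abs (v p)
    nlinarith
  have hg2 : ‖g‖ ^ 2 ≤ (2 * maxRowNorm X / (c * m)) ^ 2 :=
    pow_le_pow_left₀ (norm_nonneg g) hg 2
  calc defect φ X v s.active p ^ 2 ≤ ‖h‖ ^ 2 * ‖g‖ ^ 2 := by
        rw [hd, neg_sq, ← sq_abs, ← mul_pow]
        exact pow_le_pow_left₀ (abs_nonneg _) (abs_real_inner_le_norm _ _) 2
    _ ≤ (2 * (m ^ 2 * ‖crossAvg X v s.active‖ ^ 2) + 2 * (v p ^ 2 * maxRowNorm X ^ 2)) *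
        (2 * maxRowNorm X / (c * m)) ^ 2 := by gcongr
    _ = _ := by
        field_simp
        ring

lemma abs_le_supNorm (w : Vec n) (i : Fin n) : |w i| ≤ supNorm w :=
  le_ciSup (f := fun i => |w i|) (Set.finite_range _).bddAbove i

lemma supNorm_nonneg (w : Vec n) : 0 ≤ supNorm w := Real.iSup_nonneg fun _ => abs_nonneg _

lemma Good.abs_defect_le (hR : Regime X v c η l m₀) (h0 : 0 < φ) (h1 : φ ≤ 1)
    (hs : Good X c η m₀ s) (hp : p ∈ s.active) :
    |defect φ X v s.active p| ≤ 2 * maxRowNorm X ^ 2 / c * supNorm v := by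
  have hm0 : (0 : ℝ) < s.active.card := by linarith [hR.two_le, hs.card]
  have hc := hR.c_pos
  rw [defect_eq_sum h0 h1 hp]
  refine (Finset.abs_sum_le_sum_abs _ _).trans ?_
  calc ∑ i ∈ s.active.erase p, |stepDirection (augmented φ X) s.active p i * v i|
      ≤ ∑ _i ∈ s.active.erase p,
        2 * maxRowNorm X ^ 2 / c / s.active.card * supNorm v := by
        refine Finset.sum_le_sum fun i hi => ?_
        rw [abs_mul]
        exact mul_le_mul (hs.abs_direction_le hR h0 h1 hp hi) (abs_le_supNorm v i)
          (abs_nonneg _) (by positivity)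
    _ = ((s.active.erase p).card : ℝ) / s.active.card *
        (2 * maxRowNorm X ^ 2 / c * supNorm v) := by
        rw [Finset.sum_const, nsmul_eq_mul]; ring
    _ ≤ 1 * (2 * maxRowNorm X ^ 2 / c * supNorm v) := by
        refine mul_le_mul_of_nonneg_right ?_
          (mul_nonneg (by positivity) (supNorm_nonneg v))
        refine div_le_one_of_le₀ ?_ hm0.le
        exact_mod_cast Finset.card_le_card (Finset.erase_subset _ _)
    _ = _ := one_mul _

end Good

/-! ### The potential -/

section Potential

variable {n d : ℕ} {X : Matrix (Fin n) (Fin d) ℝ} {v : Vec n} {c η l m₀ φ : ℝ} {s : State n}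
  {p : Fin n}

/-- The exponential potential `∑ᵢ 2 cosh (l zᵢ)` over the active units. -/
def expPotential (l : ℝ) (s : State n) : ℝ :=
  ∑ i ∈ s.active, (Real.exp (l * s.z i) + Real.exp (-(l * s.z i)))

lemma expPotential_nonneg (l : ℝ) (s : State n) : 0 ≤ expPotential l s :=
  Finset.sum_nonneg fun _ _ => by positivity

/-- A bounded centred step of variance at most one multiplies exponential moments by at most
`1 + y²`. -/
lemma Good.expect_exp_le (hR : Regime X v c η l m₀) (h0 : 0 < φ) (h1 : φ ≤ 1)
    (hs : Good X c η m₀ s) (hp : p ∈ s.active) {x y : ℝ} (hy : |y| ≤ 1 / 2) :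
    (expect (stepSize s.z (stepDirection (augmented φ X) s.active p)) fun δ =>
      Real.exp (x + y * δ)) ≤ Real.exp x * (1 + y ^ 2) := by
  have hu := stepDirection_mem (coercive_augmented h0 h1 X) hp
  have hsq := expect_stepSize_sq hs.valid hu hp (hs.small_half hR)
    (hs.abs_direction_le_eighth hR h0 h1 hp)
  set u := stepDirection (augmented φ X) s.active p
  have hfin := finite_support_stepSize s.z u
  have hle : ∀ δ ∈ (stepSize s.z u).support,
      Real.exp (x + y * δ) ≤ Real.exp x * ((1 + y * δ) + y ^ 2 * δ ^ 2) := fun δ hδ => by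
    rw [Real.exp_add]
    refine mul_le_mul_of_nonneg_left ?_ (Real.exp_pos x).le
    have h2 : |y * δ| ≤ 1 := by
      rw [abs_mul]
      have := abs_le_two_of_mem_support hs.valid hu.2 hδ
      nlinarith [abs_nonneg y, abs_nonneg δ]
    have := (abs_le.1 (Real.abs_exp_sub_one_sub_id_le h2)).2
    nlinarith
  refine (expect_mono hfin hle).trans ?_
  rw [expect_const_mul hfin, expect_add hfin, expect_add hfin, expect_const hfin,
    expect_const_mul hfin, expect_const_mul hfin, expect_stepSize_id, hsq]
  refine mul_le_mul_of_nonneg_left ?_ (Real.exp_pos x).le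
  nlinarith [mul_nonneg (sq_nonneg y) (sq_nonneg (s.z p))]

lemma expect_finset_sum {α ι : Type*} {q : PMF α} (hq : q.support.Finite) (A : Finset ι)
    (f : ι → α → ℝ) :
    (expect q fun a => ∑ i ∈ A, f i a) = ∑ i ∈ A, expect q (f i) := by
  classical
  induction A using Finset.induction_on with
  | empty => simp [expect_const hq]
  | insert i A hi ih => simp_rw [Finset.sum_insert hi]; rw [expect_add hq, ih]

lemma Good.expect_expPotential_le (hR : Regime X v c η l m₀) (h0 : 0 < φ) (h1 : φ ≤ 1)
    (hs : Good X c η m₀ s) (hp : p ∈ s.active) :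
    (expect (stepSize s.z (stepDirection (augmented φ X) s.active p)) fun δ =>
      expPotential l (s.update p (stepDirection (augmented φ X) s.active p) δ)) ≤
      (1 + (l * (2 * maxRowNorm X ^ 2 / c)) ^ 2 / s.active.card ^ 2) * expPotential l s := by
  have hu := stepDirection_mem (coercive_augmented h0 h1 X) hp
  have hu8 := hs.abs_direction_le_eighth hR h0 h1 hp
  have hub := fun i (hi : i ∈ s.active.erase p) => hs.abs_direction_le hR h0 h1 hp hi
  have hexp := fun (x y : ℝ) (hy : |y| ≤ 1 / 2) => hs.expect_exp_le hR h0 h1 hp (x := x) hy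
  set u := stepDirection (augmented φ X) s.active p
  have hfin := finite_support_stepSize s.z u
  have hm0 : (0 : ℝ) < s.active.card := by linarith [hR.two_le, hs.card]
  have hc := hR.c_pos
  have hl := hR.l_nonneg
  set m : ℝ := (s.active.card : ℝ) with hm
  set U := 2 * maxRowNorm X ^ 2 / c with hU
  have hU0 : 0 ≤ U := by positivity
  have heq : ∀ δ ∈ (stepSize s.z u).support, expPotential l (s.update p u δ) =
      ∑ i ∈ s.active.erase p,
        (Real.exp (l * s.z i + l * u i * δ) + Real.exp (-(l * s.z i) + -(l * u i) * δ)) := by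
    intro δ hδ
    rw [expPotential, active_update_eq hs.valid hu hp (hs.small_half hR) hu8 hδ]
    refine Finset.sum_congr rfl fun i _ => ?_
    simp only [State.update, PiLp.add_apply, PiLp.smul_apply, smul_eq_mul]
    ring_nf
  rw [expect_congr heq, expect_finset_sum hfin, expPotential, Finset.mul_sum]
  have hsub : ∀ i ∈ s.active.erase p,
      (expect (stepSize s.z u) fun δ =>
        Real.exp (l * s.z i + l * u i * δ) + Real.exp (-(l * s.z i) + -(l * u i) * δ)) ≤
      (1 + (l * U) ^ 2 / m ^ 2) * (Real.exp (l * s.z i) + Real.exp (-(l * s.z i))) := by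
    intro i hi
    have h2 : |l * u i| ≤ l * U / m := by
      rw [abs_mul, abs_of_nonneg hl, mul_div_assoc]
      exact mul_le_mul_of_nonneg_left (hub i hi) hl
    have h3 : l * U / m ≤ 1 / 2 := by
      rw [div_le_div_iff₀ hm0 (by norm_num)]
      linarith [hR.l_le, hs.card]
    have h4 : (l * u i) ^ 2 ≤ (l * U) ^ 2 / m ^ 2 := by
      rw [← div_pow, ← sq_abs]
      exact pow_le_pow_left₀ (abs_nonneg _) h2 2
    rw [expect_add hfin]
    have h5 := hexp (l * s.z i) (l * u i) (h2.trans h3)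
    have h6 := hexp (-(l * s.z i)) (-(l * u i)) (by rw [abs_neg]; exact h2.trans h3)
    rw [neg_sq] at h6
    have h7 := mul_le_mul_of_nonneg_left h4 (Real.exp_pos (l * s.z i)).le
    have h8 := mul_le_mul_of_nonneg_left h4 (Real.exp_pos (-(l * s.z i))).le
    linarith
  refine (Finset.sum_le_sum hsub).trans ?_
  refine Finset.sum_le_sum_of_subset_of_nonneg (Finset.erase_subset _ _) fun i _ _ => ?_
  positivity

/-- The part of the potential that depends on the active set only. Its terms are: the error at
the end of the analysis; the martingale that controls the second moment matrix of the active
covariates; the accumulated errors of the single rounds. -/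
def setPotential (X : Matrix (Fin n) (Fin d) ℝ) (v : Vec n) (c m₀ E₀ K ε K₁ : ℝ)
    (A : Finset (Fin n)) : ℝ :=
  E₀ + K * (16 / c ^ 2) * (‖gram X A - gram X Finset.univ‖ ^ 2 +
      4 * maxRowNorm X ^ 4 * (2 / m₀ - 1 / A.card)) +
    (ε + 24 * K₁ * maxRowNorm X ^ 4 / (c ^ 2 * m₀)) * ∑ i ∈ A, v i ^ 2 +
    8 * K₁ * maxRowNorm X ^ 2 / c ^ 2 * (A.card * ‖crossAvg X v A‖ ^ 2)

/-- The potential of a state, which dominates the error of the Gaussian approximation. -/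
def potential (X : Matrix (Fin n) (Fin d) ℝ) (v : Vec n) (c η l m₀ E₀ K ε K₁ : ℝ)
    (s : State n) : ℝ :=
  K * Real.exp (-(l * η)) *
    ((2 - 2 * (l * (2 * maxRowNorm X ^ 2 / c)) ^ 2 / s.active.card) * expPotential l s) +
    setPotential X v c m₀ E₀ K ε K₁ s.active

variable {E₀ K ε K₁ : ℝ}

lemma average_gram_le {A : Finset (Fin n)} (hA : 2 ≤ A.card) :
    (A.card : ℝ)⁻¹ * ∑ p ∈ A, ‖gram X (A.erase p) - gram X Finset.univ‖ ^ 2 ≤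
      ‖gram X A - gram X Finset.univ‖ ^ 2 + maxRowNorm X ^ 4 / (A.card - 1) ^ 2 := by
  refine (average_norm_sq_avg_erase_le _ _ hA).trans ?_
  have hm : (2 : ℝ) ≤ A.card := by exact_mod_cast hA
  refine add_le_add le_rfl ?_
  rw [inv_mul_le_iff₀ (by linarith), ← nsmul_eq_mul]
  refine Finset.sum_le_card_nsmul _ _ _ fun p _ => ?_
  refine div_le_div_of_nonneg_right ?_ (sq_nonneg _)
  rw [norm_outer, ← pow_mul]
  exact pow_le_pow_left₀ (norm_nonneg _) (norm_covariate_le X p) 4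

lemma average_crossAvg_le {A : Finset (Fin n)} (hA : 2 ≤ A.card) :
    (A.card : ℝ)⁻¹ * ∑ p ∈ A, ‖crossAvg X v (A.erase p)‖ ^ 2 ≤ ‖crossAvg X v A‖ ^ 2 +
      maxRowNorm X ^ 2 * ((A.card : ℝ)⁻¹ * ∑ p ∈ A, v p ^ 2) / (A.card - 1) ^ 2 := by
  have h := average_norm_sq_avg_erase_le (fun i => v i • covariate X i) 0 hA
  simp only [sub_zero] at h
  refine h.trans ?_
  have hm : (2 : ℝ) ≤ A.card := by exact_mod_cast hA
  refine add_le_add le_rfl ?_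
  rw [← Finset.sum_div, mul_div_assoc', mul_left_comm]
  refine div_le_div_of_nonneg_right ?_ (sq_nonneg _)
  refine mul_le_mul_of_nonneg_left ?_ (by positivity)
  rw [Finset.mul_sum]
  refine Finset.sum_le_sum fun p _ => ?_
  rw [norm_smul, mul_pow, Real.norm_eq_abs, sq_abs, mul_comm]
  refine mul_le_mul_of_nonneg_right ?_ (sq_nonneg _)
  exact pow_le_pow_left₀ (norm_nonneg _) (norm_covariate_le X p) 2

lemma average_setPotential_le (hc : 0 < c) (hm₀ : 2 ≤ m₀) (hK : 0 ≤ K)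
    (hK₁ : 0 ≤ K₁) {A : Finset (Fin n)} (hA : m₀ < A.card) :
    (A.card : ℝ)⁻¹ * ∑ p ∈ A, (setPotential X v c m₀ E₀ K ε K₁ (A.erase p) + (ε * v p ^ 2 +
      K₁ * (8 * maxRowNorm X ^ 2 / c ^ 2 * ‖crossAvg X v A‖ ^ 2 +
        8 * maxRowNorm X ^ 4 / (c ^ 2 * A.card ^ 2) * v p ^ 2))) ≤
      setPotential X v c m₀ E₀ K ε K₁ A := by
  have hA2 : 2 ≤ A.card := by exact_mod_cast hm₀.trans hA.le
  have hg := average_gram_le (X := X) hA2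
  have hx := average_crossAvg_le (X := X) (v := v) hA2
  set ξ := maxRowNorm X
  set m : ℝ := (A.card : ℝ) with hm
  have hm0 : 0 < m := by linarith
  have hm1 : 0 < m - 1 := by linarith
  set S := m⁻¹ * ∑ p ∈ A, v p ^ 2 with hS
  have hS0 : 0 ≤ S := mul_nonneg (inv_nonneg.2 hm0.le) (Finset.sum_nonneg fun _ _ => sq_nonneg _)
  set Γ := m⁻¹ * ∑ p ∈ A, ‖gram X (A.erase p) - gram X Finset.univ‖ ^ 2 with hΓ
  set Λ := m⁻¹ * ∑ p ∈ A, ‖crossAvg X v (A.erase p)‖ ^ 2 with hΛ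
  set a := ε + 24 * K₁ * ξ ^ 4 / (c ^ 2 * m₀) with ha
  set b := 8 * K₁ * ξ ^ 2 / c ^ 2 with hb
  set V := ∑ p ∈ A, v p ^ 2
  set χ := ‖crossAvg X v A‖ ^ 2
  have hlin : m⁻¹ * ∑ p ∈ A, (setPotential X v c m₀ E₀ K ε K₁ (A.erase p) + (ε * v p ^ 2 +
      K₁ * (8 * ξ ^ 2 / c ^ 2 * χ + 8 * ξ ^ 4 / (c ^ 2 * m ^ 2) * v p ^ 2))) =
      E₀ + K * (16 / c ^ 2) * (Γ + 4 * ξ ^ 4 * (2 / m₀ - 1 / (m - 1))) + a * (V - S) +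
        b * ((m - 1) * Λ) + (ε * S + K₁ * (8 * ξ ^ 2 / c ^ 2 * χ +
          8 * ξ ^ 4 / (c ^ 2 * m ^ 2) * S)) := by
    have hp : ∀ p ∈ A, setPotential X v c m₀ E₀ K ε K₁ (A.erase p) + (ε * v p ^ 2 +
        K₁ * (8 * ξ ^ 2 / c ^ 2 * χ + 8 * ξ ^ 4 / (c ^ 2 * m ^ 2) * v p ^ 2)) =
        (E₀ + K * (16 / c ^ 2) * (4 * ξ ^ 4 * (2 / m₀ - 1 / (m - 1))) + a * V +
          K₁ * (8 * ξ ^ 2 / c ^ 2 * χ)) +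
        K * (16 / c ^ 2) * ‖gram X (A.erase p) - gram X Finset.univ‖ ^ 2 +
        (ε - a + K₁ * (8 * ξ ^ 4 / (c ^ 2 * m ^ 2))) * v p ^ 2 +
        b * (m - 1) * ‖crossAvg X v (A.erase p)‖ ^ 2 := by
      intro p hp
      have hv : ∑ i ∈ A.erase p, v i ^ 2 = V - v p ^ 2 := by
        have h : v p ^ 2 + ∑ i ∈ A.erase p, v i ^ 2 = V :=
          Finset.add_sum_erase A (fun i => v i ^ 2) hp
        linarith
      rw [setPotential, card_erase_real hp, hv]
      ring
    rw [Finset.sum_congr rfl hp, Finset.sum_add_distrib, Finset.sum_add_distrib,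
      Finset.sum_add_distrib, Finset.sum_const, ← Finset.mul_sum, ← Finset.mul_sum,
      ← Finset.mul_sum, nsmul_eq_mul, ← hm, mul_add, mul_add, mul_add, ← mul_assoc,
      inv_mul_cancel₀ hm0.ne', mul_left_comm m⁻¹ (K * _), mul_left_comm m⁻¹ (ε - a + _),
      mul_left_comm m⁻¹ (b * _), ← hΓ, ← hS, ← hΛ]
    ring
  rw [hlin]
  have hJ : ξ ^ 4 / (m - 1) ^ 2 ≤ 4 * ξ ^ 4 * (1 / (m - 1) - 1 / m) := by
    have : 1 / (m - 1) ^ 2 ≤ 4 * (1 / (m - 1) - 1 / m) := by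
      rw [div_sub_div _ _ hm1.ne' hm0.ne', mul_div_assoc', div_le_div_iff₀ (by positivity)
        (by positivity)]
      nlinarith
    have h2 := mul_le_mul_of_nonneg_left this (show 0 ≤ ξ ^ 4 by positivity)
    calc ξ ^ 4 / (m - 1) ^ 2 = ξ ^ 4 * (1 / (m - 1) ^ 2) := by ring
      _ ≤ _ := h2
      _ = _ := by ring
  have hcov : (m - 1) * Λ ≤ (m - 1) * χ + ξ ^ 2 * S / (m - 1) := by
    refine (mul_le_mul_of_nonneg_left hx hm1.le).trans (le_of_eq ?_)
    field_simp
  -- The coefficient of `S` is where the size of `a` enters.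
  have hcoef : ε + K₁ * (8 * ξ ^ 4 / (c ^ 2 * m ^ 2)) + b * ξ ^ 2 / (m - 1) ≤ a := by
    have h1 : 1 / m ^ 2 + 1 / (m - 1) ≤ 3 / m₀ := by
      have e1 : 1 / m ^ 2 ≤ 1 / m₀ :=
        one_div_le_one_div_of_le (by linarith) (by nlinarith)
      have e2 : 1 / (m - 1) ≤ 2 / m₀ := by
        rw [div_le_div_iff₀ hm1 (by linarith)]
        linarith
      calc 1 / m ^ 2 + 1 / (m - 1) ≤ 1 / m₀ + 2 / m₀ := add_le_add e1 e2
        _ = 3 / m₀ := by ring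
    have h2 := mul_le_mul_of_nonneg_left h1 (show 0 ≤ 8 * K₁ * ξ ^ 4 / c ^ 2 by positivity)
    calc ε + K₁ * (8 * ξ ^ 4 / (c ^ 2 * m ^ 2)) + b * ξ ^ 2 / (m - 1)
        = ε + 8 * K₁ * ξ ^ 4 / c ^ 2 * (1 / m ^ 2 + 1 / (m - 1)) := by
          rw [hb]; field_simp; ring
      _ ≤ ε + 8 * K₁ * ξ ^ 4 / c ^ 2 * (3 / m₀) := by linarith
      _ = a := by rw [ha]; field_simp; ring
  have hb0 : 0 ≤ b := by positivity
  have e1 := mul_le_mul_of_nonneg_left hcov hb0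
  have e2 := mul_le_mul_of_nonneg_right hcoef hS0
  have e3 : K * (16 / c ^ 2) * (Γ + 4 * ξ ^ 4 * (2 / m₀ - 1 / (m - 1))) ≤
      K * (16 / c ^ 2) * (‖gram X A - gram X Finset.univ‖ ^ 2 +
        4 * ξ ^ 4 * (2 / m₀ - 1 / m)) := by
    refine mul_le_mul_of_nonneg_left ?_ (by positivity)
    nlinarith
  have e4 : K₁ * (8 * ξ ^ 2 / c ^ 2 * χ) = b * χ := by rw [hb]; ring
  have e5 : b * (ξ ^ 2 * S / (m - 1)) = b * ξ ^ 2 / (m - 1) * S := by ring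
  rw [setPotential, ← hm]
  change _ ≤ E₀ + K * (16 / c ^ 2) * (‖gram X A - gram X Finset.univ‖ ^ 2 +
        4 * ξ ^ 4 * (2 / m₀ - 1 / m)) + a * V + b * (m * χ)
  linarith

lemma le_setPotential (hc : 0 < c) (hm₀ : 2 ≤ m₀) (hK : 0 ≤ K) (hε : 0 ≤ ε)
    (hK₁ : 0 ≤ K₁) {A : Finset (Fin n)} (hA : m₀ / 2 ≤ A.card) :
    E₀ + K * (16 / c ^ 2) * ‖gram X A - gram X Finset.univ‖ ^ 2 ≤
      setPotential X v c m₀ E₀ K ε K₁ A := by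
  have h1 : 1 / (A.card : ℝ) ≤ 2 / m₀ := by
    rw [div_le_div_iff₀ (by linarith) (by linarith)]
    linarith
  have h2 : 0 ≤ K * (16 / c ^ 2) * (4 * maxRowNorm X ^ 4 * (2 / m₀ - 1 / A.card)) := by
    have := sub_nonneg.2 h1
    have := maxRowNorm_nonneg X
    positivity
  have h3 : 0 ≤ (ε + 24 * K₁ * maxRowNorm X ^ 4 / (c ^ 2 * m₀)) * ∑ i ∈ A, v i ^ 2 :=
    mul_nonneg (by positivity) (Finset.sum_nonneg fun _ _ => sq_nonneg _)
  have h4 : 0 ≤ 8 * K₁ * maxRowNorm X ^ 2 / c ^ 2 * (A.card * ‖crossAvg X v A‖ ^ 2) := by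
    positivity
  rw [setPotential]
  linarith

lemma Regime.one_le_factor (hR : Regime X v c η l m₀) {m : ℝ} (hm : m₀ / 2 ≤ m) :
    0 ≤ 2 - 2 * (l * (2 * maxRowNorm X ^ 2 / c)) ^ 2 / m ∧
      (m₀ ≤ m → 1 ≤ 2 - 2 * (l * (2 * maxRowNorm X ^ 2 / c)) ^ 2 / m) := by
  have h := hR.l_sq_le
  have h2 := hR.two_le
  have hm0 : 0 < m := by linarith
  constructor
  · have : 2 * (l * (2 * maxRowNorm X ^ 2 / c)) ^ 2 / m ≤ 2 := by
      rw [div_le_iff₀ hm0]; linarith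
    linarith
  · intro hmm
    have : 2 * (l * (2 * maxRowNorm X ^ 2 / c)) ^ 2 / m ≤ 1 := by
      rw [div_le_iff₀ hm0]; linarith
    linarith

lemma setPotential_le_potential (hR : Regime X v c η l m₀) (hK : 0 ≤ K)
    (hA : m₀ / 2 ≤ s.active.card) :
    setPotential X v c m₀ E₀ K ε K₁ s.active ≤ potential X v c η l m₀ E₀ K ε K₁ s := by
  have h1 := (hR.one_le_factor hA).1
  have h2 := expPotential_nonneg l s
  have : 0 ≤ K * Real.exp (-(l * η)) *
    ((2 - 2 * (l * (2 * maxRowNorm X ^ 2 / c)) ^ 2 / s.active.card) * expPotential l s) := by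
    positivity
  rw [potential]
  linarith

/-- When the walk leaves the good states early, the potential is large. -/
lemma le_potential_of_not_good (hR : Regime X v c η l m₀) (hE : 0 ≤ E₀) (hK : 0 ≤ K)
    (hε : 0 ≤ ε) (hK₁ : 0 ≤ K₁) (hv : Valid s) (hf : Fresh s) (hA : m₀ < s.active.card)
    (hs : ¬ Good X c η m₀ s) : K ≤ potential X v c η l m₀ E₀ K ε K₁ s := by
  have hc := hR.c_pos
  have hA2 : m₀ / 2 ≤ s.active.card := by linarith [hR.two_le]
  have hset := le_setPotential (X := X) (v := v) (E₀ := E₀) hc hR.two_le hK hε hK₁ hA2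
  by_cases hz : ∀ i ∈ s.active, |s.z i| ≤ η
  · refine le_trans ?_ (setPotential_le_potential hR hK hA2)
    refine le_trans ?_ hset
    have hgram : c / 4 < ‖gram X s.active - gram X Finset.univ‖ := by
      by_contra hcon
      exact hs ⟨hv, hf, hA, hz, not_lt.1 hcon⟩
    have h1 : 1 ≤ 16 / c ^ 2 * ‖gram X s.active - gram X Finset.univ‖ ^ 2 := by
      have h2 := pow_le_pow_left₀ (by positivity) hgram.le 2
      calc (1 : ℝ) = 16 / c ^ 2 * (c / 4) ^ 2 := by field_simp; norm_num
        _ ≤ _ := mul_le_mul_of_nonneg_left h2 (by positivity)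
    nlinarith
  · push Not at hz
    obtain ⟨i, hi, hzi⟩ := hz
    have h1 : Real.exp (l * η) ≤ expPotential l s := by
      have h2 : Real.exp (l * η) ≤ Real.exp (l * s.z i) + Real.exp (-(l * s.z i)) := by
        rcases lt_abs.1 hzi with h | h
        · have := Real.exp_le_exp.2 (mul_le_mul_of_nonneg_left h.le hR.l_nonneg)
          linarith [Real.exp_pos (-(l * s.z i))]
        · have := Real.exp_le_exp.2 (mul_le_mul_of_nonneg_left h.le hR.l_nonneg)
          rw [mul_neg] at this
          linarith [Real.exp_pos (l * s.z i)]
      refine h2.trans (Finset.single_le_sum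
        (f := fun i => Real.exp (l * s.z i) + Real.exp (-(l * s.z i)))
        (fun j _ => by positivity) hi)
    have h3 := (hR.one_le_factor hA2).2 hA.le
    have h4 : 1 ≤ Real.exp (-(l * η)) *
        ((2 - 2 * (l * (2 * maxRowNorm X ^ 2 / c)) ^ 2 / s.active.card) * expPotential l s) := by
      calc (1 : ℝ) = Real.exp (-(l * η)) * (1 * Real.exp (l * η)) := by
            rw [one_mul, ← Real.exp_add, neg_add_cancel, Real.exp_zero]
        _ ≤ _ := by gcongr
    have h5 : 0 ≤ setPotential X v c m₀ E₀ K ε K₁ s.active :=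
      le_trans (by positivity) hset
    rw [potential, mul_assoc]
    nlinarith

/-- On good states the potential decreases in expectation by at least the error of the round. -/
lemma Good.average_potential_le (hR : Regime X v c η l m₀) (h0 : 0 < φ) (h1 : φ ≤ 1)
    (hK : 0 ≤ K) (hK₁ : 0 ≤ K₁) (hs : Good X c η m₀ s) :
    (s.active.card : ℝ)⁻¹ * ∑ p ∈ s.active,
      ((expect (stepSize s.z (stepDirection (augmented φ X) s.active p)) fun δ =>
        potential X v c η l m₀ E₀ K ε K₁
          (s.update p (stepDirection (augmented φ X) s.active p) δ)) +
        (ε * v p ^ 2 + K₁ * defect φ X v s.active p ^ 2)) ≤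
      potential X v c η l m₀ E₀ K ε K₁ s := by
  have hm2 := hR.two_le
  have hcard := hs.card
  have hset := average_setPotential_le (X := X) (v := v) (E₀ := E₀) (ε := ε) hR.c_pos hm2 hK hK₁
    hcard
  have hfac := hR.one_le_factor (m := s.active.card - 1) (by linarith)
  set m : ℝ := (s.active.card : ℝ) with hm
  set q := (l * (2 * maxRowNorm X ^ 2 / c)) ^ 2 with hq
  have hq0 : 0 ≤ q := sq_nonneg _
  have hm0 : 0 < m := by linarith
  have hm1 : 0 < m - 1 := by linarith
  set w := K * Real.exp (-(l * η)) with hw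
  have hw0 : 0 ≤ w := by positivity
  have hpsi := expPotential_nonneg l s
  have hp : ∀ p ∈ s.active,
      ((expect (stepSize s.z (stepDirection (augmented φ X) s.active p)) fun δ =>
        potential X v c η l m₀ E₀ K ε K₁
          (s.update p (stepDirection (augmented φ X) s.active p) δ)) +
        (ε * v p ^ 2 + K₁ * defect φ X v s.active p ^ 2)) ≤
      w * ((2 - 2 * q / m) * expPotential l s) +
      (setPotential X v c m₀ E₀ K ε K₁ (s.active.erase p) + (ε * v p ^ 2 +
        K₁ * (8 * maxRowNorm X ^ 2 / c ^ 2 * ‖crossAvg X v s.active‖ ^ 2 +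
          8 * maxRowNorm X ^ 4 / (c ^ 2 * m ^ 2) * v p ^ 2))) := by
    intro p hp
    have hu := stepDirection_mem (coercive_augmented h0 h1 X) hp
    have hu8 := hs.abs_direction_le_eighth hR h0 h1 hp
    have hexp := hs.expect_expPotential_le hR h0 h1 hp
    have hdef := mul_le_mul_of_nonneg_left (hs.defect_sq_le hR h0 h1 hp) hK₁
    set u := stepDirection (augmented φ X) s.active p
    have hfin := finite_support_stepSize s.z u
    have heq : ∀ δ ∈ (stepSize s.z u).support,
        potential X v c η l m₀ E₀ K ε K₁ (s.update p u δ) =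
        w * (2 - 2 * q / (m - 1)) * expPotential l (s.update p u δ) +
          setPotential X v c m₀ E₀ K ε K₁ (s.active.erase p) := by
      intro δ hδ
      rw [potential, active_update_eq hs.valid hu hp (hs.small_half hR) hu8 hδ,
        card_erase_real hp, ← hm, ← hq, ← hw]
      ring
    rw [expect_congr heq, expect_add hfin, expect_const hfin, expect_const_mul hfin]
    have hkey : (2 - 2 * q / (m - 1)) * (1 + q / m ^ 2) ≤ 2 - 2 * q / m := by
      have h2 : (2 - 2 * q / (m - 1)) * (q / m ^ 2) ≤ 2 * (q / m ^ 2) := by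
        refine mul_le_mul_of_nonneg_right ?_ (by positivity)
        have : 0 ≤ 2 * q / (m - 1) := by positivity
        linarith
      have h3 : 2 * (q / m ^ 2) ≤ 2 * q / (m - 1) - 2 * q / m := by
        rw [div_sub_div _ _ hm1.ne' hm0.ne', mul_div_assoc', div_le_div_iff₀ (by positivity)
          (by positivity)]
        nlinarith [mul_nonneg hq0 hm0.le]
      linarith
    have h5 : w * (2 - 2 * q / (m - 1)) *
        (expect (stepSize s.z u) fun δ => expPotential l (s.update p u δ)) ≤
        w * ((2 - 2 * q / m) * expPotential l s) := by
      calc w * (2 - 2 * q / (m - 1)) *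
          (expect (stepSize s.z u) fun δ => expPotential l (s.update p u δ))
          ≤ w * (2 - 2 * q / (m - 1)) * ((1 + q / m ^ 2) * expPotential l s) :=
            mul_le_mul_of_nonneg_left hexp (mul_nonneg hw0 hfac.1)
        _ = w * (((2 - 2 * q / (m - 1)) * (1 + q / m ^ 2)) * expPotential l s) := by ring
        _ ≤ _ := by gcongr
    linarith
  refine (mul_le_mul_of_nonneg_left (Finset.sum_le_sum hp) (by positivity)).trans ?_
  rw [Finset.sum_add_distrib, mul_add, Finset.sum_const, nsmul_eq_mul, ← mul_assoc, ← hm,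
    inv_mul_cancel₀ hm0.ne', one_mul, potential, ← hm, ← hq, ← hw]
  exact add_le_add le_rfl hset

/-- The comparison principle: the expectation of `G` at the end of the walk is close to `F` at
the beginning, if `F` is almost preserved by a round started in a good state, and the two are
comparable at the states where the good phase ends. -/
theorem norm_expect_walkFrom_sub_le {E : Type*} [NormedAddCommGroup E] [NormedSpace ℝ E]
    (hR : Regime X v c η l m₀) (h0 : 0 < φ) (h1 : φ ≤ 1)
    (hE₀ : 0 ≤ E₀) (hK : 0 ≤ K) (hε : 0 ≤ ε) (hK₁ : 0 ≤ K₁) {F G : State n → E}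
    (hbad : ∀ k s, Valid s → s.active.card ≤ k →
      ‖expect (walkFrom (augmented φ X) k s) G - F s‖ ≤ K)
    (hend : ∀ k s, Valid s → s.active.card ≤ k → (s.active.card : ℝ) ≤ m₀ →
      ‖expect (walkFrom (augmented φ X) k s) G - F s‖ ≤ E₀)
    (hstep : ∀ s, Good X c η m₀ s → ∀ p ∈ s.active,
      ‖(expect (stepSize s.z (stepDirection (augmented φ X) s.active p)) fun δ =>
        F (s.update p (stepDirection (augmented φ X) s.active p) δ)) - F s‖ ≤
        ε * v p ^ 2 + K₁ * defect φ X v s.active p ^ 2)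
    (k : ℕ) {s : State n} (hv : Valid s) (hf : Fresh s) (hk : s.active.card ≤ k)
    (hA : m₀ / 2 ≤ s.active.card) :
    ‖expect (walkFrom (augmented φ X) k s) G - F s‖ ≤ potential X v c η l m₀ E₀ K ε K₁ s := by
  induction k generalizing s with
  | zero =>
    have : (s.active.card : ℝ) ≤ 0 := by exact_mod_cast hk
    linarith [hR.two_le]
  | succ k ih =>
    rcases le_or_gt (s.active.card : ℝ) m₀ with hsm | hsm
    · refine (hend _ s hv hk hsm).trans ?_
      refine le_trans ?_ (setPotential_le_potential hR hK hA)
      refine le_trans ?_ (le_setPotential hR.c_pos hR.two_le hK hε hK₁ hA)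
      have : 0 ≤ K * (16 / c ^ 2) * ‖gram X s.active - gram X Finset.univ‖ ^ 2 := by positivity
      linarith
    by_cases hs : Good X c η m₀ s
    swap
    · exact (hbad _ s hv hk).trans (le_potential_of_not_good hR hE₀ hK hε hK₁ hv hf hsm hs)
    refine le_trans ?_ (hs.average_potential_le hR h0 h1 hK hK₁)
    have hne := hs.active_nonempty hR
    have hm0 : (0 : ℝ) < s.active.card := by linarith [hR.two_le]
    rw [expect_walkFrom_succ, expect_step_of_fresh hf hne]
    have hFs : F s = (s.active.card : ℝ)⁻¹ • ∑ p ∈ s.active, F s := by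
      rw [Finset.sum_const, ← Nat.cast_smul_eq_nsmul ℝ, smul_smul, inv_mul_cancel₀ hm0.ne',
        one_smul]
    nth_rewrite 1 [hFs]
    rw [← smul_sub, ← Finset.sum_sub_distrib, norm_smul, Real.norm_of_nonneg (by positivity)]
    refine mul_le_mul_of_nonneg_left ?_ (by positivity)
    refine (norm_sum_le _ _).trans (Finset.sum_le_sum fun p hp => ?_)
    have hu := stepDirection_mem (coercive_augmented h0 h1 X) hp
    have hu8 := hs.abs_direction_le_eighth hR h0 h1 hp
    have hst := hstep s hs p hp
    set u := stepDirection (augmented φ X) s.active p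
    have hfin := finite_support_stepSize s.z u
    have hsplit : (expect (stepSize s.z u) fun δ =>
        expect (walkFrom (augmented φ X) k (s.update p u δ)) G) - F s =
        (expect (stepSize s.z u) fun δ =>
          (expect (walkFrom (augmented φ X) k (s.update p u δ)) G - F (s.update p u δ))) +
        ((expect (stepSize s.z u) fun δ => F (s.update p u δ)) - F s) := by
      rw [expect_sub hfin]; abel
    rw [hsplit]
    refine (norm_add_le _ _).trans (add_le_add ?_ hst)
    refine (norm_expect_le hfin _).trans (expect_mono hfin fun δ hδ => ?_)
    have hact := active_update_eq hv hu hp (hs.small_half hR) hu8 hδ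
    refine ih (valid_update hv hu (mem_stepRange_of_mem_support hv hu.2 hδ)) ?_ ?_ ?_
    · intro r hr
      obtain rfl : p = r := by simpa [State.update] using hr
      rw [hact]
      exact Finset.notMem_erase _ _
    · rw [hact, Finset.card_erase_of_mem hp]
      omega
    · rw [hact, card_erase_real hp]
      linarith [hR.two_le]

lemma potential_init_le (hR : Regime X v c η l m₀) (hK : 0 ≤ K) :
    potential X v c η l m₀ E₀ K ε K₁ (State.init n) ≤
      E₀ + 4 * K * (n * Real.exp (-(l * η))) + 128 * K * (maxRowNorm X ^ 4 / (c ^ 2 * m₀)) +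
        (ε + 24 * K₁ * maxRowNorm X ^ 4 / (c ^ 2 * m₀)) := by
  have hc := hR.c_pos
  have hm2 := hR.two_le
  have hn0 : (0 : ℝ) < n := by linarith [hR.le_n]
  have hcross : crossAvg X v Finset.univ = 0 := by
    have := hR.orth
    rw [covSum] at this
    rw [crossAvg, avg, this, smul_zero]
  have hv : ∑ i, v i ^ 2 = 1 := by
    have := EuclideanSpace.norm_sq_eq v
    rw [hR.unit] at this
    simpa using this.symm
  have hset : setPotential X v c m₀ E₀ K ε K₁ Finset.univ ≤
      E₀ + 128 * K * (maxRowNorm X ^ 4 / (c ^ 2 * m₀)) +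
        (ε + 24 * K₁ * maxRowNorm X ^ 4 / (c ^ 2 * m₀)) := by
    rw [setPotential, hcross, hv, sub_self, norm_zero]
    have h1 : K * (16 / c ^ 2) * (0 ^ 2 + 4 * maxRowNorm X ^ 4 *
        (2 / m₀ - 1 / ((Finset.univ : Finset (Fin n)).card : ℝ))) ≤
        K * (16 / c ^ 2) * (4 * maxRowNorm X ^ 4 * (2 / m₀)) := by
      refine mul_le_mul_of_nonneg_left ?_ (by positivity)
      rw [zero_pow two_ne_zero, zero_add]
      refine mul_le_mul_of_nonneg_left ?_ (by positivity)
      have : 0 ≤ 1 / ((Finset.univ : Finset (Fin n)).card : ℝ) := by positivity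
      linarith
    have h2 : K * (16 / c ^ 2) * (4 * maxRowNorm X ^ 4 * (2 / m₀)) =
        128 * K * (maxRowNorm X ^ 4 / (c ^ 2 * m₀)) := by
      field_simp; ring
    rw [h2] at h1
    have h3 : ‖(0 : Vec d)‖ = 0 := norm_zero
    rw [h3]
    linarith
  have hexp : expPotential l (State.init n) = 2 * n := by
    simp [expPotential, State.init]
    ring
  rw [potential, hexp]
  have hfac : 2 - 2 * (l * (2 * maxRowNorm X ^ 2 / c)) ^ 2 / ((State.init n).active.card : ℝ) ≤ 2 :=
    sub_le_self _ (by positivity)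
  have h3 : K * Real.exp (-(l * η)) *
      ((2 - 2 * (l * (2 * maxRowNorm X ^ 2 / c)) ^ 2 / ((State.init n).active.card : ℝ)) *
        (2 * n)) ≤ K * Real.exp (-(l * η)) * (2 * (2 * n)) := by
    gcongr
  have h4 : setPotential X v c m₀ E₀ K ε K₁ (State.init n).active ≤ _ := hset
  linarith

end Potential

/-! ### Gaussian approximation for one experiment -/

section Approximation

variable {n d : ℕ} {X : Matrix (Fin n) (Fin d) ℝ} {v : Vec n} {c η l m₀ φ ρ : ℝ} {s : State n}
  {p : Fin n}

lemma sum_sq_nonneg (v : Vec n) (A : Finset (Fin n)) : 0 ≤ ∑ i ∈ A, v i ^ 2 :=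
  Finset.sum_nonneg fun _ _ => sq_nonneg _

lemma Regime.sum_sq_le_one (hR : Regime X v c η l m₀) (A : Finset (Fin n)) :
    ∑ i ∈ A, v i ^ 2 ≤ 1 := by
  have h := EuclideanSpace.norm_sq_eq v
  rw [hR.unit] at h
  have h2 : ∑ i ∈ A, v i ^ 2 ≤ ∑ i, v i ^ 2 :=
    Finset.sum_le_sum_of_subset_of_nonneg (Finset.subset_univ A) fun _ _ _ => sq_nonneg _
  simp only [Real.norm_eq_abs, sq_abs] at h
  linarith

lemma sq_le_supNorm_sq (v : Vec n) (i : Fin n) : v i ^ 2 ≤ supNorm v ^ 2 := by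
  rw [← sq_abs]
  exact pow_le_pow_left₀ (abs_nonneg _) (abs_le_supNorm v i) 2

lemma sum_sq_le_card (v : Vec n) (A : Finset (Fin n)) {m : ℝ} (hA : (A.card : ℝ) ≤ m) :
    ∑ i ∈ A, v i ^ 2 ≤ m * supNorm v ^ 2 := by
  calc ∑ i ∈ A, v i ^ 2 ≤ ∑ _i ∈ A, supNorm v ^ 2 :=
        Finset.sum_le_sum fun i _ => sq_le_supNorm_sq v i
    _ = A.card * supNorm v ^ 2 := by rw [Finset.sum_const, nsmul_eq_mul]
    _ ≤ _ := mul_le_mul_of_nonneg_right hA (sq_nonneg _)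

lemma expect_walkFrom_sub_sq (B : Matrix (Fin n ⊕ Fin d) (Fin n) ℝ) (v : Vec n) (k : ℕ)
    (s : State n) :
    (expect (walkFrom B k s) fun s' => (inner ℝ s'.z v - inner ℝ s.z v) ^ 2) =
      (expect (walkFrom B k s) fun s' => inner ℝ s'.z v ^ 2) - inner ℝ s.z v ^ 2 := by
  have hfin := finite_support_walkFrom B k s
  have h : (fun s' : State n => (inner ℝ s'.z v - inner ℝ s.z v : ℝ) ^ 2) = fun s' =>
      (inner ℝ s'.z v ^ 2 + (-2 * inner ℝ s.z v) * inner ℝ s'.z v) + inner ℝ s.z v ^ 2 := by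
    funext s'; ring
  rw [h, expect_add hfin, expect_add hfin, expect_const_mul hfin, expect_const hfin,
    expect_walkFrom_inner]
  ring

lemma expect_walkFrom_sub_sq_le (h0 : 0 < φ) (h1 : φ ≤ 1) (v : Vec n) (k : ℕ) (hs : Valid s) :
    (expect (walkFrom (augmented φ X) k s) fun s' => (inner ℝ s'.z v - inner ℝ s.z v) ^ 2) ≤
      (∑ i ∈ s.active, v i ^ 2) / φ := by
  rw [expect_walkFrom_sub_sq]
  linarith [expect_walkFrom_inner_sq_le h0 h1 X v k hs]

lemma Good.inner_eq (v : Vec n) :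
    inner ℝ (stepDirection (augmented φ X) s.active p) v = v p + defect φ X v s.active p := by
  rw [defect]; ring

lemma inner_update (s : State n) (p : Fin n) (u v : Vec n) (δ : ℝ) :
    inner ℝ (s.update p u δ).z v = inner ℝ s.z v + δ * inner ℝ u v := by
  simp only [State.update, inner_add_left, real_inner_smul_left]

lemma abs_variance_sub_le {v r z : ℝ} (hρ : 0 < ρ) (hη : |z| ≤ η) (hz : |z| ≤ 1) :
    |(1 - z ^ 2) * (v + r) ^ 2 - v ^ 2| ≤ (η ^ 2 + ρ) * v ^ 2 + (1 + 1 / ρ) * r ^ 2 := by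
  have hz2 : z ^ 2 ≤ η ^ 2 := by
    rw [← sq_abs]; exact pow_le_pow_left₀ (abs_nonneg _) hη 2
  have hz1 : z ^ 2 ≤ 1 := by
    rw [← sq_abs]; exact pow_le_one₀ (abs_nonneg _) hz
  have hy : |2 * v * r + r ^ 2| ≤ ρ * v ^ 2 + (1 + 1 / ρ) * r ^ 2 := by
    have e1 : ρ * v ^ 2 + 1 / ρ * r ^ 2 - 2 * v * r = (ρ * v - r) ^ 2 / ρ := by
      field_simp; ring
    have e2 : ρ * v ^ 2 + 1 / ρ * r ^ 2 + 2 * v * r = (ρ * v + r) ^ 2 / ρ := by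
      field_simp; ring
    have e3 : 0 ≤ (ρ * v - r) ^ 2 / ρ := by positivity
    have e4 : 0 ≤ (ρ * v + r) ^ 2 / ρ := by positivity
    rw [abs_le]
    constructor <;> nlinarith [sq_nonneg r]
  have heq : (1 - z ^ 2) * (v + r) ^ 2 - v ^ 2 =
      -(z ^ 2 * v ^ 2) + (1 - z ^ 2) * (2 * v * r + r ^ 2) := by ring
  rw [heq]
  refine (abs_add_le _ _).trans ?_
  rw [abs_neg, abs_mul (1 - z ^ 2), abs_of_nonneg (by positivity : 0 ≤ z ^ 2 * v ^ 2),
    abs_of_nonneg (by linarith : 0 ≤ 1 - z ^ 2)]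
  have h1 := mul_le_mul_of_nonneg_right hz2 (sq_nonneg v)
  have h2 := mul_le_of_le_one_left (abs_nonneg (2 * v * r + r ^ 2))
    (by linarith [sq_nonneg z] : 1 - z ^ 2 ≤ 1)
  linarith

/-- The variance of the estimator in a direction orthogonal to the covariates. -/
theorem abs_expect_sq_sub_one_le (hR : Regime X v c η l m₀) (h0 : 0 < φ) (h1 : φ ≤ 1)
    (hρ : 0 < ρ) :
    |(expect (run (augmented φ X) n) fun s => inner ℝ s.z v ^ 2) - 1| ≤
      m₀ * supNorm v ^ 2 / φ + 4 * (1 / φ) * (n * Real.exp (-(l * η))) +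
        128 * (1 / φ) * (maxRowNorm X ^ 4 / (c ^ 2 * m₀)) +
        ((η ^ 2 + ρ) + 24 * (1 + 1 / ρ) * maxRowNorm X ^ 4 / (c ^ 2 * m₀)) := by
  have hm2 := hR.two_le
  have hgen : ∀ k s, Valid s → ‖(expect (walkFrom (augmented φ X) k s) fun s' =>
      (inner ℝ s'.z v : ℝ) ^ 2) - (inner ℝ s.z v ^ 2 + ∑ i ∈ s.active, v i ^ 2)‖ ≤
      (∑ i ∈ s.active, v i ^ 2) / φ := by
    intro k s hs
    have e1 := expect_walkFrom_inner_sq_le h0 h1 X v k hs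
    have e2 : 0 ≤ (expect (walkFrom (augmented φ X) k s) fun s' =>
        (inner ℝ s'.z v - inner ℝ s.z v) ^ 2) :=
      expect_nonneg (finite_support_walkFrom _ _ _) fun _ _ => sq_nonneg _
    rw [expect_walkFrom_sub_sq] at e2
    have e3 := sum_sq_nonneg v s.active
    have e4 : ∑ i ∈ s.active, v i ^ 2 ≤ (∑ i ∈ s.active, v i ^ 2) / φ := by
      rw [le_div_iff₀ h0]
      exact mul_le_of_le_one_right e3 h1
    rw [Real.norm_eq_abs, abs_le]
    constructor <;> linarith
  have hmain := norm_expect_walkFrom_sub_le (E₀ := m₀ * supNorm v ^ 2 / φ) (K := 1 / φ)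
    (ε := η ^ 2 + ρ) (K₁ := 1 + 1 / ρ)
    (G := fun s => (inner ℝ s.z v : ℝ) ^ 2)
    (F := fun s => inner ℝ s.z v ^ 2 + ∑ i ∈ s.active, v i ^ 2) hR h0 h1 (by positivity)
    (by positivity) (by positivity) (by positivity)
    (fun k s hs _ => (hgen k s hs).trans
      (div_le_div_of_nonneg_right (hR.sum_sq_le_one _) h0.le))
    (fun k s hs _ hcard => (hgen k s hs).trans
      (div_le_div_of_nonneg_right (sum_sq_le_card v _ hcard) h0.le))
    ?_ n valid_init fresh_init (by simp [State.init])
    (by simp [State.init]; linarith [hR.le_n])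
  · have hinit := hmain.trans (potential_init_le hR (by positivity))
    rw [run_eq_walkFrom]
    have hv : ∑ i, v i ^ 2 = 1 := by
      have := EuclideanSpace.norm_sq_eq v
      rw [hR.unit] at this
      simpa using this.symm
    have hF : (inner ℝ (State.init n).z v : ℝ) ^ 2 + ∑ i ∈ (State.init n).active, v i ^ 2 = 1 := by
      simp [State.init, hv]
    simp only [hF] at hinit
    exact hinit
  · intro s hs p hp
    have hu := stepDirection_mem (coercive_augmented h0 h1 X) hp
    have hu8 := hs.abs_direction_le_eighth hR h0 h1 hp
    have hw := Good.inner_eq (φ := φ) (X := X) (s := s) (p := p) v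
    have hsq := expect_stepSize_sq hs.valid hu hp (hs.small_half hR) hu8
    set u := stepDirection (augmented φ X) s.active p
    set r := defect φ X v s.active p
    have hfin := finite_support_stepSize s.z u
    have heq : ∀ δ ∈ (stepSize s.z u).support,
        (inner ℝ (s.update p u δ).z v : ℝ) ^ 2 + ∑ i ∈ (s.update p u δ).active, v i ^ 2 =
        (inner ℝ s.z v ^ 2 + ∑ i ∈ s.active, v i ^ 2 - v p ^ 2) +
          (2 * inner ℝ s.z v * (v p + r)) * δ + (v p + r) ^ 2 * δ ^ 2 := by
      intro δ hδ
      rw [active_update_eq hs.valid hu hp (hs.small_half hR) hu8 hδ, inner_update, hw,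
        ← Finset.add_sum_erase s.active (fun i => v i ^ 2) hp]
      ring
    rw [expect_congr heq, expect_add hfin, expect_add hfin, expect_const hfin,
      expect_const_mul hfin, expect_const_mul hfin, expect_stepSize_id, hsq, Real.norm_eq_abs]
    have := abs_variance_sub_le (v := v p) (r := r) hρ (hs.small p hp) (hs.valid.1 p)
    refine le_trans (le_of_eq ?_) this
    congr 1
    ring

lemma norm_exp_mul_I_sub_le (x : ℝ) :
    ‖Complex.exp (x * Complex.I) - 1 - x * Complex.I‖ ≤ 3 * x ^ 2 := by
  have hn : ‖(x : ℂ) * Complex.I‖ = |x| := by simp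
  rcases le_or_gt |x| 1 with h | h
  · have := Complex.norm_exp_sub_one_sub_id_le (x := x * Complex.I) (by rw [hn]; exact h)
    rw [hn, sq_abs] at this
    linarith [sq_nonneg x]
  · refine (norm_sub_le _ _).trans ?_
    have h1 : ‖Complex.exp (x * Complex.I) - 1‖ ≤ 2 := by
      refine (norm_sub_le _ _).trans ?_
      rw [Complex.norm_exp_ofReal_mul_I, norm_one]
      norm_num
    rw [hn]
    nlinarith [sq_abs x]

lemma norm_exp_mul_I_sub_quadratic_le {x : ℝ} (hx : |x| ≤ 1) :
    ‖Complex.exp (x * Complex.I) - 1 - x * Complex.I + (x : ℂ) ^ 2 / 2‖ ≤ |x| ^ 3 := by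
  have hn : ‖(x : ℂ) * Complex.I‖ = |x| := by simp
  have h := Complex.exp_bound (x := x * Complex.I) (by rw [hn]; exact hx) (n := 3) (by norm_num)
  rw [hn] at h
  have he : Complex.exp (x * Complex.I) - 1 - x * Complex.I + (x : ℂ) ^ 2 / 2 =
      Complex.exp (x * Complex.I) -
        ∑ m ∈ Finset.range 3, (x * Complex.I) ^ m / (m.factorial : ℂ) := by
    simp only [Finset.sum_range_succ, Finset.sum_range_zero, Nat.factorial, mul_pow,
      Complex.I_sq]
    push_cast
    ring
  rw [he]
  refine h.trans ?_
  refine mul_le_of_le_one_right (by positivity) ?_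
  norm_num [Nat.factorial]

/-- A centred two-point step of conditional variance close to `v²` has almost the characteristic
function of a Gaussian of variance `v²`. -/
lemma Good.norm_expect_exp_sub_le (hR : Regime X v c η l m₀) (h0 : 0 < φ) (h1 : φ ≤ 1)
    (hρ : 0 < ρ) {θ ν : ℝ} (hν : (1 + 2 * maxRowNorm X ^ 2 / c) * supNorm v ≤ ν)
    (hθ : 2 * |θ| * ν ≤ 1) (hs : Good X c η m₀ s) (hp : p ∈ s.active) :
    ‖(expect (stepSize s.z (stepDirection (augmented φ X) s.active p)) fun δ =>
        Complex.exp ((θ * (δ * inner ℝ (stepDirection (augmented φ X) s.active p) v) : ℝ) *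
          Complex.I)) - (Real.exp (-(θ ^ 2 / 2 * v p ^ 2)) : ℂ)‖ ≤
      (θ ^ 2 / 2 * (η ^ 2 + ρ) + 4 * |θ| ^ 3 * ν + θ ^ 4 * ν ^ 2) * v p ^ 2 +
        (θ ^ 2 / 2 * (1 + 1 / ρ) + 4 * |θ| ^ 3 * ν) * defect φ X v s.active p ^ 2 := by
  have hc := hR.c_pos
  have hu := stepDirection_mem (coercive_augmented h0 h1 X) hp
  have hu8 := hs.abs_direction_le_eighth hR h0 h1 hp
  have hw := Good.inner_eq (φ := φ) (X := X) (s := s) (p := p) v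
  have hsq := expect_stepSize_sq hs.valid hu hp (hs.small_half hR) hu8
  have hdef := hs.abs_defect_le hR h0 h1 hp
  rw [hw]
  set u := stepDirection (augmented φ X) s.active p
  set r := defect φ X v s.active p
  set w := v p + r with hwdef
  have hfin := finite_support_stepSize s.z u
  have hsup := supNorm_nonneg v
  have hvν : |v p| ≤ ν := by
    refine (abs_le_supNorm v p).trans (le_trans ?_ hν)
    have : 0 ≤ 2 * maxRowNorm X ^ 2 / c * supNorm v := by positivity
    linarith
  have hwν : |w| ≤ ν := by
    refine (abs_add_le _ _).trans (le_trans ?_ hν)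
    linarith [abs_le_supNorm v p]
  have hν0 : 0 ≤ ν := (abs_nonneg _).trans hvν
  have hθ0 := abs_nonneg θ
  have hvar := abs_variance_sub_le (v := v p) (r := r) hρ (hs.small p hp) (hs.valid.1 p)
  -- The Taylor expansion of the exponential of the step.
  have htaylor : ‖(expect (stepSize s.z u) fun δ => Complex.exp ((θ * (δ * w) : ℝ) * Complex.I)) -
      ((1 - θ ^ 2 / 2 * ((1 - s.z p ^ 2) * w ^ 2) : ℝ) : ℂ)‖ ≤ 2 * |θ| ^ 3 * ν * w ^ 2 := by
    have hexp : (expect (stepSize s.z u) fun δ =>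
        ((1 : ℂ) + (θ * w * Complex.I) * (δ : ℂ) +
          (-(θ ^ 2 / 2 * w ^ 2 : ℝ) : ℂ) * ((δ ^ 2 : ℝ) : ℂ))) =
        ((1 - θ ^ 2 / 2 * ((1 - s.z p ^ 2) * w ^ 2) : ℝ) : ℂ) := by
      have hof : ∀ f : ℝ → ℝ, (expect (stepSize s.z u) fun δ => ((f δ : ℝ) : ℂ)) =
          ((expect (stepSize s.z u) f : ℝ) : ℂ) := fun f => by
        rw [expect_eq_sum_support hfin, expect_eq_sum_support hfin]
        push_cast
        simp
      rw [expect_add hfin, expect_add hfin, expect_const hfin, expect_const_mul hfin,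
        expect_const_mul hfin, hof (fun δ => δ), hof (fun δ => δ ^ 2), expect_stepSize_id, hsq]
      push_cast
      ring
    rw [← hexp, ← expect_sub hfin]
    refine (norm_expect_le hfin _).trans ?_
    have hle : ∀ δ ∈ (stepSize s.z u).support,
        ‖Complex.exp ((θ * (δ * w) : ℝ) * Complex.I) - ((1 : ℂ) + (θ * w * Complex.I) * (δ : ℂ) +
          (-(θ ^ 2 / 2 * w ^ 2 : ℝ) : ℂ) * ((δ ^ 2 : ℝ) : ℂ))‖ ≤
        (2 * |θ| ^ 3 * ν * w ^ 2) * δ ^ 2 := by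
      intro δ hδ
      have hδ2 := abs_le_two_of_mem_support hs.valid hu.2 hδ
      have hx : |θ * (δ * w)| = |θ| * |w| * |δ| := by
        rw [abs_mul, abs_mul]; ring
      have hx1 : |θ * (δ * w)| ≤ 1 := by
        rw [hx]
        calc |θ| * |w| * |δ| ≤ |θ| * ν * 2 := by gcongr
          _ ≤ 1 := by linarith
      have h := norm_exp_mul_I_sub_quadratic_le hx1
      have he : Complex.exp ((θ * (δ * w) : ℝ) * Complex.I) - 1 -
          ((θ * (δ * w) : ℝ) : ℂ) * Complex.I + ((θ * (δ * w) : ℝ) : ℂ) ^ 2 / 2 =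
          Complex.exp ((θ * (δ * w) : ℝ) * Complex.I) - ((1 : ℂ) + (θ * w * Complex.I) * (δ : ℂ) +
          (-(θ ^ 2 / 2 * w ^ 2 : ℝ) : ℂ) * ((δ ^ 2 : ℝ) : ℂ)) := by
        push_cast
        ring
      rw [he] at h
      refine h.trans ?_
      rw [hx]
      calc (|θ| * |w| * |δ|) ^ 3 = |θ| ^ 3 * |w| * w ^ 2 * (|δ| * δ ^ 2) := by
            rw [← sq_abs w, ← sq_abs δ]; ring
        _ ≤ |θ| ^ 3 * ν * w ^ 2 * (2 * δ ^ 2) := by gcongr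
        _ = _ := by ring
    refine (expect_mono hfin hle).trans ?_
    rw [expect_const_mul hfin, hsq]
    refine mul_le_of_le_one_right (by positivity) ?_
    linarith [sq_nonneg (s.z p)]
  set y := θ ^ 2 / 2 * v p ^ 2 with hy
  have hy0 : 0 ≤ y := by positivity
  have hv2 : v p ^ 2 ≤ ν ^ 2 := by
    rw [← sq_abs]; exact pow_le_pow_left₀ (abs_nonneg _) hvν 2
  have hy1 : y ≤ 1 := by
    have h4 : (2 * |θ| * ν) ^ 2 ≤ 1 := pow_le_one₀ (by positivity) hθ
    have h5 : θ ^ 2 * v p ^ 2 ≤ |θ| ^ 2 * ν ^ 2 := by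
      rw [sq_abs]; gcongr
    rw [hy]
    nlinarith
  have hgauss : |(1 - y) - Real.exp (-y)| ≤ θ ^ 4 * ν ^ 2 * v p ^ 2 := by
    have h4 := Real.abs_exp_sub_one_sub_id_le (x := -y)
      (by rw [abs_neg, abs_of_nonneg hy0]; exact hy1)
    rw [neg_sq] at h4
    have h5 : y ^ 2 ≤ θ ^ 4 * ν ^ 2 * v p ^ 2 := by
      calc y ^ 2 = θ ^ 4 * (v p ^ 2 / 4) * v p ^ 2 := by rw [hy]; ring
        _ ≤ θ ^ 4 * ν ^ 2 * v p ^ 2 := by gcongr; linarith [sq_nonneg (v p)]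
    rw [abs_sub_comm]
    refine le_trans (le_of_eq ?_) (h4.trans h5)
    congr 1
    ring
  have hmid : |(1 - θ ^ 2 / 2 * ((1 - s.z p ^ 2) * w ^ 2)) - (1 - y)| ≤
      θ ^ 2 / 2 * ((η ^ 2 + ρ) * v p ^ 2 + (1 + 1 / ρ) * r ^ 2) := by
    have he : (1 - θ ^ 2 / 2 * ((1 - s.z p ^ 2) * w ^ 2)) - (1 - y) =
        -(θ ^ 2 / 2 * ((1 - s.z p ^ 2) * w ^ 2 - v p ^ 2)) := by rw [hy]; ring
    rw [he, abs_neg, abs_mul, abs_of_nonneg (by positivity : 0 ≤ θ ^ 2 / 2)]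
    exact mul_le_mul_of_nonneg_left hvar (by positivity)
  have hw2 : w ^ 2 ≤ 2 * v p ^ 2 + 2 * r ^ 2 := by
    rw [hwdef]; nlinarith [sq_nonneg (v p - r)]
  have hw3 := mul_le_mul_of_nonneg_left hw2 (show 0 ≤ 2 * |θ| ^ 3 * ν by positivity)
  have hsplit := norm_sub_le_norm_sub_add_norm_sub
    (expect (stepSize s.z u) fun δ => Complex.exp ((θ * (δ * w) : ℝ) * Complex.I))
    ((1 - θ ^ 2 / 2 * ((1 - s.z p ^ 2) * w ^ 2) : ℝ) : ℂ) (Real.exp (-y) : ℂ)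
  have hreal : ‖((1 - θ ^ 2 / 2 * ((1 - s.z p ^ 2) * w ^ 2) : ℝ) : ℂ) - (Real.exp (-y) : ℂ)‖ ≤
      θ ^ 2 / 2 * ((η ^ 2 + ρ) * v p ^ 2 + (1 + 1 / ρ) * r ^ 2) + θ ^ 4 * ν ^ 2 * v p ^ 2 := by
    rw [← Complex.ofReal_sub, Complex.norm_real, Real.norm_eq_abs]
    exact (abs_sub_le _ (1 - y) _).trans (add_le_add hmid hgauss)
  refine hsplit.trans ((add_le_add htaylor hreal).trans ?_)
  linarith

/-- The characteristic function of the estimator in a direction orthogonal to the covariates is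
almost Gaussian. -/
theorem norm_expect_exp_sub_gaussian_le (hR : Regime X v c η l m₀) (h0 : 0 < φ) (h1 : φ ≤ 1)
    (hρ : 0 < ρ) {θ ν : ℝ} (hν : (1 + 2 * maxRowNorm X ^ 2 / c) * supNorm v ≤ ν)
    (hθ : 2 * |θ| * ν ≤ 1) :
    ‖(expect (run (augmented φ X) n) fun s => Complex.exp ((θ * inner ℝ s.z v : ℝ) * Complex.I)) -
      (Real.exp (-(θ ^ 2 / 2)) : ℂ)‖ ≤
      4 * θ ^ 2 * (m₀ * supNorm v ^ 2 / φ) + 4 * 2 * (n * Real.exp (-(l * η))) +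
        128 * 2 * (maxRowNorm X ^ 4 / (c ^ 2 * m₀)) +
        ((θ ^ 2 / 2 * (η ^ 2 + ρ) + 4 * |θ| ^ 3 * ν + θ ^ 4 * ν ^ 2) +
          24 * (θ ^ 2 / 2 * (1 + 1 / ρ) + 4 * |θ| ^ 3 * ν) * maxRowNorm X ^ 4 / (c ^ 2 * m₀)) := by
  have hm2 := hR.two_le
  have hc := hR.c_pos
  have hsup := supNorm_nonneg v
  have hν0 : 0 ≤ ν := le_trans (by positivity) hν
  set F : State n → ℂ := fun s => Complex.exp ((θ * inner ℝ s.z v : ℝ) * Complex.I) *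
    (Real.exp (-(θ ^ 2 / 2 * ∑ i ∈ s.active, v i ^ 2)) : ℂ) with hF
  set G : State n → ℂ := fun s => Complex.exp ((θ * inner ℝ s.z v : ℝ) * Complex.I) with hG
  have hG1 : ∀ s, ‖G s‖ = 1 := fun s => Complex.norm_exp_ofReal_mul_I _
  have hE1 : ∀ x : ℝ, 0 ≤ x → ‖((Real.exp (-x) : ℝ) : ℂ)‖ ≤ 1 := fun x hx => by
    rw [Complex.norm_real, Real.norm_of_nonneg (Real.exp_pos _).le, Real.exp_le_one_iff]
    linarith
  have hF1 : ∀ s, ‖F s‖ ≤ 1 := fun s => by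
    rw [hF]
    simp only
    rw [norm_mul, Complex.norm_exp_ofReal_mul_I, one_mul]
    exact hE1 _ (mul_nonneg (by positivity) (sum_sq_nonneg v _))
  have hgen : ∀ k s, Valid s → ‖expect (walkFrom (augmented φ X) k s) G - F s‖ ≤
      4 * θ ^ 2 * ((∑ i ∈ s.active, v i ^ 2) / φ) := by
    intro k s hs
    have hfin := finite_support_walkFrom (augmented φ X) k s
    set V := ∑ i ∈ s.active, v i ^ 2 with hV
    have hV0 : 0 ≤ V := sum_sq_nonneg v _
    set M : ℝ := inner ℝ s.z v with hM
    have hof : (expect (walkFrom (augmented φ X) k s) fun s' =>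
        (((inner ℝ s'.z v : ℝ) - M : ℝ) : ℂ)) = 0 := by
      rw [expect_eq_sum_support hfin]
      have := expect_walkFrom_inner (augmented φ X) k s v
      have h3 : (expect (walkFrom (augmented φ X) k s) fun s' => (inner ℝ s'.z v : ℝ) - M) = 0 := by
        rw [expect_sub hfin, this, expect_const hfin, sub_self]
      rw [expect_eq_sum_support hfin] at h3
      have h4 := congrArg (fun x : ℝ => (x : ℂ)) h3
      push_cast at h4 ⊢
      simpa using h4
    have hlin : expect (walkFrom (augmented φ X) k s) G - G s =
        expect (walkFrom (augmented φ X) k s) fun s' => G s *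
          (Complex.exp ((θ * (inner ℝ s'.z v - M) : ℝ) * Complex.I) - 1 -
            (θ * (inner ℝ s'.z v - M) : ℝ) * Complex.I) := by
      have hpt : ∀ s', G s * (Complex.exp ((θ * (inner ℝ s'.z v - M) : ℝ) * Complex.I) - 1 -
            (θ * (inner ℝ s'.z v - M) : ℝ) * Complex.I) =
          G s' - (G s + (G s * θ * Complex.I) * (((inner ℝ s'.z v : ℝ) - M : ℝ) : ℂ)) := by
        intro s'
        have : G s' = G s * Complex.exp ((θ * (inner ℝ s'.z v - M) : ℝ) * Complex.I) := by
          simp only [hG]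
          rw [← Complex.exp_add]
          congr 1
          rw [hM]
          push_cast
          ring
        rw [this]
        push_cast
        ring
      simp_rw [hpt]
      rw [expect_sub hfin, expect_add hfin, expect_const hfin, expect_const_mul hfin, hof, mul_zero,
        add_zero]
    have hfirst : ‖expect (walkFrom (augmented φ X) k s) G - G s‖ ≤ 3 * θ ^ 2 * (V / φ) := by
      rw [hlin]
      refine (norm_expect_le hfin _).trans ?_
      have hle : ∀ s' ∈ (walkFrom (augmented φ X) k s).support,
          ‖G s * (Complex.exp ((θ * (inner ℝ s'.z v - M) : ℝ) * Complex.I) - 1 -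
            (θ * (inner ℝ s'.z v - M) : ℝ) * Complex.I)‖ ≤
          3 * θ ^ 2 * (inner ℝ s'.z v - M) ^ 2 := by
        intro s' _
        rw [norm_mul, hG1, one_mul]
        refine (norm_exp_mul_I_sub_le _).trans (le_of_eq ?_)
        ring
      refine (expect_mono hfin hle).trans ?_
      rw [expect_const_mul hfin]
      exact mul_le_mul_of_nonneg_left (expect_walkFrom_sub_sq_le h0 h1 v k hs) (by positivity)
    have hsecond : ‖G s - F s‖ ≤ θ ^ 2 * (V / φ) := by
      have he : G s - F s = G s * ((1 - Real.exp (-(θ ^ 2 / 2 * V)) : ℝ) : ℂ) := by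
        simp only [hG, hF, ← hV]
        rw [Complex.ofReal_sub, Complex.ofReal_one]
        ring
      rw [he, norm_mul, hG1, one_mul, Complex.norm_real, Real.norm_eq_abs]
      have h3 := Real.one_sub_le_exp_neg (θ ^ 2 / 2 * V)
      have h4 : Real.exp (-(θ ^ 2 / 2 * V)) ≤ 1 := by
        rw [Real.exp_le_one_iff]
        have : 0 ≤ θ ^ 2 / 2 * V := by positivity
        linarith
      rw [abs_of_nonneg (by linarith)]
      have h5 : V ≤ V / φ := by
        rw [le_div_iff₀ h0]
        exact mul_le_of_le_one_right hV0 h1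
      have h6 := mul_le_mul_of_nonneg_left h5 (sq_nonneg θ)
      have h7 : 0 ≤ θ ^ 2 * V := by positivity
      linarith
    calc ‖expect (walkFrom (augmented φ X) k s) G - F s‖
        ≤ ‖expect (walkFrom (augmented φ X) k s) G - G s‖ + ‖G s - F s‖ :=
          norm_sub_le_norm_sub_add_norm_sub _ _ _
      _ ≤ 3 * θ ^ 2 * (V / φ) + θ ^ 2 * (V / φ) := add_le_add hfirst hsecond
      _ = _ := by ring
  have hmain := norm_expect_walkFrom_sub_le (E₀ := 4 * θ ^ 2 * (m₀ * supNorm v ^ 2 / φ)) (K := 2)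
    (ε := θ ^ 2 / 2 * (η ^ 2 + ρ) + 4 * |θ| ^ 3 * ν + θ ^ 4 * ν ^ 2)
    (K₁ := θ ^ 2 / 2 * (1 + 1 / ρ) + 4 * |θ| ^ 3 * ν)
    (G := G) (F := F) hR h0 h1 (by positivity)
    (by positivity) (by positivity) (by positivity)
    (fun k s hs _ => by
      have hfin := finite_support_walkFrom (augmented φ X) k s
      refine (norm_sub_le _ _).trans ?_
      have : ‖expect (walkFrom (augmented φ X) k s) G‖ ≤ 1 := by
        refine (norm_expect_le hfin _).trans ?_
        simp_rw [hG1]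
        rw [expect_const hfin]
      linarith [hF1 s])
    (fun k s hs _ hcard => (hgen k s hs).trans (mul_le_mul_of_nonneg_left
      (div_le_div_of_nonneg_right (sum_sq_le_card v _ hcard) h0.le) (by positivity)))
    ?_ n valid_init fresh_init (by simp [State.init])
    (by simp [State.init]; linarith [hR.le_n])
  · have hinit := hmain.trans (potential_init_le hR (by positivity))
    rw [run_eq_walkFrom]
    have hv : ∑ i, v i ^ 2 = 1 := by
      have := EuclideanSpace.norm_sq_eq v
      rw [hR.unit] at this
      simpa using this.symm
    have hFi : F (State.init n) = (Real.exp (-(θ ^ 2 / 2)) : ℂ) := by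
      have e1 : inner ℝ (State.init n).z v = 0 := inner_zero_left v
      have e2 : ∑ i ∈ (State.init n).active, v i ^ 2 = 1 := hv
      simp only [hF, e1, e2]
      simp
    rw [hFi] at hinit
    exact hinit
  · intro s hs p hp
    have hu := stepDirection_mem (coercive_augmented h0 h1 X) hp
    have hu8 := hs.abs_direction_le_eighth hR h0 h1 hp
    have hkey := hs.norm_expect_exp_sub_le hR h0 h1 hρ hν hθ hp
    set u := stepDirection (augmented φ X) s.active p
    have hfin := finite_support_stepSize s.z u
    have hV := Finset.add_sum_erase s.active (fun i => v i ^ 2) hp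
    simp only at hV
    set V' := ∑ i ∈ s.active.erase p, v i ^ 2 with hV'
    have hV'0 : 0 ≤ V' := sum_sq_nonneg v _
    have heq : ∀ δ ∈ (stepSize s.z u).support, F (s.update p u δ) =
        (G s * (Real.exp (-(θ ^ 2 / 2 * V')) : ℂ)) *
          Complex.exp ((θ * (δ * inner ℝ u v) : ℝ) * Complex.I) := by
      intro δ hδ
      simp only [hF, hG]
      rw [active_update_eq hs.valid hu hp (hs.small_half hR) hu8 hδ, inner_update, ← hV',
        mul_right_comm, ← Complex.exp_add]
      congr 2
      push_cast
      ring
    have hFs : F s = (G s * (Real.exp (-(θ ^ 2 / 2 * V')) : ℂ)) *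
        (Real.exp (-(θ ^ 2 / 2 * v p ^ 2)) : ℂ) := by
      simp only [hF, hG]
      rw [← hV, mul_assoc, ← Complex.ofReal_mul, ← Real.exp_add]
      congr 3
      ring
    rw [expect_congr heq, hFs, expect_const_mul hfin, ← mul_sub, norm_mul, norm_mul, hG1, one_mul]
    refine (mul_le_of_le_one_left (norm_nonneg _) (hE1 _ (by positivity))).trans hkey

end Approximation

/-! ### The estimator as a linear statistic -/

section Estimator

variable {n d : ℕ}

/-- The smallest singular value bounds the map from below. -/
lemma sigmaMin_sq_mul_le (X : Matrix (Fin n) (Fin d) ℝ) (g : Vec d) :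
    sigmaMin X ^ 2 * ‖g‖ ^ 2 ≤ ‖Matrix.toEuclideanLin X g‖ ^ 2 := by
  rcases Nat.eq_zero_or_pos d with rfl | hd
  · have : g = 0 := Subsingleton.elim _ _
    simp [this]
  set T := Matrix.toEuclideanLin X
  have hn : Module.finrank ℝ (Vec d) = d := by simp
  have hsym := T.isSymmetric_adjoint_comp_self
  set b := hsym.eigenvectorBasis hn
  have hT : ‖T g‖ ^ 2 = ∑ i, hsym.eigenvalues hn i * inner ℝ (b i) g ^ 2 := by
    rw [← real_inner_self_eq_norm_sq, ← LinearMap.adjoint_inner_right, ← b.sum_inner_mul_inner]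
    refine Finset.sum_congr rfl fun i _ => ?_
    have h1 : inner ℝ (b i) (LinearMap.adjoint T (T g)) =
        hsym.eigenvalues hn i * inner ℝ (b i) g := by
      have h2 := hsym (b i) g
      rw [hsym.apply_eigenvectorBasis hn i] at h2
      rw [← LinearMap.comp_apply, ← h2, inner_smul_left]
      simp [b]
    rw [h1, real_inner_comm]
    ring
  have hg : ‖g‖ ^ 2 = ∑ i, inner ℝ (b i) g ^ 2 := by
    rw [← real_inner_self_eq_norm_sq, ← b.sum_inner_mul_inner]
    refine Finset.sum_congr rfl fun i _ => ?_
    rw [real_inner_comm]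
    ring
  rw [hT, hg, Finset.mul_sum]
  refine Finset.sum_le_sum fun i _ => mul_le_mul_of_nonneg_right ?_ (sq_nonneg _)
  rw [← T.sq_singularValues_fin hn i]
  refine pow_le_pow_left₀ (T.singularValues_nonneg _) ?_ 2
  exact T.singularValues_antitone (by omega)

lemma norm_toEuclideanLin_sq (X : Matrix (Fin n) (Fin d) ℝ) (g : Vec d) :
    ‖Matrix.toEuclideanLin X g‖ ^ 2 = ∑ i, inner ℝ (covariate X i) g ^ 2 := by
  rw [EuclideanSpace.norm_sq_eq]
  refine Finset.sum_congr rfl fun i _ => ?_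
  rw [toEuclideanLin_apply_eq_inner, Real.norm_eq_abs, sq_abs]

lemma covSum_residual (X : Matrix (Fin n) (Fin d) ℝ) (μ : Vec n) :
    covSum X (residual X μ) = 0 := by
  have h : inner ℝ (residual X μ) (Matrix.toEuclideanLin X (covSum X (residual X μ))) = 0 :=
    Submodule.inner_left_of_mem_orthogonal (LinearMap.mem_range_self _ _)
      ((colSpace X)ᗮ.starProjection_apply_mem μ)
  rw [inner_toEuclideanLin] at h
  exact inner_self_eq_zero.1 h

lemma ae_toMeasure_map {α γ : Type*} [MeasurableSpace γ] [MeasurableSingletonClass γ]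
    {p : PMF α} (hp : p.support.Finite) (g : α → γ) {Q : γ → Prop}
    (h : ∀ a ∈ p.support, Q (g a)) : ∀ᵐ x ∂(p.map g).toMeasure, Q x := by
  rw [← PMF.restrict_toMeasure_support]
  refine ae_restrict_of_forall_mem (finite_support_map g hp).measurableSet fun x hx => ?_
  rw [PMF.support_map] at hx
  obtain ⟨a, ha, rfl⟩ := hx
  exact h a ha

variable {φ : ℝ} {X : Matrix (Fin n) (Fin d) ℝ}

lemma integral_design {E : Type*} [NormedAddCommGroup E] [NormedSpace ℝ E] [CompleteSpace E]
    (φ : ℝ) (X : Matrix (Fin n) (Fin d) ℝ) (f : Vec n → E) :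
    ∫ z, f z ∂(design φ X) = expect (run (augmented φ X) n) fun s => f s.z :=
  integral_toMeasure_map (finite_support_run _ _) State.z f

lemma eq_one_or_eq_neg_one (h0 : 0 < φ) (h1 : φ ≤ 1) {s : State n}
    (hs : s ∈ (run (augmented φ X) n).support) (i : Fin n) : s.z i = 1 ∨ s.z i = -1 := by
  have hB := coercive_augmented h0 h1 X
  rw [run_eq_walkFrom] at hs
  have hv := valid_of_mem_support_walkFrom hB valid_init hs
  have he := active_eq_empty_of_mem_support hB valid_init (by simp [State.init]) hs
  have h2 : ¬ |s.z i| < 1 := fun h => by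
    have := (hv.2 i).2 h
    simp [he] at this
  have h3 : |s.z i| = 1 := le_antisymm (hv.1 i) (not_lt.1 h2)
  rcases abs_choice (s.z i) with h | h
  · exact Or.inl (h ▸ h3)
  · right; linarith

lemma expect_run_inner (B : Matrix (Fin n ⊕ Fin d) (Fin n) ℝ) (y : Vec n) :
    (expect (run B n) fun s => inner ℝ s.z y) = 0 := by
  rw [run_eq_walkFrom, expect_walkFrom_inner]
  exact inner_zero_left y

/-- Both treatments are equally likely for each unit. -/
lemma design_real_eq_half (h0 : 0 < φ) (h1 : φ ≤ 1) (i : Fin n) {e : ℝ} (he : e = 1 ∨ e = -1) :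
    (design φ X).real {w | w i = e} = 1 / 2 := by
  have hfin := finite_support_run (augmented φ X) n
  have hmeas : MeasurableSet {w : Vec n | w i = e} :=
    (isClosed_eq (by fun_prop) continuous_const).measurableSet
  have hz : (expect (run (augmented φ X) n) fun s => s.z i) = 0 := by
    have := expect_run_inner (augmented φ X) (EuclideanSpace.single i 1)
    simpa [EuclideanSpace.inner_single_right] using this
  rw [← integral_indicator_one hmeas, integral_design]
  have heq : ∀ s ∈ (run (augmented φ X) n).support,
      Set.indicator {w : Vec n | w i = e} (1 : Vec n → ℝ) s.z = 1 / 2 + e / 2 * s.z i := by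
    intro s hs
    rcases eq_one_or_eq_neg_one h0 h1 hs i with h | h <;> rcases he with rfl | rfl <;>
      simp [Set.indicator_apply, h] <;> norm_num
  rw [expect_congr heq, expect_add hfin, expect_const hfin, expect_const_mul hfin, hz]
  ring

lemma horvitzThompson_sub_ate (h0 : 0 < φ) (h1 : φ ≤ 1) (a b : Vec n) {s : State n}
    (hs : s ∈ (run (augmented φ X) n).support) :
    horvitzThompson (design φ X) a b s.z = ate a b + (1 / n : ℝ) * inner ℝ s.z (a + b) := by
  rw [horvitzThompson, ate, ← mul_add]
  congr 1
  rw [Finset.sum_filter, Finset.sum_filter, ← Finset.sum_sub_distrib, PiLp.inner_apply,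
    ← Finset.sum_add_distrib]
  refine Finset.sum_congr rfl fun i _ => ?_
  rw [design_real_eq_half h0 h1 i (Or.inl rfl), design_real_eq_half h0 h1 i (Or.inr rfl)]
  rcases eq_one_or_eq_neg_one h0 h1 hs i with h | h
  · rw [h, if_pos rfl, if_neg (by norm_num)]
    simp
    ring
  · rw [h, if_neg (by norm_num), if_pos rfl]
    simp
    ring

lemma horvitzThompson_ae_eq (h0 : 0 < φ) (h1 : φ ≤ 1) (a b : Vec n) :
    horvitzThompson (design φ X) a b =ᵐ[design φ X]
      fun z => ate a b + (1 / n : ℝ) * inner ℝ z (a + b) :=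
  ae_toMeasure_map (finite_support_run _ _) State.z fun _ hs => horvitzThompson_sub_ate h0 h1 a b hs

lemma variance_horvitzThompson (h0 : 0 < φ) (h1 : φ ≤ 1) (a b : Vec n) :
    variance (horvitzThompson (design φ X) a b) (design φ X) =
      (expect (run (augmented φ X) n) fun s => inner ℝ s.z (a + b) ^ 2) / (n : ℝ) ^ 2 := by
  have hfin := finite_support_run (augmented φ X) n
  rw [variance_congr (horvitzThompson_ae_eq h0 h1 a b),
    variance_eq_integral (Continuous.aemeasurable (by fun_prop)), integral_design, integral_design,
    expect_add hfin, expect_const hfin, expect_const_mul hfin, expect_run_inner]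
  have : (fun s : State n => (ate a b + (1 / n : ℝ) * inner ℝ s.z (a + b) -
      (ate a b + (1 / n : ℝ) * 0)) ^ 2) =
      fun s => (1 / n : ℝ) ^ 2 * inner ℝ s.z (a + b) ^ 2 := by
    funext s; ring
  rw [this, expect_const_mul hfin]
  ring

/-- The characteristic function of the studentized estimator. -/
lemma charFun_map_studentized (h0 : 0 < φ) (h1 : φ ≤ 1) (hn : n ≠ 0) (a b : Vec n) (θ : ℝ) :
    charFun ((design φ X).map fun z => (horvitzThompson (design φ X) a b z - ate a b) /
      √(variance (horvitzThompson (design φ X) a b) (design φ X))) θ =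
    expect (run (augmented φ X) n) fun s => Complex.exp ((θ * (inner ℝ s.z (a + b) /
      √(expect (run (augmented φ X) n) fun s => inner ℝ s.z (a + b) ^ 2)) : ℝ) * Complex.I) := by
  have hn' : (0 : ℝ) < n := by positivity
  set S := expect (run (augmented φ X) n) fun s => (inner ℝ s.z (a + b) : ℝ) ^ 2
  have hae : (fun z => (horvitzThompson (design φ X) a b z - ate a b) /
      √(variance (horvitzThompson (design φ X) a b) (design φ X))) =ᵐ[design φ X]
      fun z => inner ℝ z (a + b) / √S := by
    filter_upwards [horvitzThompson_ae_eq h0 h1 a b] with z hz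
    rw [hz, variance_horvitzThompson h0 h1, Real.sqrt_div' _ (sq_nonneg _),
      Real.sqrt_sq hn'.le, add_sub_cancel_left]
    change 1 / (n : ℝ) * inner ℝ z (a + b) / (√S / n) = inner ℝ z (a + b) / √S
    rcases eq_or_ne (√S) 0 with h | h
    · simp [h]
    · field_simp
  have hcont : Continuous fun z : Vec n => inner ℝ z (a + b) / √S := by fun_prop
  rw [Measure.map_congr hae, charFun_apply_real, integral_map hcont.aemeasurable (by fun_prop),
    integral_design]
  congr 1
  funext s
  push_cast
  rfl

lemma aemeasurable_studentized (h0 : 0 < φ) (h1 : φ ≤ 1) (a b : Vec n) :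
    AEMeasurable (fun z => (horvitzThompson (design φ X) a b z - ate a b) /
      √(variance (horvitzThompson (design φ X) a b) (design φ X))) (design φ X) := by
  have hcont : Continuous fun z : Vec n => ate a b + (1 / n : ℝ) * inner ℝ z (a + b) := by fun_prop
  have : AEMeasurable (horvitzThompson (design φ X) a b) (design φ X) :=
    ⟨_, hcont.measurable, horvitzThompson_ae_eq h0 h1 a b⟩
  exact (this.sub_const _).div_const _

end Estimator

/-! ### Asymptotics -/

section Asymptotics

lemma supNorm_smul {n : ℕ} {t : ℝ} (ht : 0 ≤ t) (v : Vec n) : supNorm (t • v) = t * supNorm v := by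
  unfold supNorm
  rw [Real.mul_iSup_of_nonneg ht]
  simp [abs_mul, abs_of_nonneg ht]

/-- The Cauchy–Schwarz inequality. -/
lemma expect_mul_sq_le {α : Type*} {p : PMF α} (hp : p.support.Finite) (f g : α → ℝ) :
    (expect p fun a => f a * g a) ^ 2 ≤
      (expect p fun a => f a ^ 2) * expect p fun a => g a ^ 2 := by
  rw [expect_eq_sum_support hp, expect_eq_sum_support hp, expect_eq_sum_support hp]
  have h := Finset.sum_mul_sq_le_sq_mul_sq hp.toFinset (fun a => √(p a).toReal * f a)
    (fun a => √(p a).toReal * g a)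
  have hs : ∀ a, √(p a).toReal * √(p a).toReal = (p a).toReal := fun a =>
    Real.mul_self_sqrt ENNReal.toReal_nonneg
  have e1 : ∀ a, √(p a).toReal * f a * (√(p a).toReal * g a) = (p a).toReal • (f a * g a) := by
    intro a; rw [smul_eq_mul, ← hs]; simp only [hs]; linear_combination (f a * g a) * hs a
  have e2 : ∀ (f : α → ℝ) a, (√(p a).toReal * f a) ^ 2 = (p a).toReal • f a ^ 2 := by
    intro f a; rw [smul_eq_mul, mul_pow, sq (√_), hs]
  simpa only [e1, e2] using h

lemma tendsto_log_natCast : Tendsto (fun n : ℕ => Real.log n) atTop atTop :=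
  Real.tendsto_log_atTop.comp tendsto_natCast_atTop_atTop

lemma tendsto_inv_log_rpow {c : ℝ} (hc : 0 < c) :
    Tendsto (fun n : ℕ => (Real.log n ^ c)⁻¹) atTop (𝓝 0) :=
  ((tendsto_rpow_atTop hc).comp tendsto_log_natCast).inv_tendsto_atTop

lemma tendsto_inv_log_pow {k : ℕ} (hk : k ≠ 0) :
    Tendsto (fun n : ℕ => (Real.log n ^ k)⁻¹) atTop (𝓝 0) :=
  ((tendsto_pow_atTop hk).comp tendsto_log_natCast).inv_tendsto_atTop

lemma eventually_const_mul_log_pow_le (M : ℝ) (k : ℕ) :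
    ∀ᶠ n : ℕ in atTop, M * Real.log n ^ k ≤ n := by
  have h := (Real.isLittleO_pow_log_id_atTop (n := k)).comp_tendsto tendsto_natCast_atTop_atTop
  have h2 := h.def (c := (|M| + 1)⁻¹) (by positivity)
  filter_upwards [h2, tendsto_log_natCast.eventually_ge_atTop 0] with n hn hL
  simp only [Function.comp_apply, id_eq, norm_pow, Real.norm_eq_abs, Nat.abs_cast] at hn
  rw [abs_of_nonneg hL, inv_mul_eq_div, le_div_iff₀ (by positivity)] at hn
  have : 0 ≤ Real.log n ^ k := by positivity
  nlinarith [le_abs_self M]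

/-- The residual, scaled to unit length. -/
def unitResidual {n d : ℕ} (X : Matrix (Fin n) (Fin d) ℝ) (μ : Vec n) : Vec n :=
  ‖residual X μ‖⁻¹ • residual X μ

variable {d : ℕ} {X : ∀ n : ℕ, Matrix (Fin n) (Fin d) ℝ} {μ : ∀ n : ℕ, Vec n} {β : ℕ → Vec d}
  {φ : ℕ → ℝ}

lemma eventually_residual_pos (hnd : NonDegeneracy fun n => residual (X n) (μ n)) :
    ∀ᶠ n in atTop, 0 < ‖residual (X n) (μ n)‖ := by
  obtain ⟨c, _, h⟩ := hnd
  filter_upwards [h, tendsto_log_natCast.eventually_gt_atTop 0] with n hn hL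
  have h2 : 0 < ‖residual (X n) (μ n)‖ ^ 2 := (Real.rpow_pos_of_pos hL _).trans_le hn
  exact (norm_nonneg _).lt_of_ne' fun h0 => by simp [h0] at h2

/-- Under the regularity assumptions the quantitative analysis applies with a cutoff of order
`log⁶ n`, and all its error terms vanish. -/
lemma exists_regime (hout : OutcomeRegularity (fun n => residual (X n) (μ n)) β)
    (hcov : CovariateRegularity X) (hnd : NonDegeneracy fun n => residual (X n) (μ n)) :
    ∃ c > (0 : ℝ), ∃ M > (0 : ℝ),
      (∀ᶠ n : ℕ in atTop, Regime (X n) (unitResidual (X n) (μ n)) c (1 / Real.log n)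
        (2 * Real.log n ^ 2) (M * Real.log n ^ 6)) ∧
      Tendsto (fun n : ℕ => M * Real.log n ^ 6 * supNorm (unitResidual (X n) (μ n)) ^ 2)
        atTop (𝓝 0) ∧
      Tendsto (fun n : ℕ => (1 + 2 * maxRowNorm (X n) ^ 2 / c) *
        supNorm (unitResidual (X n) (μ n))) atTop (𝓝 0) ∧
      Tendsto (fun n : ℕ => (1 + Real.log n) *
        (maxRowNorm (X n) ^ 4 / (c ^ 2 * (M * Real.log n ^ 6)))) atTop (𝓝 0) := by
  have hpos := eventually_residual_pos hnd
  obtain ⟨c₁, hc₁, C₁, hC₁, hout⟩ := hout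
  obtain ⟨c, hc, C, hC, hcov⟩ := hcov
  set D : ℝ := C * d with hD
  have hD0 : 0 ≤ D := by positivity
  set M : ℝ := 32 * D ^ 2 / c ^ 2 + 8 * D / c + 16 * D / c + 1 with hM
  have hM0 : 0 < M := by positivity
  have hξ : ∀ᶠ n : ℕ in atTop, maxRowNorm (X n) ^ 2 ≤ D * Real.log n := by
    filter_upwards [hcov] with n hn using hn.2
  have hL1 : ∀ᶠ n : ℕ in atTop, 2 ≤ Real.log n := tendsto_log_natCast.eventually_ge_atTop 2
  have hsup : ∀ᶠ n : ℕ in atTop, supNorm (unitResidual (X n) (μ n)) ≤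
      C₁ * (Real.log n ^ 3)⁻¹ * (Real.log n ^ c₁)⁻¹ := by
    filter_upwards [hout, hL1] with n hn hL
    have hL0 : 0 < Real.log n := by linarith
    rw [unitResidual, supNorm_smul (by positivity), inv_mul_eq_div]
    refine hn.1.trans (le_of_eq ?_)
    rw [Real.rpow_add hL0, show (3 : ℝ) = ((3 : ℕ) : ℝ) by norm_num, Real.rpow_natCast]
    field_simp
  refine ⟨c, hc, M, hM0, ?_, ?_, ?_, ?_⟩
  · have hM1 : 32 * D ^ 2 / c ^ 2 ≤ M ∧ 8 * D / c ≤ M ∧ 16 * D / c ≤ M ∧ 1 ≤ M := by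
      have e1 : 0 ≤ 32 * D ^ 2 / c ^ 2 := by positivity
      have e2 : 0 ≤ 8 * D / c := by positivity
      have e3 : 0 ≤ 16 * D / c := by positivity
      refine ⟨?_, ?_, ?_, ?_⟩ <;> linarith
    filter_upwards [hpos, hξ, hL1, hcov, eventually_const_mul_log_pow_le M 6,
      eventually_gt_atTop 0] with n hr hx hL hcv hn hn0
    have hL0 : 0 < Real.log n := by linarith
    have hLL : 1 ≤ Real.log n := by linarith
    set L := Real.log n
    set ξ := maxRowNorm (X n)
    have hn0' : (0 : ℝ) < n := by exact_mod_cast hn0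
    have hU : 2 * L ^ 2 * (2 * ξ ^ 2 / c) ≤ 4 * D / c * L ^ 3 := by
      calc 2 * L ^ 2 * (2 * ξ ^ 2 / c) ≤ 2 * L ^ 2 * (2 * (D * L) / c) := by gcongr
        _ = _ := by ring
    have hp3 : L ^ 3 ≤ L ^ 6 := pow_le_pow_right₀ hLL (by norm_num)
    have hp1 : L ≤ L ^ 6 := le_self_pow₀ hLL (by norm_num)
    constructor
    · exact hc
    · intro g
      have h1 : c * n ≤ sigmaMin (X n) ^ 2 := by
        have h2 := pow_le_pow_left₀ (Real.sqrt_nonneg _) hcv.1 2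
        rwa [Real.sq_sqrt (by positivity)] at h2
      have h2 := sigmaMin_sq_mul_le (X n) g
      rw [norm_toEuclideanLin_sq] at h2
      rw [inv_mul_eq_div, le_div_iff₀ hn0']
      have h3 := mul_le_mul_of_nonneg_right h1 (sq_nonneg ‖g‖)
      linarith
    · rw [unitResidual, norm_smul, norm_inv, norm_norm, inv_mul_cancel₀ hr.ne']
    · have : covSum (X n) (unitResidual (X n) (μ n)) =
          ‖residual (X n) (μ n)‖⁻¹ • covSum (X n) (residual (X n) (μ n)) := by
        simp only [covSum, unitResidual, PiLp.smul_apply, smul_eq_mul, mul_smul, Finset.smul_sum]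
      rw [this, covSum_residual, smul_zero]
    · have : (2 : ℝ) ≤ 1 * L ^ 6 := by linarith
      exact this.trans (mul_le_mul_of_nonneg_right hM1.2.2.2 (by positivity))
    · exact hn
    · positivity
    · rw [div_le_div_iff₀ hL0 (by norm_num)]
      linarith
    · positivity
    · calc 16 * ξ ^ 2 ≤ 16 * (D * L) := by linarith
        _ = c * (16 * D / c * L) := by field_simp
        _ ≤ c * (M * L ^ 6) := by
          have := hM1.2.2.1
          gcongr
    · calc 2 * (2 * L ^ 2 * (2 * ξ ^ 2 / c)) ≤ 2 * (4 * D / c * L ^ 3) := by linarith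
        _ = 8 * D / c * L ^ 3 := by ring
        _ ≤ M * L ^ 6 := by
          have := hM1.2.1
          gcongr
    · calc 2 * (2 * L ^ 2 * (2 * ξ ^ 2 / c)) ^ 2 ≤ 2 * (4 * D / c * L ^ 3) ^ 2 := by gcongr
        _ = 32 * D ^ 2 / c ^ 2 * L ^ 6 := by ring
        _ ≤ M * L ^ 6 := by
          have := hM1.1
          gcongr
  · have hlim : Tendsto (fun n : ℕ => M * C₁ ^ 2 * ((Real.log n ^ c₁)⁻¹) ^ 2) atTop (𝓝 0) := by
      simpa using ((tendsto_inv_log_rpow hc₁).pow 2).const_mul (M * C₁ ^ 2)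
    refine squeeze_zero' (Eventually.of_forall fun n => by positivity) ?_ hlim
    filter_upwards [hsup, hL1] with n hs hL
    have hL0 : 0 < Real.log n := by linarith
    calc M * Real.log n ^ 6 * supNorm (unitResidual (X n) (μ n)) ^ 2
        ≤ M * Real.log n ^ 6 * (C₁ * (Real.log n ^ 3)⁻¹ * (Real.log n ^ c₁)⁻¹) ^ 2 := by
          have := supNorm_nonneg (unitResidual (X n) (μ n))
          gcongr
      _ = _ := by field_simp
  · have hlim : Tendsto (fun n : ℕ => (1 + 2 * D / c) * C₁ * (Real.log n ^ c₁)⁻¹) atTop (𝓝 0) := by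
      simpa using (tendsto_inv_log_rpow hc₁).const_mul ((1 + 2 * D / c) * C₁)
    refine squeeze_zero' (Eventually.of_forall fun n => ?_) ?_ hlim
    · have := supNorm_nonneg (unitResidual (X n) (μ n))
      positivity
    filter_upwards [hsup, hL1, hξ] with n hs hL hx
    have hL0 : 0 < Real.log n := by linarith
    have hrp : 0 < Real.log n ^ c₁ := Real.rpow_pos_of_pos hL0 _
    calc (1 + 2 * maxRowNorm (X n) ^ 2 / c) * supNorm (unitResidual (X n) (μ n))
        ≤ (1 * Real.log n ^ 3 + 2 * (D * Real.log n ^ 3) / c) *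
          (C₁ * (Real.log n ^ 3)⁻¹ * (Real.log n ^ c₁)⁻¹) := by
          have h1 : 1 ≤ 1 * Real.log n ^ 3 := by
            rw [one_mul]; exact one_le_pow₀ (by linarith)
          have h2 : Real.log n ≤ Real.log n ^ 3 := le_self_pow₀ (by linarith) (by norm_num)
          have h3 : maxRowNorm (X n) ^ 2 ≤ D * Real.log n ^ 3 :=
            hx.trans (mul_le_mul_of_nonneg_left h2 hD0)
          have := supNorm_nonneg (unitResidual (X n) (μ n))
          gcongr
      _ = _ := by field_simp
  · have hlim : Tendsto (fun n : ℕ => 2 * D ^ 2 / (c ^ 2 * M) * (Real.log n ^ 3)⁻¹)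
        atTop (𝓝 0) := by
      simpa using (tendsto_inv_log_pow three_ne_zero).const_mul (2 * D ^ 2 / (c ^ 2 * M))
    refine squeeze_zero' ?_ ?_ hlim
    · filter_upwards [hL1] with n hL
      have hL0 : 0 < Real.log n := by linarith
      positivity
    filter_upwards [hL1, hξ] with n hL hx
    have hL0 : 0 < Real.log n := by linarith
    calc (1 + Real.log n) * (maxRowNorm (X n) ^ 4 / (c ^ 2 * (M * Real.log n ^ 6)))
        ≤ (2 * Real.log n) * ((D * Real.log n) ^ 2 / (c ^ 2 * (M * Real.log n ^ 6))) := by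
          have h4 : maxRowNorm (X n) ^ 4 ≤ (D * Real.log n) ^ 2 := by
            calc maxRowNorm (X n) ^ 4 = (maxRowNorm (X n) ^ 2) ^ 2 := by ring
              _ ≤ _ := by gcongr
          gcongr
          linarith
      _ = _ := by field_simp

lemma tendsto_mul_exp_neg :
    Tendsto (fun n : ℕ => (n : ℝ) * Real.exp (-(2 * Real.log n ^ 2 * (1 / Real.log n)))) atTop
      (𝓝 0) := by
  refine (tendsto_inv_atTop_zero.comp tendsto_natCast_atTop_atTop).congr' ?_
  filter_upwards [tendsto_log_natCast.eventually_gt_atTop 0, eventually_gt_atTop 0] with n hL hn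
  have hn' : (0 : ℝ) < n := by exact_mod_cast hn
  have h : 2 * Real.log n ^ 2 * (1 / Real.log n) = Real.log n + Real.log n := by
    field_simp; ring
  rw [h, neg_add, Real.exp_add, Real.exp_neg, Real.exp_log hn', Function.comp_apply]
  field_simp

lemma tendsto_eta_add_rho :
    Tendsto (fun n : ℕ => (1 / Real.log n) ^ 2 + 1 / Real.log n) atTop (𝓝 0) := by
  have h : Tendsto (fun n : ℕ => 1 / Real.log n) atTop (𝓝 0) := by
    simpa using tendsto_inv_log_pow one_ne_zero
  simpa using (h.pow 2).add h

/-- If `(1 + log n) g n` tends to zero, so does `g n`. -/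
lemma tendsto_zero_of_one_add_log_mul {g : ℕ → ℝ} (hg : ∀ᶠ n in atTop, 0 ≤ g n)
    (h : Tendsto (fun n : ℕ => (1 + Real.log n) * g n) atTop (𝓝 0)) :
    Tendsto g atTop (𝓝 0) := by
  refine squeeze_zero' hg ?_ h
  filter_upwards [hg, tendsto_log_natCast.eventually_ge_atTop 0] with n hn hL
  nlinarith

lemma tendsto_expect_sq_unitResidual (hφ : ∃ ε > (0 : ℝ), ∀ n, ε ≤ φ n ∧ φ n ≤ 1 - ε)
    (hout : OutcomeRegularity (fun n => residual (X n) (μ n)) β)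
    (hcov : CovariateRegularity X) (hnd : NonDegeneracy fun n => residual (X n) (μ n)) :
    Tendsto (fun n => expect (run (augmented (φ n) (X n)) n) fun s =>
      (inner ℝ s.z (unitResidual (X n) (μ n)) : ℝ) ^ 2) atTop (𝓝 1) := by
  obtain ⟨ε, hε, hφ⟩ := hφ
  obtain ⟨c, hc, M, hM, hR, hA, -, hG⟩ := exists_regime hout hcov hnd
  have hLpos := tendsto_log_natCast.eventually_gt_atTop 0
  have hG0 := tendsto_zero_of_one_add_log_mul (by
    filter_upwards [hLpos] with n hL
    positivity) hG
  rw [tendsto_iff_dist_tendsto_zero]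
  have hlim := (((hA.div_const ε).add (tendsto_mul_exp_neg.const_mul (4 * (1 / ε)))).add
    (hG0.const_mul (128 * (1 / ε)))).add (tendsto_eta_add_rho.add (hG.const_mul 24))
  simp only [zero_div, mul_zero, add_zero] at hlim
  refine squeeze_zero' (Eventually.of_forall fun n => dist_nonneg) ?_ hlim
  filter_upwards [hR, hLpos] with n hRn hL
  have hφ0 : 0 < φ n := hε.trans_le (hφ n).1
  have h := abs_expect_sq_sub_one_le hRn hφ0 (by linarith [(hφ n).2]) (ρ := 1 / Real.log n)
    (by positivity)
  rw [Real.dist_eq]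
  refine h.trans ?_
  have hinv : 1 / φ n ≤ 1 / ε := one_div_le_one_div_of_le hε (hφ n).1
  have e1 : M * Real.log n ^ 6 * supNorm (unitResidual (X n) (μ n)) ^ 2 / φ n ≤
      M * Real.log n ^ 6 * supNorm (unitResidual (X n) (μ n)) ^ 2 / ε :=
    div_le_div_of_nonneg_left (by positivity) hε (hφ n).1
  have e2 : 24 * (1 + 1 / (1 / Real.log n)) * maxRowNorm (X n) ^ 4 /
      (c ^ 2 * (M * Real.log n ^ 6)) = 24 * ((1 + Real.log n) *
        (maxRowNorm (X n) ^ 4 / (c ^ 2 * (M * Real.log n ^ 6)))) := by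
    rw [one_div_one_div]; ring
  rw [e2]
  gcongr

lemma tendsto_expect_exp_unitResidual (hφ : ∃ ε > (0 : ℝ), ∀ n, ε ≤ φ n ∧ φ n ≤ 1 - ε)
    (hout : OutcomeRegularity (fun n => residual (X n) (μ n)) β)
    (hcov : CovariateRegularity X) (hnd : NonDegeneracy fun n => residual (X n) (μ n)) (θ : ℝ) :
    Tendsto (fun n => expect (run (augmented (φ n) (X n)) n) fun s => Complex.exp
      ((θ * inner ℝ s.z (unitResidual (X n) (μ n)) : ℝ) * Complex.I)) atTop
      (𝓝 (Real.exp (-(θ ^ 2 / 2)) : ℂ)) := by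
  obtain ⟨ε, hε, hφ⟩ := hφ
  obtain ⟨c, hc, M, hM, hR, hA, hν, hG⟩ := exists_regime hout hcov hnd
  have hLpos := tendsto_log_natCast.eventually_gt_atTop 0
  have hG0 := tendsto_zero_of_one_add_log_mul (by
    filter_upwards [hLpos] with n hL
    positivity) hG
  rw [tendsto_iff_dist_tendsto_zero]
  have hlim := ((((hA.div_const ε).const_mul (4 * θ ^ 2)).add
    (tendsto_mul_exp_neg.const_mul (4 * 2))).add (hG0.const_mul (128 * 2))).add
      ((((tendsto_eta_add_rho.const_mul (θ ^ 2 / 2)).add (hν.const_mul (4 * |θ| ^ 3))).add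
        ((hν.pow 2).const_mul (θ ^ 4))).add
      (((hG.const_mul (θ ^ 2 / 2)).add ((hν.const_mul (4 * |θ| ^ 3)).mul hG0)).const_mul 24))
  simp only [zero_div, mul_zero, add_zero, ne_eq, OfNat.ofNat_ne_zero, not_false_eq_true,
    zero_pow] at hlim
  have hsmall : ∀ᶠ n in atTop, 2 * |θ| * ((1 + 2 * maxRowNorm (X n) ^ 2 / c) *
      supNorm (unitResidual (X n) (μ n))) ≤ 1 := by
    have h2 := hν.const_mul (2 * |θ|)
    rw [mul_zero] at h2
    exact h2.eventually_le_const one_pos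
  refine squeeze_zero' (Eventually.of_forall fun n => dist_nonneg) ?_ hlim
  filter_upwards [hR, hLpos, hsmall] with n hRn hL hθ
  have hφ0 : 0 < φ n := hε.trans_le (hφ n).1
  have h := norm_expect_exp_sub_gaussian_le hRn hφ0 (by linarith [(hφ n).2])
    (ρ := 1 / Real.log n) (by positivity) le_rfl hθ
  rw [dist_eq_norm]
  refine h.trans ?_
  have e1 : M * Real.log n ^ 6 * supNorm (unitResidual (X n) (μ n)) ^ 2 / φ n ≤
      M * Real.log n ^ 6 * supNorm (unitResidual (X n) (μ n)) ^ 2 / ε :=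
    div_le_div_of_nonneg_left (by positivity) hε (hφ n).1
  rw [one_div_one_div]
  gcongr ?_ + _ + _ + (_ + ?_)
  · gcongr
  · exact le_of_eq (by ring)

/-- The part of the estimator explained by the covariates is negligible. -/
lemma tendsto_expect_sq_covSum (hφ : ∃ ε > (0 : ℝ), ∀ n, ε ≤ φ n ∧ φ n ≤ 1 - ε)
    (hout : OutcomeRegularity (fun n => residual (X n) (μ n)) β)
    (hcov : CovariateRegularity X) (hnd : NonDegeneracy fun n => residual (X n) (μ n)) :
    Tendsto (fun n => expect (run (augmented (φ n) (X n)) n) fun s =>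
      (inner ℝ (covSum (X n) s.z) (β n) / ‖residual (X n) (μ n)‖ : ℝ) ^ 2) atTop (𝓝 0) := by
  obtain ⟨ε, hε, hφ⟩ := hφ
  obtain ⟨_, _, C₁, hC₁, hout⟩ := hout
  obtain ⟨_, _, C₂, hC₂, hcov⟩ := hcov
  obtain ⟨c₃, hc₃, hnd⟩ := hnd
  have hlim : Tendsto (fun n : ℕ => C₂ * d * C₁ / ε * (Real.log n ^ c₃)⁻¹) atTop (𝓝 0) := by
    simpa using (tendsto_inv_log_rpow hc₃).const_mul (C₂ * d * C₁ / ε)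
  refine squeeze_zero' (Eventually.of_forall fun n =>
    expect_nonneg (finite_support_run _ _) fun _ _ => sq_nonneg _) ?_ hlim
  filter_upwards [hout, hcov, hnd, tendsto_log_natCast.eventually_gt_atTop 0] with n h1 h2 h3 hL
  have hfin := finite_support_run (augmented (φ n) (X n)) n
  have hφ0 : 0 < φ n := hε.trans_le (hφ n).1
  have hφ1 : ε ≤ 1 - φ n := by linarith [(hφ n).2]
  have hb := expect_walkFrom_covSum_sq_le hφ0 (by linarith) (X n) (β n) n
  rw [← run_eq_walkFrom] at hb
  have hrw : (fun s : State n => (inner ℝ (covSum (X n) s.z) (β n) /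
      ‖residual (X n) (μ n)‖ : ℝ) ^ 2) = fun s => (‖residual (X n) (μ n)‖ ^ 2)⁻¹ *
      inner ℝ (covSum (X n) s.z) (β n) ^ 2 := by
    funext s; rw [div_pow]; ring
  rw [hrw, expect_const_mul hfin]
  have hr : 0 < Real.log n ^ (2 + c₃) := Real.rpow_pos_of_pos hL _
  have hrc : 0 < Real.log n ^ c₃ := Real.rpow_pos_of_pos hL _
  calc (‖residual (X n) (μ n)‖ ^ 2)⁻¹ *
      (expect (run (augmented (φ n) (X n)) n) fun s => (inner ℝ (covSum (X n) s.z) (β n) : ℝ) ^ 2)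
      ≤ (Real.log n ^ (2 + c₃))⁻¹ * ((C₂ * d * Real.log n) * (C₁ * Real.log n) / ε) := by
        have e1 : maxRowNorm (X n) ^ 2 * ‖β n‖ ^ 2 / (1 - φ n) ≤
            (C₂ * d * Real.log n) * (C₁ * Real.log n) / ε := by
          have := h1.2
          have := h2.2
          gcongr
        refine mul_le_mul (inv_anti₀ hr h3) (hb.trans e1) ?_ (by positivity)
        exact expect_nonneg hfin fun _ _ => sq_nonneg _
    _ = _ := by
        rw [Real.rpow_add hL, Real.rpow_two]
        field_simp

end Asymptotics

/-! ### Removing the negligible part -/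

section Slutsky

variable {α : ℕ → Type*} {p : ∀ n, PMF (α n)} {A T : ∀ n, α n → ℝ}

lemma tendsto_expect_abs_zero (hp : ∀ n, (p n).support.Finite)
    (hT : Tendsto (fun n => expect (p n) fun s => T n s ^ 2) atTop (𝓝 0)) :
    Tendsto (fun n => expect (p n) fun s => |T n s|) atTop (𝓝 0) := by
  have hs := hT.sqrt
  rw [Real.sqrt_zero] at hs
  exact squeeze_zero (fun n => expect_nonneg (hp n) fun _ _ => abs_nonneg _)
    (fun n => Real.le_sqrt_of_sq_le (expect_abs_sq_le (hp n) _)) hs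

/-- A perturbation that vanishes in mean square does not change the limiting second moment. -/
lemma tendsto_expect_add_sq (hp : ∀ n, (p n).support.Finite)
    (hA : Tendsto (fun n => expect (p n) fun s => A n s ^ 2) atTop (𝓝 1))
    (hT : Tendsto (fun n => expect (p n) fun s => T n s ^ 2) atTop (𝓝 0)) :
    Tendsto (fun n => expect (p n) fun s => (A n s + T n s) ^ 2) atTop (𝓝 1) := by
  have hAT : Tendsto (fun n => expect (p n) fun s => A n s * T n s) atTop (𝓝 0) := by
    have hs := (hA.mul hT).sqrt
    rw [mul_zero, Real.sqrt_zero] at hs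
    exact squeeze_zero_norm (fun n => Real.le_sqrt_of_sq_le
      (by rw [Real.norm_eq_abs, sq_abs]; exact expect_mul_sq_le (hp n) _ _)) hs
  have h := (hA.add (hAT.const_mul 2)).add hT
  rw [mul_zero, add_zero, add_zero] at h
  refine h.congr fun n => ?_
  rw [← expect_const_mul (hp n), ← expect_add (hp n), ← expect_add (hp n)]
  refine expect_congr fun s _ => ?_
  ring

lemma norm_exp_mul_I_sub_exp_mul_I_le (x y : ℝ) :
    ‖Complex.exp (x * Complex.I) - Complex.exp (y * Complex.I)‖ ≤ |x - y| := by
  have h : Complex.exp (x * Complex.I) - Complex.exp (y * Complex.I) =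
      Complex.exp (y * Complex.I) * (Complex.exp (Complex.I * ((x - y : ℝ) : ℂ)) - 1) := by
    rw [mul_sub, ← Complex.exp_add, mul_one]
    congr 2
    push_cast
    ring
  rw [h, norm_mul, Complex.norm_exp_ofReal_mul_I, one_mul]
  exact Real.norm_exp_I_mul_ofReal_sub_one_le

/-- Slutsky's theorem for characteristic functions: neither a scaling factor tending to `1` nor a
perturbation that vanishes in mean square changes the limit. -/
lemma tendsto_expect_exp_scaled_add (hp : ∀ n, (p n).support.Finite) {κ : ℕ → ℝ} {θ : ℝ} {l : ℂ}
    (hκ : Tendsto κ atTop (𝓝 1))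
    (hA : Tendsto (fun n => expect (p n) fun s => A n s ^ 2) atTop (𝓝 1))
    (hT : Tendsto (fun n => expect (p n) fun s => T n s ^ 2) atTop (𝓝 0))
    (hl : Tendsto (fun n => expect (p n) fun s => Complex.exp ((θ * A n s : ℝ) * Complex.I))
      atTop (𝓝 l)) :
    Tendsto (fun n => expect (p n) fun s =>
      Complex.exp ((θ * (κ n * (A n s + T n s)) : ℝ) * Complex.I)) atTop (𝓝 l) := by
  have h1 : Tendsto (fun n => |θ| * (|κ n - 1| * √(expect (p n) fun s => A n s ^ 2) +
      |κ n| * expect (p n) fun s => |T n s|)) atTop (𝓝 0) := by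
    have := (((hκ.sub_const 1).abs.mul hA.sqrt).add
      (hκ.abs.mul (tendsto_expect_abs_zero hp hT))).const_mul |θ|
    simpa using this
  have h2 : Tendsto (fun n => (expect (p n) fun s =>
      Complex.exp ((θ * (κ n * (A n s + T n s)) : ℝ) * Complex.I)) -
      expect (p n) fun s => Complex.exp ((θ * A n s : ℝ) * Complex.I)) atTop (𝓝 0) := by
    refine squeeze_zero_norm (fun n => ?_) h1
    rw [← expect_sub (hp n)]
    refine (norm_expect_le (hp n) _).trans ?_
    have hle : ∀ s ∈ (p n).support, ‖Complex.exp ((θ * (κ n * (A n s + T n s)) : ℝ) * Complex.I) -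
        Complex.exp ((θ * A n s : ℝ) * Complex.I)‖ ≤
        |θ| * (|κ n - 1| * |A n s| + |κ n| * |T n s|) := fun s _ => by
      refine (norm_exp_mul_I_sub_exp_mul_I_le _ _).trans ?_
      rw [show θ * (κ n * (A n s + T n s)) - θ * A n s =
        θ * ((κ n - 1) * A n s + κ n * T n s) by ring, abs_mul]
      refine mul_le_mul_of_nonneg_left ((abs_add_le _ _).trans ?_) (abs_nonneg _)
      rw [abs_mul, abs_mul]
    refine (expect_mono (hp n) hle).trans ?_
    rw [expect_const_mul (hp n), expect_add (hp n), expect_const_mul (hp n),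
      expect_const_mul (hp n)]
    gcongr
    exact Real.le_sqrt_of_sq_le (expect_abs_sq_le (hp n) _)
  simpa using h2.add hl

end Slutsky

section Limit

variable {d : ℕ} {φ : ℕ → ℝ} {X : ∀ n : ℕ, Matrix (Fin n) (Fin d) ℝ} {μ : ∀ n : ℕ, Vec n}
  {β : ℕ → Vec d}

/-- The linear statistic splits into its components along the residual and along the columns
of `X`. -/
lemma inner_eq_norm_mul_add {n : ℕ} {X : Matrix (Fin n) (Fin d) ℝ} {μ : Vec n} {β : Vec d}
    (hβ : μ = Matrix.toEuclideanLin X β + residual X μ) (hr : 0 < ‖residual X μ‖) (w : Vec n) :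
    (inner ℝ w μ : ℝ) = ‖residual X μ‖ *
      (inner ℝ w (unitResidual X μ) + inner ℝ (covSum X w) β / ‖residual X μ‖) := by
  have h : (inner ℝ w μ : ℝ) = inner ℝ w (Matrix.toEuclideanLin X β + residual X μ) :=
    congrArg (fun v : Vec n => (inner ℝ w v : ℝ)) hβ
  rw [h, inner_add_right, inner_toEuclideanLin, unitResidual, real_inner_smul_right]
  field_simp
  ring

/-- The second moment of the linear statistic is asymptotic to the squared norm of the
residual. -/
lemma tendsto_expect_inner_sq_div
    (hβ : ∀ n, μ n = Matrix.toEuclideanLin (X n) (β n) + residual (X n) (μ n))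
    (hφ : ∃ ε > (0 : ℝ), ∀ n, ε ≤ φ n ∧ φ n ≤ 1 - ε)
    (hout : OutcomeRegularity (fun n => residual (X n) (μ n)) β)
    (hcov : CovariateRegularity X) (hnd : NonDegeneracy fun n => residual (X n) (μ n)) :
    Tendsto (fun n => (expect (run (augmented (φ n) (X n)) n) fun s =>
      (inner ℝ s.z (μ n) : ℝ) ^ 2) / ‖residual (X n) (μ n)‖ ^ 2) atTop (𝓝 1) := by
  have h := tendsto_expect_add_sq (fun n => finite_support_run (augmented (φ n) (X n)) n)
    (tendsto_expect_sq_unitResidual hφ hout hcov hnd)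
    (tendsto_expect_sq_covSum hφ hout hcov hnd)
  refine h.congr' ?_
  filter_upwards [eventually_residual_pos hnd] with n hr
  simp only [inner_eq_norm_mul_add (hβ n) hr, mul_pow]
  rw [expect_const_mul (finite_support_run _ _), mul_div_cancel_left₀ _ (by positivity)]

lemma tendsto_expect_exp_studentized
    (hβ : ∀ n, μ n = Matrix.toEuclideanLin (X n) (β n) + residual (X n) (μ n))
    (hφ : ∃ ε > (0 : ℝ), ∀ n, ε ≤ φ n ∧ φ n ≤ 1 - ε)
    (hout : OutcomeRegularity (fun n => residual (X n) (μ n)) β)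
    (hcov : CovariateRegularity X) (hnd : NonDegeneracy fun n => residual (X n) (μ n)) (θ : ℝ) :
    Tendsto (fun n => expect (run (augmented (φ n) (X n)) n) fun s => Complex.exp
      ((θ * (inner ℝ s.z (μ n) / √(expect (run (augmented (φ n) (X n)) n) fun s =>
        (inner ℝ s.z (μ n) : ℝ) ^ 2)) : ℝ) * Complex.I)) atTop
      (𝓝 (Real.exp (-(θ ^ 2 / 2)) : ℂ)) := by
  have hκ : Tendsto (fun n => (√((expect (run (augmented (φ n) (X n)) n) fun s =>
      (inner ℝ s.z (μ n) : ℝ) ^ 2) / ‖residual (X n) (μ n)‖ ^ 2))⁻¹) atTop (𝓝 1) := by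
    simpa using (tendsto_expect_inner_sq_div hβ hφ hout hcov hnd).sqrt.inv₀ (by simp)
  refine (tendsto_expect_exp_scaled_add
    (fun n => finite_support_run (augmented (φ n) (X n)) n) hκ
    (tendsto_expect_sq_unitResidual hφ hout hcov hnd)
    (tendsto_expect_sq_covSum hφ hout hcov hnd)
    (tendsto_expect_exp_unitResidual hφ hout hcov hnd θ)).congr' ?_
  filter_upwards [eventually_residual_pos hnd] with n hr
  rw [Real.sqrt_div' _ (sq_nonneg _), Real.sqrt_sq hr.le, inv_div]
  refine expect_congr fun s _ => ?_
  have e : ∀ x y : ℝ, x * (‖residual (X n) (μ n)‖ / y) = ‖residual (X n) (μ n)‖ * x / y :=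
    fun x y => by ring
  rw [mul_comm (_ / _) (_ + _), e, ← inner_eq_norm_mul_add (hβ n) hr]

end Limit

end GSW

end

theorem theorem1p2 (d : ℕ) (φ : ℕ → ℝ)
    (X : ∀ n : ℕ, Matrix (Fin n) (Fin d) ℝ) (a b : ∀ n : ℕ, GSW.Vec n) (β : ℕ → GSW.Vec d)
    (hβ : ∀ n, a n + b n = Matrix.toEuclideanLin (X n) (β n) + GSW.residual (X n) (a n + b n))
    (hφ : ∃ ε > (0 : ℝ), ∀ n, ε ≤ φ n ∧ φ n ≤ 1 - ε)
    (hout : GSW.OutcomeRegularity (fun n => GSW.residual (X n) (a n + b n)) β)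
    (hcov : GSW.CovariateRegularity X)
    (hnd : GSW.NonDegeneracy (fun n => GSW.residual (X n) (a n + b n))) :
    TendstoInDistribution
      (fun (n : ℕ) (z : GSW.Vec n) =>
        (GSW.horvitzThompson (GSW.design (φ n) (X n)) (a n) (b n) z - GSW.ate (a n) (b n)) /
          √(variance (GSW.horvitzThompson (GSW.design (φ n) (X n)) (a n) (b n))
            (GSW.design (φ n) (X n))))
      atTop (id : ℝ → ℝ) (fun n => GSW.design (φ n) (X n)) (gaussianReal 0 1) ∧
    Tendsto
      (fun n : ℕ =>
        variance (GSW.horvitzThompson (GSW.design (φ n) (X n)) (a n) (b n))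
            (GSW.design (φ n) (X n)) /
          (‖GSW.residual (X n) (a n + b n)‖ ^ 2 / (n : ℝ) ^ 2))
      atTop (𝓝 1) := by
  have h0 : ∀ n, 0 < φ n := by
    obtain ⟨ε, hε, h⟩ := hφ
    exact fun n => hε.trans_le (h n).1
  have h1 : ∀ n, φ n ≤ 1 := by
    obtain ⟨ε, hε, h⟩ := hφ
    exact fun n => by linarith [(h n).2]
  refine ⟨⟨fun n => GSW.aemeasurable_studentized (h0 n) (h1 n) (a n) (b n), aemeasurable_id, ?_⟩,
    ?_⟩
  · refine ProbabilityMeasure.tendsto_iff_tendsto_charFun.2 fun θ => ?_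
    have hlim : charFun ((gaussianReal 0 1).map (id : ℝ → ℝ)) θ =
        (Real.exp (-(θ ^ 2 / 2)) : ℂ) := by
      rw [Measure.map_id, charFun_gaussianReal]
      push_cast
      congr 1
      simp
    simp only [ProbabilityMeasure.coe_mk, hlim]
    refine (GSW.tendsto_expect_exp_studentized hβ hφ hout hcov hnd θ).congr' ?_
    filter_upwards [eventually_ne_atTop 0] with n hn
    exact (GSW.charFun_map_studentized (h0 n) (h1 n) hn (a n) (b n) θ).symm
  · refine (GSW.tendsto_expect_inner_sq_div hβ hφ hout hcov hnd).congr' ?_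
    filter_upwards [eventually_ne_atTop 0] with n hn
    rw [GSW.variance_horvitzThompson (h0 n) (h1 n), div_div_div_cancel_right₀ (by positivity)]
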